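/- Let $G$ be a compact, simple, simply connected Lie group with Lie algebra $\mathfrak g$. Let $U\mathfrak g$ be the universal enveloping algebra of $\mathfrak g\otimes_{\mathbb R}\mathbb C$, $Z(\mathfrak g)$ its center and $S$ its antipode. Let $N\ge 1$, read indices cyclically modulo $N$, and let $V_{\mu_1},\dots,V_{\mu_N}$ be irreducible finite-dimensional complex (smooth) representations of $G$. Let $\mathcal R(G^N)$ be the span of the matrix elements of all finite-dimensional representations of $G^N$. The gauge action of $h\in G^N$ on $G^N$ is $(g^h)_j=h_j g_j h_{j+1}^{-1}$; it acts on functions by $(h\cdot f)(g)=f(g^{h^{-1}})$. Put $$\mathcal R_\mu=\bigl(\mathcal R(G^N)\otimes V_{\mu_1}\otimes\dots\otimes V_{\mu_N}\bigr)^{G^N},$$ where $h\in G^N$ acts on $V_{\mu_1}\otimes\dots\otimes V_{\mu_N}$ with $h_j$ acting in $V_{\mu_j}$. For an $N$-tuple $\nu=(\nu_1,\dots,\nu_N)$ of isomorphism classes of irreducible finite-dimensional representations of $G$ let $\mathcal R^{(\nu)}(G^N)$ be the span of the matrix elements of the $G^N$-representation $V_{\nu_1}\otimes\dots\otimes V_{\nu_N}$,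 and put $\mathcal R_\mu^{(\nu)}=\bigl(\mathcal R^{(\nu)}(G^N)\otimes V_{\mu_1}\otimes\dots\otimes V_{\mu_N}\bigr)^{G^N}\subset\mathcal R_\mu$. The algebra $(U\mathfrak g\otimes U\mathfrak g)^{\otimes N}$ acts on $\mathcal R(G^N)$: in the $j$-th factor, $X\otimes 1$ and $1\otimes X$ ($X\in\mathfrak g$) act by $\frac{d}{dt}f(\dots,e^{-tX}g_j,\dots)|_{t=0}$ and $\frac{d}{dt}f(\dots,g_je^{tX},\dots)|_{t=0}$. The action factors through $(U\mathfrak g\otimes_{Z(\mathfrak g)}U\mathfrak g)^{\otimes N}$, where $az\otimes b=a\otimes S(z)b$ for $z\in Z(\mathfrak g)$. The gauge group acts on this algebra, $h$ acting in the $j$-th factor by $\mathrm{Ad}(h_j)\otimes\mathrm{Ad}(h_{j+1})$. Let $\mathbb D(G^N)^{G^N}$ be the algebra of gauge invariant differential operators on $G^N$ that preserve $\mathcal R(G^N)$. Let $$I_\mu,\qquad J_\mu,\qquad A_\mu$$ be the images in $\mathrm{End}(\mathcal R_\mu)$ of $Z(\mathfrak g)^{\otimes N}$ (in the left factors), of $\bigl((U\mathfrak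 g\otimes_{Z(\mathfrak g)}U\mathfrak g)^{\otimes N}\bigr)^{G^N}$ and of $\mathbb D(G^N)^{G^N}$, respectively, and let $Z(I_\mu,A_\mu)$ be the centralizer of $I_\mu$ in $A_\mu$. **Theorem.** One has $I_\mu\subset J_\mu\subset Z(I_\mu,A_\mu)\subset A_\mu$, and $$\mathcal R_\mu=\bigoplus_\nu\mathcal R_\mu^{(\nu)}$$ is the decomposition of $\mathcal R_\mu$ into joint eigenspaces of $I_\mu$ and the multiplicity free decomposition of $\mathcal R_\mu$ into irreducible $J_\mu$-modules. That is: each nonzero $\mathcal R_\mu^{(\nu)}$ is the full joint eigenspace $\{f\in\mathcal R_\mu: Tf=\chi(T)f\ \ \forall\, T\in I_\mu\}$ of a character $\chi$ of $I_\mu$; each nonzero $\mathcal R_\mu^{(\nu)}$ is an irreducible $J_\mu$-module; and the nonzero modules $\mathcal R_\mu^{(\nu)}$ for distinct $\nu$ are not isomorphic. **Corollary.** Every $\mathcal R_\mu^{(\nu)}$ is stable under $Z(I_\mu,A_\mu)$, and the images of $J_\mu$ and $Z(I_\mu,A_\mu)$ in $\mathrm{End}(\mathcal R_\mu^{(\nu)})$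 coincide: $J_\mu^{(\nu)}=Z(I_\mu,A_\mu)^{(\nu)}$. In this sense the chain $I_\mu\subset J_\mu\subset A_\mu$ is a simple quantum superintegrable system. -/

import Mathlib

open scoped Manifold ContDiff TensorProduct Topology

namespace SpinChain

noncomputable section

set_option linter.unusedSectionVars false

instance instLEInftyMinSmoothness : ENat.LEInfty (minSmoothness ℝ 3) :=
  ⟨by rw [minSmoothness_of_isRCLikeNormedField]; exact ENat.LEInfty.out⟩

/-- The derivative `dφ_x(v)` of a vector-valued function on a manifold. -/
def dirDeriv {E F : Type*} [NormedAddCommGroup E] [NormedSpace ℝ E]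
    [NormedAddCommGroup F] [NormedSpace ℝ F] {M : Type*} [TopologicalSpace M] [ChartedSpace E M]
    (φ : M → F) (x : M) (v : TangentSpace 𝓘(ℝ, E) x) : F :=
  mfderiv 𝓘(ℝ, E) 𝓘(ℝ, F) φ x v

section VectorFields

variable {E F : Type*} [NormedAddCommGroup E] [NormedSpace ℝ E]
    [NormedAddCommGroup F] [NormedSpace ℝ F]
    {M : Type*} [TopologicalSpace M] [ChartedSpace E M] [IsManifold 𝓘(ℝ, E) ∞ M]

/-- A vector field read in the preferred chart at `x`. -/
def chartField (x : M) (U : ∀ x : M, TangentSpace 𝓘(ℝ, E) x) : E → E :=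
  VectorField.mpullbackWithin 𝓘(ℝ, E) 𝓘(ℝ, E) (extChartAt 𝓘(ℝ, E) x).symm U Set.univ

theorem chartField_apply (x : M) (U : ∀ x : M, TangentSpace 𝓘(ℝ, E) x) {y : E}
    (hy : y ∈ (extChartAt 𝓘(ℝ, E) x).target) :
    chartField x U y = mfderiv 𝓘(ℝ, E) 𝓘(ℝ, E) (extChartAt 𝓘(ℝ, E) x)
      ((extChartAt 𝓘(ℝ, E) x).symm y) (U ((extChartAt 𝓘(ℝ, E) x).symm y)) := by
  have a := mfderivWithin_extChartAt_symm_comp_mfderiv_extChartAt (I := 𝓘(ℝ, E)) hy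
  have b := mfderiv_extChartAt_comp_mfderivWithin_extChartAt_symm (I := 𝓘(ℝ, E)) hy
  simp only [modelWithCornersSelf_coe, Set.range_id] at a b
  unfold chartField
  rw [VectorField.mpullbackWithin_apply, ContinuousLinearMap.inverse_eq a b]
  rfl

theorem differentiableAt_chartField [CompleteSpace E] (x : M)
    {U : ∀ x : M, TangentSpace 𝓘(ℝ, E) x}
    (hU : MDifferentiableAt 𝓘(ℝ, E) 𝓘(ℝ, E).tangent
      (fun y => (U y : TangentBundle 𝓘(ℝ, E) M)) x) :
    DifferentiableAt ℝ (chartField x U) (extChartAt 𝓘(ℝ, E) x x) := by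
  have := MDifferentiableWithinAt.differentiableWithinAt_mpullbackWithin_vectorField
    (I := 𝓘(ℝ, E)) (s := Set.univ) hU.mdifferentiableWithinAt
  simp only [modelWithCornersSelf_coe, Set.range_id, Set.preimage_univ, Set.univ_inter] at this
  exact differentiableWithinAt_univ.1 this

theorem eventuallyEq_comp_chart (φ : M → F) (x : M) {z : M}
    (hz : z ∈ (extChartAt 𝓘(ℝ, E) x).source) :
    φ =ᶠ[𝓝 z] (φ ∘ (extChartAt 𝓘(ℝ, E) x).symm) ∘ (extChartAt 𝓘(ℝ, E) x) := by
  filter_upwards [(isOpen_extChartAt_source (I := 𝓘(ℝ, E)) x).mem_nhds hz] with y hy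
  simp only [Function.comp, (extChartAt 𝓘(ℝ, E) x).left_inv hy]

theorem dirDeriv_eq_chart (x : M) (φ : M → F) {z : M} (hz : z ∈ (extChartAt 𝓘(ℝ, E) x).source)
    (hφ : DifferentiableAt ℝ (φ ∘ (extChartAt 𝓘(ℝ, E) x).symm) (extChartAt 𝓘(ℝ, E) x z))
    (v : TangentSpace 𝓘(ℝ, E) z) :
    dirDeriv φ z v = fderiv ℝ (φ ∘ (extChartAt 𝓘(ℝ, E) x).symm) (extChartAt 𝓘(ℝ, E) x z)
      (mfderiv 𝓘(ℝ, E) 𝓘(ℝ, E) (extChartAt 𝓘(ℝ, E) x) z v) := by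
  have hd : MDifferentiableAt 𝓘(ℝ, E) 𝓘(ℝ, E) (extChartAt 𝓘(ℝ, E) x) z :=
    mdifferentiableAt_extChartAt (by rwa [extChartAt_source] at hz)
  unfold dirDeriv
  rw [(eventuallyEq_comp_chart φ x hz).mfderiv_eq, mfderiv_comp z hφ.mdifferentiableAt hd,
    mfderiv_eq_fderiv]
  rfl

theorem contDiffAt_chart {φ : M → F} {x : M} (hφ : ContMDiffAt 𝓘(ℝ, E) 𝓘(ℝ, F) ∞ φ x) :
    ContDiffAt ℝ ∞ (φ ∘ (extChartAt 𝓘(ℝ, E) x).symm) (extChartAt 𝓘(ℝ, E) x x) := by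
  have := (contMDiffAt_iff.1 hφ).2
  simp only [modelWithCornersSelf_coe, Set.range_id, contDiffWithinAt_univ] at this
  exact this

theorem dirDeriv_field_eventuallyEq {φ : M → F} {x : M}
    (hφ : ContMDiffAt 𝓘(ℝ, E) 𝓘(ℝ, F) ∞ φ x) (U : ∀ x : M, TangentSpace 𝓘(ℝ, E) x) :
    (fun y => dirDeriv φ y (U y)) ∘ (extChartAt 𝓘(ℝ, E) x).symm =ᶠ[𝓝 (extChartAt 𝓘(ℝ, E) x x)]
      fun y => fderiv ℝ (φ ∘ (extChartAt 𝓘(ℝ, E) x).symm) y (chartField x U y) := by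
  have h2 : ∀ᶠ y in 𝓝 (extChartAt 𝓘(ℝ, E) x x),
      ContDiffAt ℝ 1 (φ ∘ (extChartAt 𝓘(ℝ, E) x).symm) y :=
    ((contDiffAt_chart hφ).of_le (m := 1) ENat.LEInfty.out).eventually (by simp)
  filter_upwards [extChartAt_target_mem_nhds x, h2] with y hy hy2
  have h1 := dirDeriv_eq_chart x φ ((extChartAt 𝓘(ℝ, E) x).map_target hy)
    (by rw [(extChartAt 𝓘(ℝ, E) x).right_inv hy]; exact hy2.differentiableAt one_ne_zero)
    (U ((extChartAt 𝓘(ℝ, E) x).symm y))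
  rw [chartField_apply x U hy]
  simp only [Function.comp]
  rw [h1, (extChartAt 𝓘(ℝ, E) x).right_inv hy]

theorem differentiableAt_dirDeriv_chart [CompleteSpace E] {φ : M → F} {x : M}
    (hφ : ContMDiffAt 𝓘(ℝ, E) 𝓘(ℝ, F) ∞ φ x) {U : ∀ x : M, TangentSpace 𝓘(ℝ, E) x}
    (hU : MDifferentiableAt 𝓘(ℝ, E) 𝓘(ℝ, E).tangent
      (fun y => (U y : TangentBundle 𝓘(ℝ, E) M)) x) :
    DifferentiableAt ℝ ((fun y => dirDeriv φ y (U y)) ∘ (extChartAt 𝓘(ℝ, E) x).symm)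
      (extChartAt 𝓘(ℝ, E) x x) := by
  have hfd : DifferentiableAt ℝ (fderiv ℝ (φ ∘ (extChartAt 𝓘(ℝ, E) x).symm))
      (extChartAt 𝓘(ℝ, E) x x) :=
    (((contDiffAt_chart hφ).of_le (m := 2) ENat.LEInfty.out).fderiv_right (m := 1)
      (by norm_num [one_add_one_eq_two])).differentiableAt one_ne_zero
  exact (hfd.clm_apply (differentiableAt_chartField x hU)).congr_of_eventuallyEq
    (dirDeriv_field_eventuallyEq hφ U)

theorem mdifferentiableAt_dirDeriv [CompleteSpace E] {φ : M → F} {x : M}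
    (hφ : ContMDiffAt 𝓘(ℝ, E) 𝓘(ℝ, F) ∞ φ x) {U : ∀ x : M, TangentSpace 𝓘(ℝ, E) x}
    (hU : MDifferentiableAt 𝓘(ℝ, E) 𝓘(ℝ, E).tangent
      (fun y => (U y : TangentBundle 𝓘(ℝ, E) M)) x) :
    MDifferentiableAt 𝓘(ℝ, E) 𝓘(ℝ, F) (fun y => dirDeriv φ y (U y)) x := by
  have hx : x ∈ (extChartAt 𝓘(ℝ, E) x).source := mem_extChartAt_source x
  refine MDifferentiableAt.congr_of_eventuallyEq ?_ (eventuallyEq_comp_chart _ x hx)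
  exact (differentiableAt_dirDeriv_chart hφ hU).mdifferentiableAt.comp x
    (mdifferentiableAt_extChartAt (mem_chart_source E x))

/-- The Lie bracket of vector fields acts on functions as a commutator. -/
theorem dirDeriv_mlieBracket [CompleteSpace E] {φ : M → F} {x : M}
    (hφ : ContMDiffAt 𝓘(ℝ, E) 𝓘(ℝ, F) ∞ φ x) {V W : ∀ x : M, TangentSpace 𝓘(ℝ, E) x}
    (hV : MDifferentiableAt 𝓘(ℝ, E) 𝓘(ℝ, E).tangent (fun y => (V y : TangentBundle 𝓘(ℝ, E) M)) x)
    (hW : MDifferentiableAt 𝓘(ℝ, E) 𝓘(ℝ, E).tangent (fun y => (W y : TangentBundle 𝓘(ℝ, E) M)) x) :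
    dirDeriv φ x (VectorField.mlieBracket 𝓘(ℝ, E) V W x) =
      dirDeriv (fun y => dirDeriv φ y (W y)) x (V x) -
      dirDeriv (fun y => dirDeriv φ y (V y)) x (W x) := by
  have hx : x ∈ (extChartAt 𝓘(ℝ, E) x).source := mem_extChartAt_source x
  have hVd := differentiableAt_chartField x hV
  have hWd := differentiableAt_chartField x hW
  have e1 : ∀ U : ∀ x : M, TangentSpace 𝓘(ℝ, E) x,
      chartField x U (extChartAt 𝓘(ℝ, E) x x) =
        mfderiv 𝓘(ℝ, E) 𝓘(ℝ, E) (extChartAt 𝓘(ℝ, E) x) x (U x) := by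
    intro U
    rw [chartField_apply x U ((extChartAt 𝓘(ℝ, E) x).map_source hx),
      (extChartAt 𝓘(ℝ, E) x).left_inv hx]
  rw [dirDeriv_eq_chart x _ hx (differentiableAt_dirDeriv_chart hφ hW),
    dirDeriv_eq_chart x _ hx (differentiableAt_dirDeriv_chart hφ hV),
    (dirDeriv_field_eventuallyEq hφ W).fderiv_eq, (dirDeriv_field_eventuallyEq hφ V).fderiv_eq,
    ← e1 V, ← e1 W, dirDeriv_eq_chart x φ hx ((contDiffAt_chart hφ).differentiableAt (by simp))]
  have br : (mfderiv 𝓘(ℝ, E) 𝓘(ℝ, E) (extChartAt 𝓘(ℝ, E) x) x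
      (VectorField.mlieBracket 𝓘(ℝ, E) V W x) : E) =
      VectorField.lieBracket ℝ (chartField x V) (chartField x W) (extChartAt 𝓘(ℝ, E) x x) := by
    have hinv : (mfderiv 𝓘(ℝ, E) 𝓘(ℝ, E) (extChartAt 𝓘(ℝ, E) x) x).IsInvertible :=
      isInvertible_mfderiv_extChartAt hx
    rw [← VectorField.mlieBracketWithin_univ, VectorField.mlieBracketWithin_apply]
    simp only [modelWithCornersSelf_coe, Set.range_id, Set.preimage_univ, Set.univ_inter]
    rw [← VectorField.lieBracketWithin_univ]
    exact hinv.self_apply_inverse _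
  erw [br]
  exact VectorField.fderiv_apply_lieBracket (contDiffAt_chart hφ) (n := ∞)
   (by rw [minSmoothness_of_isRCLikeNormedField]; exact ENat.LEInfty.out) hWd hVd

end VectorFields

theorem contMDiff_toPi {E₁ H₁ M₁ : Type*} [NormedAddCommGroup E₁] [NormedSpace ℝ E₁]
    [TopologicalSpace H₁] {I₁ : ModelWithCorners ℝ E₁ H₁} [TopologicalSpace M₁] [ChartedSpace H₁ M₁]
    {ι : Type} [Fintype ι] {E G : Type*} [NormedAddCommGroup E] [NormedSpace ℝ E]
    [TopologicalSpace G] [ChartedSpace E G] {f : M₁ → ι → G}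
    (hf : ∀ i, ContMDiff I₁ 𝓘(ℝ, E) ∞ fun x => f x i) :
    ContMDiff I₁ (ModelWithCorners.pi fun _ : ι => 𝓘(ℝ, E)) ∞ f := by
  intro x
  rw [contMDiffAt_iff]
  refine ⟨continuousAt_pi.2 fun i => (hf i).continuous.continuousAt, ?_⟩
  refine contDiffWithinAt_pi.2 fun i => ?_
  exact (contMDiffAt_iff.1 (hf i x)).2

section
variable {E F : Type*} [NormedAddCommGroup E] [NormedSpace ℝ E]
    [NormedAddCommGroup F] [NormedSpace ℝ F]
    {G : Type*} [TopologicalSpace G] [ChartedSpace E G] [Group G] [LieGroup 𝓘(ℝ, E) ∞ G]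

theorem dirDeriv_mulInvariantVectorField {φ : G → F} {x : G}
    (hφ : MDifferentiableAt 𝓘(ℝ, E) 𝓘(ℝ, F) φ x) (Y : GroupLieAlgebra 𝓘(ℝ, E) G) :
    dirDeriv φ x (mulInvariantVectorField Y x) = dirDeriv (fun y => φ (x * y)) (1 : G) Y := by
  unfold dirDeriv mulInvariantVectorField
  have h1 : MDifferentiableAt 𝓘(ℝ, E) 𝓘(ℝ, E) (fun y : G => x * y) 1 :=
    (contMDiff_mul_left (n := ∞) (I := 𝓘(ℝ, E)) (a := x)).mdifferentiable (by simp) 1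
  have hφ' : MDifferentiableAt 𝓘(ℝ, E) 𝓘(ℝ, F) φ (x * 1) := by rwa [mul_one]
  have := mfderiv_comp (1 : G) hφ' h1
  rw [show (fun y => φ (x * y)) = φ ∘ (fun y : G => x * y) from rfl, this, mul_one]
  rfl

theorem dirDeriv_bracket [CompleteSpace E] {φ : G → F} (hφ : ContMDiffAt 𝓘(ℝ, E) 𝓘(ℝ, F) ∞ φ 1)
    (X Y : GroupLieAlgebra 𝓘(ℝ, E) G) :
    dirDeriv φ (1 : G) ⁅X, Y⁆ =
      dirDeriv (fun x : G => dirDeriv (fun y : G => φ (x * y)) (1 : G) Y) (1 : G) X -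
      dirDeriv (fun x : G => dirDeriv (fun y : G => φ (x * y)) (1 : G) X) (1 : G) Y := by
  have hd : ∀ Z : GroupLieAlgebra 𝓘(ℝ, E) G,
      MDifferentiableAt 𝓘(ℝ, E) 𝓘(ℝ, E).tangent
        (fun y => (mulInvariantVectorField Z y : TangentBundle 𝓘(ℝ, E) G)) 1 :=
    fun Z => mdifferentiableAt_mulInvariantVectorField Z
  have h1 := dirDeriv_mlieBracket hφ (hd X) (hd Y)
  have hev : ∀ Z : GroupLieAlgebra 𝓘(ℝ, E) G,
      (fun x : G => dirDeriv φ x (mulInvariantVectorField Z x)) =ᶠ[𝓝 1]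
        fun x : G => dirDeriv (fun y : G => φ (x * y)) (1 : G) Z := by
    intro Z
    have : ∀ᶠ x in 𝓝 (1 : G), ContMDiffAt 𝓘(ℝ, E) 𝓘(ℝ, F) 1 φ x :=
      (contMDiffAt_iff_contMDiffAt_nhds (by simp)).1
        (hφ.of_le (m := 1) ENat.LEInfty.out)
    filter_upwards [this] with x hx
    exact dirDeriv_mulInvariantVectorField (hx.mdifferentiableAt one_ne_zero) Z
  have h0 : ∀ Z : GroupLieAlgebra 𝓘(ℝ, E) G, mulInvariantVectorField Z (1 : G) = Z := by
    intro Z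
    have e : (fun b : G => 1 * b) = id := funext one_mul
    change (mfderiv 𝓘(ℝ, E) 𝓘(ℝ, E) (fun b : G => 1 * b) 1 : E →L[ℝ] E) Z = Z
    rw [e]
    exact congrArg (fun L : E →L[ℝ] E => L Z) (mfderiv_id (I := 𝓘(ℝ, E)) (x := (1 : G)))
  rw [GroupLieAlgebra.bracket_def, h1, h0, h0]
  unfold dirDeriv at hev ⊢
  rw [(hev X).mfderiv_eq, (hev Y).mfderiv_eq]
  rfl

theorem contMDiff_conj (h : G) :
    ContMDiff 𝓘(ℝ, E) 𝓘(ℝ, E) ∞ (fun x : G => h * x * h⁻¹) :=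
  (contMDiff_mul_right (a := h⁻¹)).comp (contMDiff_mul_left (a := h))


/-- The adjoint action of `h` on the Lie algebra: the derivative at `1` of `x ↦ h x h⁻¹`. -/
def adLin (h : G) : GroupLieAlgebra 𝓘(ℝ, E) G →ₗ[ℝ] GroupLieAlgebra 𝓘(ℝ, E) G where
  toFun X := mfderiv 𝓘(ℝ, E) 𝓘(ℝ, E) (fun x : G => h * x * h⁻¹) 1 X
  map_add' X Y := map_add (mfderiv 𝓘(ℝ, E) 𝓘(ℝ, E) (fun x : G => h * x * h⁻¹) 1) X Y
  map_smul' c X := map_smul (mfderiv 𝓘(ℝ, E) 𝓘(ℝ, E) (fun x : G => h * x * h⁻¹) 1) c X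

theorem dirDeriv_adLin {φ : G → F} (hφ : MDifferentiableAt 𝓘(ℝ, E) 𝓘(ℝ, F) φ 1) (h : G)
    (X : GroupLieAlgebra 𝓘(ℝ, E) G) :
    dirDeriv φ (1 : G) (adLin h X) = dirDeriv (fun x : G => φ (h * x * h⁻¹)) (1 : G) X := by
  have e : h * 1 * h⁻¹ = 1 := by simp
  have hφ' : MDifferentiableAt 𝓘(ℝ, E) 𝓘(ℝ, F) φ (h * 1 * h⁻¹) := by rwa [e]
  have := mfderiv_comp (1 : G) hφ' ((contMDiff_conj (E := E) h).mdifferentiable (by simp) 1)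
  unfold dirDeriv
  rw [show (fun x => φ (h * x * h⁻¹)) = φ ∘ (fun x : G => h * x * h⁻¹) from rfl, this, e]
  rfl

theorem adLin_lie [CompleteSpace E] (h : G) (X Y : GroupLieAlgebra 𝓘(ℝ, E) G) :
    adLin h ⁅X, Y⁆ = ⁅adLin h X, adLin h Y⁆ := by
  have hφ : ContMDiffAt 𝓘(ℝ, E) 𝓘(ℝ, E) ∞ (extChartAt 𝓘(ℝ, E) (1 : G)) 1 :=
    contMDiffAt_extChartAt
  have e : h * 1 * h⁻¹ = 1 := by simp
  have hd := hφ.mdifferentiableAt (by simp)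
  have hinv : (mfderiv 𝓘(ℝ, E) 𝓘(ℝ, E) (extChartAt 𝓘(ℝ, E) (1 : G)) 1).IsInvertible :=
    isInvertible_mfderiv_extChartAt (mem_extChartAt_source 1)
  have hinj : ∀ u v : GroupLieAlgebra 𝓘(ℝ, E) G, dirDeriv (extChartAt 𝓘(ℝ, E) (1 : G)) (1 : G) u =
      dirDeriv (extChartAt 𝓘(ℝ, E) (1 : G)) (1 : G) v → u = v :=
    fun u v huv => hinv.injective huv
  apply hinj
  generalize (extChartAt 𝓘(ℝ, E) (1 : G) : G → E) = φ at hφ hd ⊢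
  have hφc : ContMDiffAt 𝓘(ℝ, E) 𝓘(ℝ, E) ∞ (fun x : G => φ (h * x * h⁻¹)) 1 :=
    ContMDiffAt.comp (1 : G) (by rwa [e]) (contMDiff_conj h 1)
  rw [dirDeriv_adLin hd, dirDeriv_bracket hφc, dirDeriv_bracket hφ]
  have hev : ∀ᶠ x in 𝓝 (1 : G), ContMDiffAt 𝓘(ℝ, E) 𝓘(ℝ, E) 1 φ x :=
    (contMDiffAt_iff_contMDiffAt_nhds (by simp)).1 (hφ.of_le (m := 1) ENat.LEInfty.out)
  have key : ∀ A B : GroupLieAlgebra 𝓘(ℝ, E) G,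
      dirDeriv (fun x : G => dirDeriv (fun y : G => φ (x * y)) (1 : G) (adLin h B)) (1 : G)
        (adLin h A) =
      dirDeriv (fun x : G => dirDeriv (fun y : G => φ (h * (x * y) * h⁻¹)) (1 : G) B) (1 : G) A := by
    intro A B
    have hB : MDifferentiableAt 𝓘(ℝ, E) 𝓘(ℝ, E)
        (fun x : G => dirDeriv (fun y : G => φ (x * y)) (1 : G) (adLin h B)) 1 := by
      refine (mdifferentiableAt_dirDeriv hφ
        (mdifferentiableAt_mulInvariantVectorField (adLin h B))).congr_of_eventuallyEq ?_
      filter_upwards [hev] with x hx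
      exact (dirDeriv_mulInvariantVectorField (hx.mdifferentiableAt one_ne_zero) _).symm
    rw [dirDeriv_adLin hB]
    have hev' : (fun x : G => dirDeriv (fun y : G => φ (h * x * h⁻¹ * y)) (1 : G) (adLin h B))
        =ᶠ[𝓝 1] fun x : G => dirDeriv (fun y : G => φ (h * (x * y) * h⁻¹)) (1 : G) B := by
      have hc : Filter.Tendsto (fun x : G => h * x * h⁻¹) (𝓝 1) (𝓝 1) := by
        have := (contMDiff_conj (E := E) h).continuous.tendsto (1 : G)
        rwa [e] at this
      filter_upwards [hc.eventually hev] with x hx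
      have hx' : MDifferentiableAt 𝓘(ℝ, E) 𝓘(ℝ, E) (fun y : G => φ (h * x * h⁻¹ * y)) 1 := by
        refine MDifferentiableAt.comp (1 : G) (g := φ) ?_
          ((contMDiff_mul_left (n := ∞) (I := 𝓘(ℝ, E))
            (a := h * x * h⁻¹)).mdifferentiable (by simp) 1)
        rw [mul_one]
        exact hx.mdifferentiableAt one_ne_zero
      rw [dirDeriv_adLin hx']
      simp only [mul_assoc, inv_mul_cancel_left]
    unfold dirDeriv at hev' ⊢
    rw [hev'.mfderiv_eq]
    rfl
  rw [key X Y, key Y X]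

end

section Differential

variable {E : Type*} [NormedAddCommGroup E] [NormedSpace ℝ E] [CompleteSpace E]
  {G : Type*} [TopologicalSpace G] [ChartedSpace E G] [Group G] [LieGroup 𝓘(ℝ, E) ∞ G]

/-- A complex representation is smooth if all its matrix elements are smooth functions. -/
def IsSmoothRep {F H : Type*} [NormedAddCommGroup F] [NormedSpace ℝ F] [TopologicalSpace H]
    (J : ModelWithCorners ℝ F H) {K : Type*} [TopologicalSpace K] [ChartedSpace H K] [Group K]
    {V : Type*} [AddCommGroup V] [Module ℂ V] (ρ : Representation ℂ K V) : Prop :=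
  ∀ (v : V) (l : Module.Dual ℂ V), ContMDiff J 𝓘(ℝ, ℂ) ∞ fun k => l (ρ k v)

theorem dirDeriv_add {F : Type*} [NormedAddCommGroup F] [NormedSpace ℝ F] {φ ψ : G → F} {x : G}
    (hφ : MDifferentiableAt 𝓘(ℝ, E) 𝓘(ℝ, F) φ x) (hψ : MDifferentiableAt 𝓘(ℝ, E) 𝓘(ℝ, F) ψ x)
    (X : TangentSpace 𝓘(ℝ, E) x) :
    dirDeriv (fun y => φ y + ψ y) x X = dirDeriv φ x X + dirDeriv ψ x X :=
  congrArg (fun L : E →L[ℝ] F => L X) (hφ.hasMFDerivAt.add hψ.hasMFDerivAt).mfderiv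

theorem dirDeriv_clm {F F' : Type*} [NormedAddCommGroup F] [NormedSpace ℝ F]
    [NormedAddCommGroup F'] [NormedSpace ℝ F'] (L : F →L[ℝ] F') {φ : G → F} {x : G}
    (hφ : MDifferentiableAt 𝓘(ℝ, E) 𝓘(ℝ, F) φ x) (X : TangentSpace 𝓘(ℝ, E) x) :
    dirDeriv (fun y => L (φ y)) x X = L (dirDeriv φ x X) := by
  have := mfderiv_comp x (g := L) L.differentiableAt.mdifferentiableAt hφ
  unfold dirDeriv
  rw [show (fun y => L (φ y)) = L ∘ φ from rfl, this, mfderiv_eq_fderiv, L.fderiv]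
  rfl

theorem dirDeriv_const_mul {φ : G → ℂ} {x : G}
    (hφ : MDifferentiableAt 𝓘(ℝ, E) 𝓘(ℝ, ℂ) φ x) (a : ℂ) (X : TangentSpace 𝓘(ℝ, E) x) :
    dirDeriv (fun y => a * φ y) x X = a * dirDeriv φ x X :=
  dirDeriv_clm (ContinuousLinearMap.mul ℝ ℂ a) hφ X

variable (E G) in
/-- The complexified Lie algebra of `G`. -/
abbrev LieC := ℂ ⊗[ℝ] GroupLieAlgebra 𝓘(ℝ, E) G

variable (E G) in
/-- The universal enveloping algebra of the complexified Lie algebra of `G`. -/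
abbrev Ug := UniversalEnvelopingAlgebra ℂ (LieC E G)

variable {V : Type*} [AddCommGroup V] [Module ℂ V]

theorem eq_of_dual {v w : V} (h : ∀ l : Module.Dual ℂ V, l v = l w) : v = w := by
  rw [← sub_eq_zero, ← Module.forall_dual_apply_eq_zero_iff ℂ]
  intro l
  rw [map_sub, h, sub_self]

variable (E) in
/-- Every orbit map `x ↦ π(x) v` is a finite combination of fixed vectors with smooth
coefficients. -/
def IsFinSmooth (π : Representation ℂ G V) : Prop :=
  ∀ v : V, ∃ (d : ℕ) (c : G → Fin d → ℂ) (w : Fin d → V),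
    ContMDiff 𝓘(ℝ, E) 𝓘(ℝ, Fin d → ℂ) ∞ c ∧ ∀ x, π x v = ∑ k, c x k • w k

variable {π : Representation ℂ G V}

/-- The real linear functional `c ↦ l (∑ c_k w_k)`. -/
def coordFun {d : ℕ} (w : Fin d → V) (l : Module.Dual ℂ V) : (Fin d → ℂ) →L[ℝ] ℂ :=
  LinearMap.toContinuousLinearMap ((l ∘ₗ Fintype.linearCombination ℂ w).restrictScalars ℝ)

theorem coordFun_apply {d : ℕ} (w : Fin d → V) (l : Module.Dual ℂ V) (c : Fin d → ℂ) :
    coordFun w l c = l (∑ k, c k • w k) := by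
  simp [coordFun, Fintype.linearCombination_apply]

theorem IsFinSmooth.smooth (h : IsFinSmooth E π) : IsSmoothRep 𝓘(ℝ, E) π := by
  intro v l
  obtain ⟨d, c, w, hc, hw⟩ := h v
  have := (coordFun w l).contMDiff.comp hc
  exact this.congr fun x => by simp only [Function.comp, coordFun_apply, hw]

theorem IsFinSmooth.mdiff (h : IsFinSmooth E π) (v : V) (l : Module.Dual ℂ V) (x : G) :
    MDifferentiableAt 𝓘(ℝ, E) 𝓘(ℝ, ℂ) (fun x => l (π x v)) x :=
  (h.smooth v l).mdifferentiable (by simp) x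

theorem IsFinSmooth.exists_deriv (h : IsFinSmooth E π) (X : GroupLieAlgebra 𝓘(ℝ, E) G) (v : V) :
    ∃ w : V, ∀ l : Module.Dual ℂ V, l w = dirDeriv (fun x => l (π x v)) (1 : G) X := by
  obtain ⟨d, c, w, hc, hw⟩ := h v
  refine ⟨∑ k, dirDeriv c (1 : G) X k • w k, fun l => ?_⟩
  rw [← coordFun_apply, ← dirDeriv_clm _ (hc.mdifferentiable (by simp) 1)]
  simp only [coordFun_apply, hw]

/-- The vector `d/dt π(exp tX) v` at `t = 0`. -/
def diffFun (h : IsFinSmooth E π) (X : GroupLieAlgebra 𝓘(ℝ, E) G) (v : V) : V :=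
  (h.exists_deriv X v).choose

theorem dual_diffFun (h : IsFinSmooth E π) (X : GroupLieAlgebra 𝓘(ℝ, E) G) (v : V)
    (l : Module.Dual ℂ V) : l (diffFun h X v) = dirDeriv (fun x => l (π x v)) (1 : G) X :=
  (h.exists_deriv X v).choose_spec l

/-- The differential `𝔤 → End V`, `X ↦ dπ(X)`, of a representation `π`. -/
def diffReal (h : IsFinSmooth E π) : GroupLieAlgebra 𝓘(ℝ, E) G →ₗ[ℝ] Module.End ℂ V where
  toFun X :=
    { toFun := diffFun h X
      map_add' := fun v w => eq_of_dual fun l => by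
        simp only [map_add, dual_diffFun]
        exact dirDeriv_add (h.mdiff v l 1) (h.mdiff w l 1) X
      map_smul' := fun a v => eq_of_dual fun l => by
        simp only [map_smul, dual_diffFun, smul_eq_mul, RingHom.id_apply]
        exact dirDeriv_const_mul (h.mdiff v l 1) a X }
  map_add' X Y := LinearMap.ext fun v => eq_of_dual fun l => by
    simp only [LinearMap.add_apply, LinearMap.coe_mk, AddHom.coe_mk, map_add, dual_diffFun]
    exact map_add (mfderiv 𝓘(ℝ, E) 𝓘(ℝ, ℂ) (fun x => l (π x v)) 1) X Y
  map_smul' a X := LinearMap.ext fun v => eq_of_dual fun l => by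
    have e := map_smul (mfderiv 𝓘(ℝ, E) 𝓘(ℝ, ℂ) (fun x => l (π x v)) 1) a X
    have e2 : l (a • diffFun h X v) = a • l (diffFun h X v) := by
      rw [← Complex.coe_smul, map_smul, Complex.coe_smul]
    simp only [LinearMap.smul_apply, LinearMap.coe_mk, AddHom.coe_mk, RingHom.id_apply]
    rw [e2, dual_diffFun, dual_diffFun]
    exact e

theorem dual_diffReal (h : IsFinSmooth E π) (X : GroupLieAlgebra 𝓘(ℝ, E) G) (v : V)
    (l : Module.Dual ℂ V) : l (diffReal h X v) = dirDeriv (fun x => l (π x v)) (1 : G) X :=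
  dual_diffFun h X v l

theorem diffReal_lie (h : IsFinSmooth E π) (X Y : GroupLieAlgebra 𝓘(ℝ, E) G) :
    diffReal h ⁅X, Y⁆ = diffReal h X * diffReal h Y - diffReal h Y * diffReal h X := by
  refine LinearMap.ext fun v => eq_of_dual fun l => ?_
  have key : ∀ A B : GroupLieAlgebra 𝓘(ℝ, E) G, l (diffReal h A (diffReal h B v)) =
      dirDeriv (fun x : G => dirDeriv (fun y : G => l (π (x * y) v)) (1 : G) B) (1 : G) A := by
    intro A B
    rw [dual_diffReal]
    congr 1
    funext x
    rw [← LinearMap.comp_apply, dual_diffReal]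
    simp only [map_mul, LinearMap.comp_apply, Module.End.mul_apply]
  rw [dual_diffReal, dirDeriv_bracket (h.smooth v l 1), LinearMap.sub_apply, map_sub,
    Module.End.mul_apply, Module.End.mul_apply, key, key]

theorem lieC_hom_lie {A : Type*} [Ring A] [Algebra ℂ A]
    (f : GroupLieAlgebra 𝓘(ℝ, E) G →ₗ[ℝ] A) (hf : ∀ X Y, f ⁅X, Y⁆ = f X * f Y - f Y * f X)
    (x y : LieC E G) :
    f.liftBaseChange ℂ ⁅x, y⁆ = f.liftBaseChange ℂ x * f.liftBaseChange ℂ y -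
      f.liftBaseChange ℂ y * f.liftBaseChange ℂ x := by
  induction x using TensorProduct.induction_on with
  | zero => simp
  | add x x' hx hx' => simp only [add_lie, map_add, hx, hx', add_mul, mul_add]; abel
  | tmul a X =>
    induction y using TensorProduct.induction_on with
    | zero =>
      have e : ⁅(a ⊗ₜ[ℝ] X : LieC E G), (0 : LieC E G)⁆ = 0 := by
        have := LieRing.lie_add (a ⊗ₜ[ℝ] X : LieC E G) 0 0
        rw [add_zero] at this
        exact left_eq_add.1 this
      rw [e]; simp
    | add y y' hy hy' =>
      have e : ⁅(a ⊗ₜ[ℝ] X : LieC E G), (y + y' : LieC E G)⁆ =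
        ⁅(a ⊗ₜ[ℝ] X : LieC E G), y⁆ + ⁅(a ⊗ₜ[ℝ] X : LieC E G), y'⁆ := LieRing.lie_add _ _ _
      rw [e]; simp only [map_add, hy, hy', add_mul, mul_add]; abel
    | tmul b Y =>
      rw [LieAlgebra.ExtendScalars.bracket_tmul]
      simp only [LinearMap.liftBaseChange_tmul, hf, smul_mul_smul_comm, smul_sub, mul_comm b a]

section
attribute [local instance 100] LieRing.ofAssociativeRing
attribute [local instance 100] LieAlgebra.ofAssociativeAlgebra

/-- The algebra homomorphism `U𝔤 → A` extending a Lie algebra homomorphism `𝔤 → A`. -/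
def ugLift {A : Type*} [Ring A] [Algebra ℂ A]
    (f : GroupLieAlgebra 𝓘(ℝ, E) G →ₗ[ℝ] A) (hf : ∀ X Y, f ⁅X, Y⁆ = f X * f Y - f Y * f X) :
    Ug E G →ₐ[ℂ] A :=
  UniversalEnvelopingAlgebra.lift ℂ
    { toLinearMap := f.liftBaseChange ℂ
      map_lie' := fun {x y} => by
        rw [LieRing.of_associative_ring_bracket]
        exact lieC_hom_lie f hf x y }

/-- The inclusion `𝔤 → U𝔤`. -/
def ugIncl : GroupLieAlgebra 𝓘(ℝ, E) G →ₗ[ℝ] Ug E G :=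
  ((UniversalEnvelopingAlgebra.ι ℂ : LieC E G →ₗ⁅ℂ⁆ Ug E G) :
    LieC E G →ₗ[ℂ] Ug E G).restrictScalars ℝ ∘ₗ (TensorProduct.mk ℝ ℂ _ 1)

theorem ugIncl_lie (X Y : GroupLieAlgebra 𝓘(ℝ, E) G) :
    (ugIncl ⁅X, Y⁆ : Ug E G) = ugIncl X * ugIncl Y - ugIncl Y * ugIncl X := by
  have e : (1 : ℂ) ⊗ₜ[ℝ] ⁅X, Y⁆ = ⁅(1 : ℂ) ⊗ₜ[ℝ] X, (1 : ℂ) ⊗ₜ[ℝ] Y⁆ := by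
    rw [LieAlgebra.ExtendScalars.bracket_tmul, one_mul]
  have := LieHom.map_lie (UniversalEnvelopingAlgebra.ι ℂ : LieC E G →ₗ⁅ℂ⁆ Ug E G)
    ((1 : ℂ) ⊗ₜ[ℝ] X) ((1 : ℂ) ⊗ₜ[ℝ] Y)
  rw [← e, LieRing.of_associative_ring_bracket] at this
  exact this

theorem ugLift_ugIncl {A : Type*} [Ring A] [Algebra ℂ A]
    (f : GroupLieAlgebra 𝓘(ℝ, E) G →ₗ[ℝ] A) (hf : ∀ X Y, f ⁅X, Y⁆ = f X * f Y - f Y * f X)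
    (X : GroupLieAlgebra 𝓘(ℝ, E) G) : ugLift f hf (ugIncl X) = f X := by
  have := UniversalEnvelopingAlgebra.lift_ι_apply ℂ
    { toLinearMap := f.liftBaseChange ℂ
      map_lie' := fun {x y} => by
        rw [LieRing.of_associative_ring_bracket]
        exact lieC_hom_lie f hf x y } ((1 : ℂ) ⊗ₜ[ℝ] X)
  refine this.trans ?_
  change f.liftBaseChange ℂ ((1 : ℂ) ⊗ₜ[ℝ] X) = f X
  simp

theorem ug_hom_ext {A : Type*} [Ring A] [Algebra ℂ A] {f g : Ug E G →ₐ[ℂ] A}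
    (h : ∀ X : GroupLieAlgebra 𝓘(ℝ, E) G, f (ugIncl X) = g (ugIncl X)) : f = g := by
  apply UniversalEnvelopingAlgebra.hom_ext
  ext x
  change f (UniversalEnvelopingAlgebra.ι ℂ x) = g (UniversalEnvelopingAlgebra.ι ℂ x)
  induction x using TensorProduct.induction_on with
  | zero => simp
  | add x y hx hy => rw [map_add, map_add, map_add, hx, hy]
  | tmul a X =>
    have e : a ⊗ₜ[ℝ] X = a • ((1 : ℂ) ⊗ₜ[ℝ] X) := by simp [TensorProduct.smul_tmul']
    rw [e, map_smul, map_smul, map_smul]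
    exact congrArg _ (h X)

end

/-- The adjoint action of `h ∈ G` on `U𝔤`. -/
def adUg (h : G) : Ug E G →ₐ[ℂ] Ug E G :=
  ugLift (ugIncl ∘ₗ adLin h) fun X Y => by
    simp only [LinearMap.comp_apply, adLin_lie, ugIncl_lie]

/-- The antipode of `U𝔤` as an algebra homomorphism to the opposite algebra. -/
def antipodeOp : Ug E G →ₐ[ℂ] (Ug E G)ᵐᵒᵖ :=
  ugLift (-(((MulOpposite.opLinearEquiv ℝ).toLinearMap) ∘ₗ ugIncl)) fun X Y => by
    apply MulOpposite.unop_injective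
    simp [ugIncl_lie]

/-- The antipode of `U𝔤`: the anti-involution acting by `X ↦ -X` on `𝔤`. -/
def antipode (u : Ug E G) : Ug E G := (antipodeOp u).unop

/-- The action of `U𝔤` obtained by differentiating a representation `π` of `G`. -/
def ugAction (h : IsFinSmooth E π) : Ug E G →ₐ[ℂ] Module.End ℂ V :=
  ugLift (diffReal h) (diffReal_lie h)

theorem ugAction_commute (h : IsFinSmooth E π) {T : Module.End ℂ V} (hT : ∀ x, Commute T (π x))
    (u : Ug E G) : Commute T (ugAction h u) := by
  have hX : ∀ X, diffReal h X ∈ Subalgebra.centralizer ℂ {T} := by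
    intro X
    rw [Subalgebra.mem_centralizer_iff]
    rintro _ rfl
    refine LinearMap.ext fun v => eq_of_dual fun l => ?_
    rw [Module.End.mul_apply, Module.End.mul_apply, dual_diffReal, ← LinearMap.comp_apply,
      dual_diffReal]
    congr 1
    funext x
    have := LinearMap.congr_fun (hT x).eq v
    simp only [Module.End.mul_apply] at this
    rw [LinearMap.comp_apply, this]
  let f : GroupLieAlgebra 𝓘(ℝ, E) G →ₗ[ℝ] Subalgebra.centralizer ℂ {T} :=
    { toFun := fun X => ⟨diffReal h X, hX X⟩
      map_add' := fun X Y => Subtype.ext (map_add (diffReal h) X Y)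
      map_smul' := fun a X => Subtype.ext (map_smul (diffReal h) a X) }
  have hf : ∀ X Y, f ⁅X, Y⁆ = f X * f Y - f Y * f X := fun X Y => Subtype.ext (diffReal_lie h X Y)
  have e : (Subalgebra.centralizer ℂ {T}).val.comp (ugLift f hf) = ugAction h :=
    ug_hom_ext fun X => by
      rw [AlgHom.comp_apply, ugLift_ugIncl, ugAction, ugLift_ugIncl]
      rfl
  rw [← e]
  exact (Subalgebra.mem_centralizer_iff ℂ).1 (ugLift f hf u).2 T rfl

end Differential

section Functions

/-- The matrix element `k ↦ l (ρ(k) v)`. -/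
def matrixElement {K V : Type*} [Group K] [AddCommGroup V] [Module ℂ V]
    (ρ : Representation ℂ K V) (v : V) (l : Module.Dual ℂ V) : K → ℂ :=
  fun k => l (ρ k v)

/-- The span `𝓡(K)` of the matrix elements of all finite dimensional smooth representations. -/
def repFun {F H : Type*} [NormedAddCommGroup F] [NormedSpace ℝ F] [TopologicalSpace H]
    (J : ModelWithCorners ℝ F H) (K : Type*) [TopologicalSpace K] [ChartedSpace H K] [Group K] :
    Submodule ℂ (K → ℂ) :=
  Submodule.span ℂ {f | ∃ (d : ℕ) (ρ : Representation ℂ K (Fin d → ℂ)), IsSmoothRep J ρ ∧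
    ∃ v l, f = matrixElement ρ v l}

section
variable {F H : Type*} [NormedAddCommGroup F] [NormedSpace ℝ F] [TopologicalSpace H]
    (J : ModelWithCorners ℝ F H) (K : Type*) [TopologicalSpace K] [ChartedSpace H K] [Group K]

/-- The action `f ↦ (g ↦ f(a⁻¹ g b))` of `K × K` on all functions on `K`. -/
def funTrans : Representation ℂ (K × K) (K → ℂ) where
  toFun p := LinearMap.funLeft ℂ ℂ fun g => p.1⁻¹ * g * p.2
  map_one' := by ext; simp [LinearMap.funLeft_apply]
  map_mul' p q := by ext; simp [LinearMap.funLeft_apply, mul_assoc]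

variable {K}

theorem funTrans_matrixElement {d : ℕ} (ρ : Representation ℂ K (Fin d → ℂ)) (v : Fin d → ℂ)
    (l : Module.Dual ℂ (Fin d → ℂ)) (p : K × K) :
    funTrans K p (matrixElement ρ v l) = matrixElement ρ (ρ p.2 v) (l ∘ₗ ρ p.1⁻¹) := by
  funext g
  simp [funTrans, LinearMap.funLeft_apply, matrixElement]

theorem funTrans_mem (p : K × K) {f : K → ℂ} (hf : f ∈ repFun J K) :
    funTrans K p f ∈ repFun J K := by
  induction hf using Submodule.span_induction with
  | mem f hf =>
    obtain ⟨d, ρ, hρ, v, l, rfl⟩ := hf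
    rw [funTrans_matrixElement]
    exact Submodule.subset_span ⟨d, ρ, hρ, _, _, rfl⟩
  | zero => rw [map_zero]; exact zero_mem _
  | add f g _ _ hf hg => rw [map_add]; exact add_mem hf hg
  | smul a f _ hf => rw [map_smul]; exact Submodule.smul_mem _ _ hf

variable (K)

/-- The action `f ↦ (g ↦ f(a⁻¹ g b))` of `K × K` on `𝓡(K)`. -/
def biTrans : Representation ℂ (K × K) (repFun J K) where
  toFun p := (funTrans K p).restrict fun _ hf => funTrans_mem J p hf
  map_one' := by ext; simp
  map_mul' p q := by ext; simp

theorem biTrans_apply (p : K × K) (f : repFun J K) (g : K) :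
    (biTrans J K p f).1 g = f.1 (p.1⁻¹ * g * p.2) := rfl

theorem contMDiff_repFun {f : K → ℂ} (hf : f ∈ repFun J K) : ContMDiff J 𝓘(ℝ, ℂ) ∞ f := by
  induction hf using Submodule.span_induction with
  | mem f hf =>
    obtain ⟨d, ρ, hρ, v, l, rfl⟩ := hf
    exact hρ v l
  | zero => exact contMDiff_const
  | add f g _ _ hf hg => exact hf.add hg
  | smul a f _ hf => exact (ContinuousLinearMap.mul ℝ ℂ a).contMDiff.comp hf

end

variable (E : Type*) [NormedAddCommGroup E] [NormedSpace ℝ E] [CompleteSpace E]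
  (G : Type*) [TopologicalSpace G] [ChartedSpace E G] [Group G] [LieGroup 𝓘(ℝ, E) ∞ G]
  (N : ℕ)

/-- The model of the product manifold `G^N`. -/
abbrev powModel := ModelWithCorners.pi fun _ : Fin N => 𝓘(ℝ, E)

/-- The space `𝓡(G^N)`. -/
abbrev RG := repFun (powModel E N) (Fin N → G)

variable {G N}

theorem contMDiff_mulSingle (j : Fin N) :
    ContMDiff 𝓘(ℝ, E) (powModel E N) ∞ fun x : G => (Pi.mulSingle j x : Fin N → G) := by
  refine contMDiff_toPi fun i => ?_
  by_cases h : i = j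
  · subst h
    simp only [Pi.mulSingle_eq_same]
    exact contMDiff_id
  · simpa [Pi.mulSingle_eq_of_ne h] using contMDiff_const

/-- The action of `x ∈ G` on `𝓡(G^N)` by left translation of the `j`-th argument:
`f ↦ f(g_1, …, x⁻¹ g_j, …, g_N)`. -/
def leftRep (j : Fin N) : Representation ℂ G (RG E G N) :=
  (biTrans (powModel E N) (Fin N → G)).comp
    ((MonoidHom.inl (Fin N → G) (Fin N → G)).comp (MonoidHom.mulSingle (fun _ : Fin N => G) j))

/-- The action of `x ∈ G` on `𝓡(G^N)` by right translation of the `j`-th argument: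
`f ↦ f(g_1, …, g_j x, …, g_N)`. -/
def rightRep (j : Fin N) : Representation ℂ G (RG E G N) :=
  (biTrans (powModel E N) (Fin N → G)).comp
    ((MonoidHom.inr (Fin N → G) (Fin N → G)).comp (MonoidHom.mulSingle (fun _ : Fin N => G) j))

theorem leftRep_apply (j : Fin N) (x : G) (f : RG E G N) (g : Fin N → G) :
    (leftRep E j x f).1 g = f.1 (Pi.mulSingle j x⁻¹ * g) := by
  change f.1 ((Pi.mulSingle j x)⁻¹ * g * 1) = _
  rw [mul_one, Pi.mulSingle_inv]

theorem rightRep_apply (j : Fin N) (x : G) (f : RG E G N) (g : Fin N → G) :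
    (rightRep E j x f).1 g = f.1 (g * Pi.mulSingle j x) := by
  change f.1 (1⁻¹ * g * Pi.mulSingle j x) = _
  rw [inv_one, one_mul]

theorem isFinSmooth_of_span {π : Representation ℂ G (RG E G N)}
    (h : ∀ (d : ℕ) (ρ : Representation ℂ (Fin N → G) (Fin d → ℂ))
      (_ : IsSmoothRep (powModel E N) ρ) (v : Fin d → ℂ) (l : Module.Dual ℂ (Fin d → ℂ))
      (f : RG E G N), f.1 = matrixElement ρ v l →
      ∃ (d' : ℕ) (c : G → Fin d' → ℂ) (w : Fin d' → RG E G N),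
        ContMDiff 𝓘(ℝ, E) 𝓘(ℝ, Fin d' → ℂ) ∞ c ∧ ∀ x, π x f = ∑ k, c x k • w k) :
    IsFinSmooth E π := by
  rintro ⟨f, hf⟩
  induction hf using Submodule.span_induction with
  | mem f hf =>
    obtain ⟨d, ρ, hρ, v, l, rfl⟩ := hf
    exact h d ρ hρ v l _ rfl
  | zero =>
    refine ⟨0, fun _ => 0, fun _ => 0, contMDiff_const, fun x => ?_⟩
    have : (⟨0, zero_mem _⟩ : RG E G N) = 0 := rfl
    simp [this]
  | add f g hf' hg' hf hg =>
    obtain ⟨d, c, w, hc, hw⟩ := hf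
    obtain ⟨d', c', w', hc', hw'⟩ := hg
    refine ⟨d + d', fun x => Fin.append (c x) (c' x), Fin.append w w', ?_, fun x => ?_⟩
    · rw [contMDiff_pi_space] at hc hc' ⊢
      intro i
      induction i using Fin.addCases with
      | left i => simpa using hc i
      | right i => simpa using hc' i
    · have : (⟨f + g, add_mem hf' hg'⟩ : RG E G N) = ⟨f, hf'⟩ + ⟨g, hg'⟩ := rfl
      rw [this, map_add, hw, hw', Fin.sum_univ_add]
      simp
  | smul a f hf' hf =>
    obtain ⟨d, c, w, hc, hw⟩ := hf
    refine ⟨d, c, fun k => a • w k, hc, fun x => ?_⟩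
    have : (⟨a • f, Submodule.smul_mem _ a hf'⟩ : RG E G N) = a • ⟨f, hf'⟩ := rfl
    rw [this, map_smul, hw, Finset.smul_sum]
    exact Finset.sum_congr rfl fun k _ => smul_comm _ _ _

theorem isFinSmooth_rightRep (j : Fin N) : IsFinSmooth E (rightRep (G := G) E j) := by
  refine isFinSmooth_of_span E fun d ρ hρ v l f hf => ?_
  refine ⟨d, fun x k => ρ (Pi.mulSingle j x) v k,
    fun k => ⟨matrixElement ρ (Pi.single k 1) l,
      Submodule.subset_span ⟨d, ρ, hρ, _, _, rfl⟩⟩, ?_, fun x => ?_⟩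
  · rw [contMDiff_pi_space]
    intro k
    exact (hρ v (LinearMap.proj k)).comp (contMDiff_mulSingle E j)
  · ext g
    rw [rightRep_apply, hf]
    have e : ρ (Pi.mulSingle j x) v =
        ∑ k, ρ (Pi.mulSingle j x) v k • (Pi.single k (1 : ℂ) : Fin d → ℂ) :=
      pi_eq_sum_univ' _
    simp only [matrixElement, map_mul, Module.End.mul_apply]
    conv_lhs => rw [e]
    rw [map_sum, map_sum]
    simp only [map_smul, smul_eq_mul, AddSubmonoidClass.coe_finsetSum, Finset.sum_apply,
      SetLike.val_smul, Pi.smul_apply, matrixElement]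

theorem isFinSmooth_leftRep (j : Fin N) : IsFinSmooth E (leftRep (G := G) E j) := by
  refine isFinSmooth_of_span E fun d ρ hρ v l f hf => ?_
  refine ⟨d, fun x k => l (ρ (Pi.mulSingle j x⁻¹) (Pi.single k 1)),
    fun k => ⟨matrixElement ρ v (LinearMap.proj k),
      Submodule.subset_span ⟨d, ρ, hρ, _, _, rfl⟩⟩, ?_, fun x => ?_⟩
  · rw [contMDiff_pi_space]
    intro k
    exact (hρ (Pi.single k 1) l).comp ((contMDiff_mulSingle E j).comp (contMDiff_inv 𝓘(ℝ, E) ∞))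
  · ext g
    rw [leftRep_apply, hf]
    have e : ρ g v = ∑ k, ρ g v k • (Pi.single k (1 : ℂ) : Fin d → ℂ) := pi_eq_sum_univ' _
    simp only [matrixElement, map_mul, Module.End.mul_apply]
    conv_lhs => rw [e]
    rw [map_sum, map_sum]
    simp only [map_smul, smul_eq_mul, AddSubmonoidClass.coe_finsetSum, Finset.sum_apply,
      SetLike.val_smul, Pi.smul_apply, matrixElement, LinearMap.proj_apply]
    exact Finset.sum_congr rfl fun k _ => mul_comm _ _

/-- The left quantum moment map in the `j`-th factor:
`(μ_L(X_j) f)(g) = d/dt f(g_1, …, e^{-tX} g_j, …, g_N)` at `t = 0`. -/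
def momentL (j : Fin N) : Ug E G →ₐ[ℂ] Module.End ℂ (RG E G N) :=
  ugAction (isFinSmooth_leftRep E j)

/-- The right quantum moment map in the `j`-th factor:
`(μ_R(X_j) f)(g) = d/dt f(g_1, …, g_j e^{tX}, …, g_N)` at `t = 0`. -/
def momentR (j : Fin N) : Ug E G →ₐ[ℂ] Module.End ℂ (RG E G N) :=
  ugAction (isFinSmooth_rightRep E j)

theorem momentL_ugIncl (j : Fin N) (X : GroupLieAlgebra 𝓘(ℝ, E) G) (f : RG E G N)
    (g : Fin N → G) : (momentL E j (ugIncl X) f).1 g =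
      dirDeriv (fun x : G => f.1 (Pi.mulSingle j x⁻¹ * g)) (1 : G) X := by
  have := dual_diffReal (isFinSmooth_leftRep (G := G) E j) X f
    (LinearMap.proj g ∘ₗ (RG E G N).subtype)
  simp only [LinearMap.comp_apply, LinearMap.proj_apply, Submodule.subtype_apply,
    leftRep_apply] at this
  rw [momentL, ugAction, ugLift_ugIncl]
  exact this

theorem momentR_ugIncl (j : Fin N) (X : GroupLieAlgebra 𝓘(ℝ, E) G) (f : RG E G N)
    (g : Fin N → G) : (momentR E j (ugIncl X) f).1 g =
      dirDeriv (fun x : G => f.1 (g * Pi.mulSingle j x)) (1 : G) X := by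
  have := dual_diffReal (isFinSmooth_rightRep (G := G) E j) X f
    (LinearMap.proj g ∘ₗ (RG E G N).subtype)
  simp only [LinearMap.comp_apply, LinearMap.proj_apply, Submodule.subtype_apply,
    rightRep_apply] at this
  rw [momentR, ugAction, ugLift_ugIncl]
  exact this

theorem momentL_momentR_commute (i j : Fin N) (a b : Ug E G) :
    Commute (momentL E i a : Module.End ℂ (RG E G N)) (momentR E j b) := by
  refine ugAction_commute _ (fun y => (ugAction_commute _ (fun x => ?_) a).symm) b
  refine LinearMap.ext fun f => Subtype.ext (funext fun g => ?_)
  simp only [Module.End.mul_apply, leftRep_apply, rightRep_apply, mul_assoc]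

theorem momentL_commute {i j : Fin N} (hij : i ≠ j) (a b : Ug E G) :
    Commute (momentL E i a : Module.End ℂ (RG E G N)) (momentL E j b) := by
  refine ugAction_commute _ (fun y => (ugAction_commute _ (fun x => ?_) a).symm) b
  have : Commute (Pi.mulSingle i x : Fin N → G) (Pi.mulSingle j y) := Pi.mulSingle_commute (f := fun _ : Fin N => G) hij x y
  exact ((this.map (MonoidHom.inl (Fin N → G) (Fin N → G))).map
    (biTrans (powModel E N) (Fin N → G))).symm

theorem momentR_commute {i j : Fin N} (hij : i ≠ j) (a b : Ug E G) :
    Commute (momentR E i a : Module.End ℂ (RG E G N)) (momentR E j b) := by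
  refine ugAction_commute _ (fun y => (ugAction_commute _ (fun x => ?_) a).symm) b
  have : Commute (Pi.mulSingle i x : Fin N → G) (Pi.mulSingle j y) := Pi.mulSingle_commute (f := fun _ : Fin N => G) hij x y
  exact ((this.map (MonoidHom.inr (Fin N → G) (Fin N → G))).map
    (biTrans (powModel E N) (Fin N → G))).symm

end Functions

section DifferentialOperators

/-- `IsDiffOpLT n D`: the linear operator `D` on the commutative algebra `C` is a differential
operator of order `< n`, that is, all `n`-fold commutators of `D` with multiplication operators
vanish. -/
def IsDiffOpLT {C : Type*} [CommRing C] [Algebra ℂ C] : ℕ → Module.End ℂ C → Prop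
  | 0, D => D = 0
  | n + 1, D => ∀ f : C, IsDiffOpLT n (D * LinearMap.mulLeft ℂ f - LinearMap.mulLeft ℂ f * D)

section
variable {C : Type*} [CommRing C] [Algebra ℂ C]

theorem IsDiffOpLT.zero (n : ℕ) : IsDiffOpLT n (0 : Module.End ℂ C) := by
  induction n with
  | zero => rfl
  | succ n ih => intro f; simpa using ih

theorem IsDiffOpLT.add {n : ℕ} {D D' : Module.End ℂ C} (h : IsDiffOpLT n D)
    (h' : IsDiffOpLT n D') : IsDiffOpLT n (D + D') := by
  induction n generalizing D D' with
  | zero => rw [IsDiffOpLT] at *; rw [h, h', add_zero]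
  | succ n ih =>
    intro f
    have := ih (h f) (h' f)
    rwa [sub_add_sub_comm, ← add_mul, ← mul_add] at this

theorem IsDiffOpLT.succ {n : ℕ} {D : Module.End ℂ C} (h : IsDiffOpLT n D) :
    IsDiffOpLT (n + 1) D := by
  induction n generalizing D with
  | zero => rw [IsDiffOpLT] at h; rw [h]; exact IsDiffOpLT.zero _
  | succ n ih => exact fun f => ih (h f)

theorem IsDiffOpLT.mono {m n : ℕ} (hmn : m ≤ n) {D : Module.End ℂ C} (h : IsDiffOpLT m D) :
    IsDiffOpLT n D := by
  induction hmn with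
  | refl => exact h
  | step _ ih => exact ih.succ

theorem IsDiffOpLT.mul {m n : ℕ} {D D' : Module.End ℂ C} (h : IsDiffOpLT m D)
    (h' : IsDiffOpLT n D') : IsDiffOpLT (m + n) (D * D') := by
  induction hk : m + n generalizing m n D D' with
  | zero =>
    obtain ⟨rfl, rfl⟩ : m = 0 ∧ n = 0 := by omega
    rw [IsDiffOpLT] at *
    rw [h, zero_mul]
  | succ k ih =>
    rcases m with _ | m
    · rw [IsDiffOpLT] at h; rw [h, zero_mul]; exact IsDiffOpLT.zero _
    rcases n with _ | n
    · rw [IsDiffOpLT] at h'; rw [h', mul_zero]; exact IsDiffOpLT.zero _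
    intro f
    have a := ih h (h' f) (by omega)
    have b := ih (h f) h' (by omega)
    have c := a.add b
    have e : D * (D' * LinearMap.mulLeft ℂ f - LinearMap.mulLeft ℂ f * D') +
        (D * LinearMap.mulLeft ℂ f - LinearMap.mulLeft ℂ f * D) * D' =
        D * D' * LinearMap.mulLeft ℂ f - LinearMap.mulLeft ℂ f * (D * D') := by
      simp only [mul_sub, sub_mul, mul_assoc]
      abel
    rwa [e] at c

variable (C) in
/-- The algebra of differential operators on a commutative algebra. -/
def diffOps : Subalgebra ℂ (Module.End ℂ C) where
  carrier := {D | ∃ n, IsDiffOpLT n D}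
  mul_mem' := by
    rintro D D' ⟨m, h⟩ ⟨n, h'⟩
    exact ⟨m + n, h.mul h'⟩
  add_mem' := by
    rintro D D' ⟨m, h⟩ ⟨n, h'⟩
    exact ⟨m + n, (h.mono (Nat.le_add_right m n)).add (h'.mono (Nat.le_add_left n m))⟩
  algebraMap_mem' a := ⟨1, fun f => by
    rw [IsDiffOpLT, Algebra.commutes, sub_self]⟩

end

end DifferentialOperators

section Algebra

/-- The homomorphism of tensor product algebras induced by homomorphisms of the factors. -/
def piTensorMap {ι : Type} [Fintype ι] {A B : ι → Type*} [∀ i, Ring (A i)] [∀ i, Algebra ℂ (A i)]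
    [∀ i, Ring (B i)] [∀ i, Algebra ℂ (B i)] (f : ∀ i, A i →ₐ[ℂ] B i) :
    (⨂[ℂ] i, A i) →ₐ[ℂ] ⨂[ℂ] i, B i :=
  PiTensorProduct.liftAlgHom
    ((PiTensorProduct.tprod ℂ).compLinearMap fun i => (f i).toLinearMap)
    (by simp [PiTensorProduct.one_def]; rfl) (fun x y => by
      simp only [MultilinearMap.compLinearMap_apply, Pi.mul_apply, AlgHom.toLinearMap_apply, map_mul]
      exact (PiTensorProduct.tprod_mul_tprod _ _).symm)

theorem list_prod_ofFn_mul {A : Type*} [Monoid A] {n : ℕ} (a b : Fin n → A)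
    (h : ∀ i j, i ≠ j → Commute (a i) (b j)) :
    (List.ofFn fun i => a i * b i).prod = (List.ofFn a).prod * (List.ofFn b).prod := by
  induction n with
  | zero => simp
  | succ n ih =>
    have hc : Commute (b 0) (List.ofFn fun i : Fin n => a i.succ).prod := by
      refine Commute.list_prod_right _ _ fun x hx => ?_
      obtain ⟨i, rfl⟩ := (List.mem_ofFn' _ _).1 hx
      exact (h i.succ 0 (Fin.succ_ne_zero i)).symm
    rw [List.ofFn_succ, List.ofFn_succ (f := a), List.ofFn_succ (f := b), List.prod_cons,
      List.prod_cons, List.prod_cons, ih (fun i => a i.succ) (fun i => b i.succ)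
        (fun i j hij => h _ _ (by simpa using hij))]
    rw [mul_assoc, ← mul_assoc (b 0), hc.eq]
    simp only [mul_assoc]

/-- The operators on a subspace `W` induced by the elements of an algebra `B` of operators. -/
def inducedOps {M : Type*} [AddCommGroup M] [Module ℂ M] (B : Subalgebra ℂ (Module.End ℂ M))
    (W : Submodule ℂ M) : Subalgebra ℂ (Module.End ℂ W) where
  carrier := {T | ∃ b ∈ B, ∀ w : W, (T w : M) = b w}
  mul_mem' := by
    rintro S T ⟨b, hb, h⟩ ⟨c, hc, h'⟩
    exact ⟨b * c, B.mul_mem hb hc, fun w => by rw [Module.End.mul_apply, h, h']; rfl⟩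
  add_mem' := by
    rintro S T ⟨b, hb, h⟩ ⟨c, hc, h'⟩
    exact ⟨b + c, B.add_mem hb hc, fun w => by
      rw [LinearMap.add_apply, Submodule.coe_add, h, h']; rfl⟩
  algebraMap_mem' a := ⟨algebraMap ℂ _ a, B.algebraMap_mem a, fun w => by
    simp [Module.algebraMap_end_apply]⟩

section
variable {M : Type*} [AddCommGroup M] [Module ℂ M]

/-- The subspace `W` is a submodule for the algebra `B` of operators. -/
def IsStable (B : Subalgebra ℂ (Module.End ℂ M)) (W : Submodule ℂ M) : Prop :=
  ∀ b ∈ B, ∀ w ∈ W, b w ∈ W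

/-- The subspace `W` is an irreducible submodule for the algebra `B` of operators: it is stable and
nonzero, and its only stable subspaces are `0` and `W`. -/
def IsIrreducibleSubmodule (B : Subalgebra ℂ (Module.End ℂ M)) (W : Submodule ℂ M) : Prop :=
  IsStable B W ∧ W ≠ ⊥ ∧ ∀ W' ≤ W, IsStable B W' → W' = ⊥ ∨ W' = W

/-- The subspaces `W` and `W'` are isomorphic as `B`-modules. -/
def AreIsomorphic (B : Subalgebra ℂ (Module.End ℂ M)) (W W' : Submodule ℂ M) : Prop :=
  ∃ e : W ≃ₗ[ℂ] W', ∀ b ∈ B, ∀ v w : W, (w : M) = b v → (e w : M) = b (e v)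

end

/-- The external tensor product representation `h ↦ ⨂ π_i(h_i)` of `G^N`. -/
def extTensor {G : Type*} [Group G] {ι : Type} {V : ι → Type*} [∀ i, AddCommGroup (V i)]
    [∀ i, Module ℂ (V i)] (π : ∀ i, Representation ℂ G (V i)) :
    Representation ℂ (ι → G) (⨂[ℂ] i, V i) where
  toFun h := PiTensorProduct.map fun i => π i (h i)
  map_one' := by
    simp only [Pi.one_apply, map_one]
    exact PiTensorProduct.map_one
  map_mul' g h := by
    simp only [Pi.mul_apply, map_mul]
    exact PiTensorProduct.map_mul _ _

end Algebra

section System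

variable (E : Type*) [NormedAddCommGroup E] [NormedSpace ℝ E] [CompleteSpace E]
  (G : Type*) [TopologicalSpace G] [ChartedSpace E G] [Group G] [LieGroup 𝓘(ℝ, E) ∞ G]
  (N : ℕ)

/-- The algebra `C^∞(G^N, ℂ)`. -/
def smoothFun : Subalgebra ℂ ((Fin N → G) → ℂ) where
  carrier := {f | ContMDiff (powModel E N) 𝓘(ℝ, ℂ) ∞ f}
  mul_mem' := fun hf hg =>
    (contDiff_mul (𝕜 := ℝ) (𝔸 := ℂ) (n := ∞)).contMDiff.comp (hf.prodMk_space hg)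
  add_mem' := fun hf hg => ContMDiff.add hf hg
  algebraMap_mem' _ := contMDiff_const

/-- Functions in `𝓡(G^N)` are smooth. -/
def toSmooth (f : RG E G N) : smoothFun E G N := ⟨f.1, contMDiff_repFun _ _ f.2⟩

/-- `Ug ⊗ Ug` -/
abbrev UgUg := Ug E G ⊗[ℂ] Ug E G

/-- The relation `z ⊗ 1 = 1 ⊗ S(z)`, for `z` in the center `Z(𝔤)` of `U𝔤`. -/
inductive CentralRel : UgUg E G → UgUg E G → Prop
  | mk (z : Ug E G) (hz : z ∈ Subalgebra.center ℂ (Ug E G)) :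
      CentralRel (z ⊗ₜ[ℂ] 1) (1 ⊗ₜ[ℂ] antipode z)

/-- The algebra `U𝔤 ⊗_{Z(𝔤)} U𝔤`, in which `az ⊗ b = a ⊗ S(z)b` for `z ∈ Z(𝔤)`. -/
abbrev UgZUg := RingQuot (CentralRel E G)

/-- The projection `(U𝔤 ⊗ U𝔤)^{⊗N} → (U𝔤 ⊗_{Z(𝔤)} U𝔤)^{⊗N}`. -/
def toBalanced : (⨂[ℂ] _ : Fin N, UgUg E G) →ₐ[ℂ] ⨂[ℂ] _ : Fin N, UgZUg E G :=
  piTensorMap fun _ => RingQuot.mkAlgHom ℂ (CentralRel E G)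

variable {G N}

/-- The action of `U𝔤 ⊗ U𝔤` on `𝓡(G^N)` through the `j`-th argument. -/
def slotAction (j : Fin N) : UgUg E G →ₐ[ℂ] Module.End ℂ (RG E G N) :=
  Algebra.TensorProduct.lift (momentL E j) (momentR E j) (momentL_momentR_commute E j j)

theorem slotAction_commute {i j : Fin N} (hij : i ≠ j) (a b : UgUg E G) :
    Commute (slotAction E i a : Module.End ℂ (RG E G N)) (slotAction E j b) := by
  induction a using TensorProduct.induction_on with
  | zero => rw [map_zero]; exact Commute.zero_left _
  | add a a' ha ha' => rw [map_add]; exact ha.add_left ha'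
  | tmul a a' =>
    induction b using TensorProduct.induction_on with
    | zero => rw [map_zero]; exact Commute.zero_right _
    | add b b' hb hb' => rw [map_add]; exact hb.add_right hb'
    | tmul b b' =>
      simp only [slotAction, Algebra.TensorProduct.lift_tmul]
      exact ((momentL_commute E hij a b).mul_right (momentL_momentR_commute E i j a b')).mul_left
        ((momentL_momentR_commute E j i b a').symm.mul_right (momentR_commute E hij a' b'))

variable (G N) in
/-- The action of `(U𝔤 ⊗ U𝔤)^{⊗N}` on `𝓡(G^N)` by the left and right quantum moment maps. -/
def momentMap : (⨂[ℂ] _ : Fin N, UgUg E G) →ₐ[ℂ] Module.End ℂ (RG E G N) :=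
  PiTensorProduct.liftAlgHom
    ((MultilinearMap.mkPiAlgebraFin ℂ N (Module.End ℂ (RG E G N))).compLinearMap
      fun j => (slotAction E j).toLinearMap)
    (by
      simp only [MultilinearMap.compLinearMap_apply, MultilinearMap.mkPiAlgebraFin_apply,
        Pi.one_apply, AlgHom.toLinearMap_apply, map_one]
      simp)
    (fun x y => by
      simp only [MultilinearMap.compLinearMap_apply, MultilinearMap.mkPiAlgebraFin_apply,
        Pi.mul_apply, AlgHom.toLinearMap_apply, map_mul]
      exact list_prod_ofFn_mul _ _ fun i j hij => slotAction_commute E hij _ _)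

variable [NeZero N]

/-- The gauge action on `U𝔤 ⊗ U𝔤` factors: `h` acts in the `j`-th factor by
`Ad(h_j) ⊗ Ad(h_{j+1})`, since `g_j` is mapped to `h_j g_j h_{j+1}⁻¹`. -/
def gaugeAd (h : Fin N → G) : (⨂[ℂ] _ : Fin N, UgUg E G) →ₐ[ℂ] ⨂[ℂ] _ : Fin N, UgUg E G :=
  piTensorMap fun j => Algebra.TensorProduct.map (adUg (h j)) (adUg (h (j + 1)))

variable (G N) in
/-- The elements of `(U𝔤 ⊗ U𝔤)^{⊗N}` with gauge invariant image in
`(U𝔤 ⊗_{Z(𝔤)} U𝔤)^{⊗N}`. -/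
def gaugeInvariants : Subalgebra ℂ (⨂[ℂ] _ : Fin N, UgUg E G) :=
  ⨅ h : Fin N → G, AlgHom.equalizer ((toBalanced E G N).comp (gaugeAd E h)) (toBalanced E G N)

variable (G N) in
/-- The algebra `Z(𝔤)^{⊗N}` inside the left factors of `(U𝔤 ⊗ U𝔤)^{⊗N}`. -/
def centerLeft : Subalgebra ℂ (⨂[ℂ] _ : Fin N, UgUg E G) :=
  (piTensorMap (A := fun _ : Fin N => Subalgebra.center ℂ (Ug E G))
    (B := fun _ : Fin N => UgUg E G) fun _ =>
    (Algebra.TensorProduct.includeLeft : Ug E G →ₐ[ℂ] UgUg E G).comp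
      (Subalgebra.center ℂ (Ug E G)).val).range

variable (G N) in
/-- The cyclic shift `(h_1, …, h_N) ↦ (h_2, …, h_N, h_1)`. -/
def shift : (Fin N → G) →* (Fin N → G) where
  toFun h j := h (j + 1)
  map_one' := rfl
  map_mul' _ _ := rfl

/-- The gauge transformation `g ↦ g^h = (h_1 g_1 h_2⁻¹, …, h_N g_N h_1⁻¹)`. -/
def gaugeAct (h g : Fin N → G) : Fin N → G := fun j => h j * g j * (h (j + 1))⁻¹

/-- The gauge action `(h · f)(g) = f(g^{h⁻¹})` on `𝓡(G^N)`. -/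
def gaugeRep : Representation ℂ (Fin N → G) (RG E G N) :=
  (biTrans (powModel E N) (Fin N → G)).comp ((MonoidHom.id _).prod (shift G N))

theorem gaugeRep_apply (h : Fin N → G) (f : RG E G N) (g : Fin N → G) :
    (gaugeRep E h f).1 g = f.1 (gaugeAct h⁻¹ g) := by
  have : gaugeAct h⁻¹ g = h⁻¹ * g * shift G N h := by
    funext j
    simp [gaugeAct, shift]
  rw [this]
  rfl

variable (G N) in
/-- The algebra `𝔻(G^N)^{G^N}` of gauge invariant differential operators on `G^N` that preserve
`𝓡(G^N)`. -/
def invDiffOps : Subalgebra ℂ (Module.End ℂ (smoothFun E G N)) where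
  carrier := {D | D ∈ diffOps (smoothFun E G N) ∧
    (∀ f, f.1 ∈ RG E G N → (D f).1 ∈ RG E G N) ∧
    ∀ (h : Fin N → G) (f f' : smoothFun E G N), (∀ g, f'.1 g = f.1 (gaugeAct h g)) →
      ∀ g, (D f').1 g = (D f).1 (gaugeAct h g)}
  mul_mem' := by
    rintro D D' ⟨h1, h2, h3⟩ ⟨h1', h2', h3'⟩
    exact ⟨mul_mem h1 h1', fun f hf => h2 _ (h2' f hf),
      fun h f f' hf => h3 h _ _ (h3' h f f' hf)⟩
  add_mem' := by
    rintro D D' ⟨h1, h2, h3⟩ ⟨h1', h2', h3'⟩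
    refine ⟨add_mem h1 h1', fun f hf => add_mem (h2 f hf) (h2' f hf), fun h f f' hf g => ?_⟩
    exact congrArg₂ (· + ·) (h3 h f f' hf g) (h3' h f f' hf g)
  algebraMap_mem' a := ⟨algebraMap_mem _ a, fun f hf => Submodule.smul_mem _ a hf,
    fun h f f' hf g => congrArg (a * ·) (hf g)⟩

variable (G N) in
/-- The operators on `𝓡(G^N)` given by elements of `𝔻(G^N)^{G^N}`. -/
def invDiffOpsOn : Subalgebra ℂ (Module.End ℂ (RG E G N)) where
  carrier := {T | ∃ D ∈ invDiffOps E G N, ∀ f, (T f).1 = (D (toSmooth E G N f)).1}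
  mul_mem' := by
    rintro S T ⟨D, hD, h⟩ ⟨D', hD', h'⟩
    refine ⟨D * D', mul_mem hD hD', fun f => ?_⟩
    have : toSmooth E G N (T f) = D' (toSmooth E G N f) := Subtype.ext (h' f)
    rw [Module.End.mul_apply, h, this]
    rfl
  add_mem' := by
    rintro S T ⟨D, hD, h⟩ ⟨D', hD', h'⟩
    exact ⟨D + D', add_mem hD hD', fun f => congrArg₂ (· + ·) (h f) (h' f)⟩
  algebraMap_mem' a := ⟨algebraMap ℂ _ a, algebraMap_mem _ a, fun f => rfl⟩

variable {V : Fin N → Type*} [∀ i, AddCommGroup (V i)] [∀ i, Module ℂ (V i)]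
  (π : ∀ i, Representation ℂ G (V i))

variable (G V) in
/-- The space `𝓡(G^N) ⊗ V_{μ_1} ⊗ ⋯ ⊗ V_{μ_N}`. -/
def RGV := RG E G N ⊗[ℂ] (⨂[ℂ] i, V i)

instance instAddCommGroupRGV : AddCommGroup (RGV E G V) :=
  inferInstanceAs (AddCommGroup (RG E G N ⊗[ℂ] (⨂[ℂ] i, V i)))

instance instModuleRGV : Module ℂ (RGV E G V) :=
  inferInstanceAs (Module ℂ (RG E G N ⊗[ℂ] (⨂[ℂ] i, V i)))

/-- The action of the gauge group on `𝓡(G^N) ⊗ V_{μ_1} ⊗ ⋯ ⊗ V_{μ_N}`. -/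
def gaugeRepV : Representation ℂ (Fin N → G) (RGV E G V) :=
  (gaugeRep E).tprod (extTensor π)

variable (G V) in
/-- The action `T ↦ T ⊗ id` of operators on `𝓡(G^N)` on vector-valued functions. -/
def actV : Module.End ℂ (RG E G N) →ₐ[ℂ] Module.End ℂ (RGV E G V) :=
  Module.End.rTensorAlgHom ℂ (RG E G N) (⨂[ℂ] i, V i)

/-- The space `𝓡_μ = (𝓡(G^N) ⊗ V_{μ_1} ⊗ ⋯ ⊗ V_{μ_N})^{G^N}`. -/
def Rmu : Submodule ℂ (RGV E G V) := (gaugeRepV E π).invariants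

/-- The image in `End(𝓡_μ)` of an algebra of operators on `𝓡(G^N)`. -/
def imageMu (B : Subalgebra ℂ (Module.End ℂ (RG E G N))) :
    Subalgebra ℂ (Module.End ℂ (Rmu E π)) :=
  inducedOps (B.map (actV E G V)) (Rmu E π)

/-- The algebra `A_μ`, the image of `𝔻(G^N)^{G^N}` in `End(𝓡_μ)`. -/
def Amu : Subalgebra ℂ (Module.End ℂ (Rmu E π)) := imageMu E π (invDiffOpsOn E G N)

/-- The algebra `J_μ` of quantum integrals, the image of the `G^N`-invariants of
`(U𝔤 ⊗_{Z(𝔤)} U𝔤)^{⊗N}` in `End(𝓡_μ)`. -/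
def Jmu : Subalgebra ℂ (Module.End ℂ (Rmu E π)) :=
  imageMu E π ((gaugeInvariants E G N).map (momentMap E G N))

/-- The algebra `I_μ` of quantum Hamiltonians, the image of `Z(𝔤)^{⊗N}` in `End(𝓡_μ)`. -/
def Imu : Subalgebra ℂ (Module.End ℂ (Rmu E π)) :=
  imageMu E π ((centerLeft E G N).map (momentMap E G N))

/-- The centralizer `Z(I_μ, A_μ)` of `I_μ` in `A_μ`. -/
def ZIA : Subalgebra ℂ (Module.End ℂ (Rmu E π)) :=
  Subalgebra.centralizer ℂ (Imu E π : Set (Module.End ℂ (Rmu E π))) ⊓ Amu E π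

variable (G) in
/-- Irreducible smooth complex representations of `G` on some `ℂ^d`. -/
structure IrrRep where
  dim : ℕ
  rep : Representation ℂ G (Fin dim → ℂ)
  smooth : IsSmoothRep 𝓘(ℝ, E) rep
  irreducible : rep.IsIrreducible

variable (G) in
/-- Isomorphism of irreducible representations. -/
instance irrSetoid : Setoid (IrrRep E G) where
  r σ τ := Nonempty (σ.rep.Equiv τ.rep)
  iseqv := ⟨fun _ => ⟨.refl _⟩, fun ⟨e⟩ => ⟨e.symm⟩, fun ⟨e⟩ ⟨e'⟩ => ⟨e.trans e'⟩⟩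

variable (G) in
/-- The set of isomorphism classes of irreducible finite dimensional representations of `G`
(equivalently, of dominant integral weights). -/
abbrev IrrClass := Quotient (irrSetoid E G)

/-- The space `𝓡^{(ν)}(G^N)` spanned by the matrix elements of `V_{ν_1} ⊗ ⋯ ⊗ V_{ν_N}`. -/
def RGblock (ν : Fin N → IrrClass E G) : Submodule ℂ (RG E G N) :=
  (Submodule.span ℂ {f | ∃ σ : Fin N → IrrRep E G, (∀ i, (⟦σ i⟧ : IrrClass E G) = ν i) ∧
    ∃ v l, f = matrixElement (extTensor fun i => (σ i).rep) v l}).comap (RG E G N).subtype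

variable (V) in
/-- The space `𝓡^{(ν)}(G^N) ⊗ V_{μ_1} ⊗ ⋯ ⊗ V_{μ_N}`. -/
def RGVblock (ν : Fin N → IrrClass E G) : Submodule ℂ (RGV E G V) :=
  LinearMap.range ((RGblock E ν).subtype.rTensor (⨂[ℂ] i, V i))

/-- The block `𝓡_μ^{(ν)} = (𝓡^{(ν)}(G^N) ⊗ V_{μ_1} ⊗ ⋯ ⊗ V_{μ_N})^{G^N}` of `𝓡_μ`. -/
def block (ν : Fin N → IrrClass E G) : Submodule ℂ (Rmu E π) :=
  (RGVblock E V ν).comap (Rmu E π).subtype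

end System

end

end SpinChain

open SpinChain

/-!
Left and right invariant differential operators on `G^N` act on the algebra `𝓡(G^N)` of
representative functions, which is the direct sum of the blocks `𝓡^{(ν)}(G^N)`. Each block is
irreducible under left and right translations, hence, as `G` is connected, under
`(U𝔤 ⊗ U𝔤)^{⊗N}`; by Burnside's theorem the latter induces *all* operators on the block
(`exists_momentMap_eq`). The copies of the center `Z(𝔤)` act on the block of `ν` by the
infinitesimal characters of the `V_{ν_j}` (`momentR_apply_RGblock`).

Two facts give the theorem.

* Infinitesimal characters separate irreducible representations of a compact connected group
  (`exists_center_separating`). No highest weight theory is needed: for non-isomorphic `V`, `V'` the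
  density theorem provides `u ∈ U𝔤` acting by `1` on `V` and by `0` on `V'`. The adjoint action on
  `U𝔤` is locally finite, so `u` can be averaged over `G`; the average is central and acts in the
  same way. Hence the blocks `𝓡_μ^{(ν)}` are the joint eigenspaces of `I_μ`
  (`mem_block_of_forall_hamiltonian`).
* The algebra `J_μ` acts transitively on the nonzero elements of each block
  (`exists_gaugeInvariant_apply_eq`). The coefficients of a nonzero `f ∈ 𝓡_μ^{(ν)}` with respect to
  functionals on `V_{μ_1} ⊗ ⋯ ⊗ V_{μ_N}` are linearly independent: the functionals giving a zero
  coefficient form a subrepresentation of an irreducible representation of `G^N`. Hence for every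
  `f'` in the same block there is an operator on `𝓡^{(ν)}(G^N)`, given by some
  `u₀ ∈ (U𝔤 ⊗ U𝔤)^{⊗N}`, that maps the coefficients of `f` to those of `f'`. As `f` and `f'` are
  gauge invariant, every gauge transform of `u₀` maps `f` to `f'`, and so does the average of `u₀`
  over the gauge group.

Transitivity yields irreducibility and that `J_μ` induces all operators on each block. Since `I_μ`
commutes with `J_μ`, it acts on each block by a character; and an operator commuting with `I_μ`
preserves the joint eigenspaces, where it cannot induce more than `J_μ` does.

The decomposition of `𝓡(G^N)` into blocks is the algebraic part of the Peter–Weyl theorem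
(`iSup_RGblock`), which follows from complete reducibility. The passage from the Lie algebra to a
connected group is an application of Grönwall's inequality along segments in charts
(`eq_zero_of_dirDeriv`), so the exponential map is not used.
-/

namespace SpinChain

noncomputable section

set_option linter.unusedSectionVars false

/-! ### Derivatives at the identity of functions of several arguments -/

section Swap

variable {E F : Type*} [NormedAddCommGroup E] [NormedSpace ℝ E]
    [NormedAddCommGroup F] [NormedSpace ℝ F]
    {G : Type*} [TopologicalSpace G] [ChartedSpace E G] [Group G] [LieGroup 𝓘(ℝ, E) ∞ G]

/-- Derivatives in the two arguments commute: symmetry of the second derivative, read in the chart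
at the identity. -/
theorem dirDeriv_swap {f : G → G → F}
    (hf : ContMDiffAt (𝓘(ℝ, E).prod 𝓘(ℝ, E)) 𝓘(ℝ, F) ∞ (Function.uncurry f) (1, 1))
    (X Y : GroupLieAlgebra 𝓘(ℝ, E) G) :
    dirDeriv (fun x => dirDeriv (fun y => f x y) (1 : G) Y) (1 : G) X =
      dirDeriv (fun y => dirDeriv (fun x => f x y) (1 : G) X) (1 : G) Y := by
  set χ := extChartAt 𝓘(ℝ, E) (1 : G) with hχ
  set c : E := χ 1 with hc
  set X' : E := mfderiv 𝓘(ℝ, E) 𝓘(ℝ, E) χ (1 : G) X with hX'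
  set Y' : E := mfderiv 𝓘(ℝ, E) 𝓘(ℝ, E) χ (1 : G) Y with hY'
  let f' : E × E → F := fun p => f (χ.symm p.1) (χ.symm p.2)
  have hf' : ContDiffAt ℝ ∞ f' (c, c) := by
    have := (contMDiffAt_iff.1 hf).2
    simp only [ModelWithCorners.range_eq_univ, contDiffWithinAt_univ, extChartAt_prod] at this
    exact this
  have h1 : (1 : G) ∈ χ.source := mem_extChartAt_source 1
  have hd : ∀ᶠ p in 𝓝 (c, c), DifferentiableAt ℝ f' p := by
    have : ∀ᶠ p in 𝓝 (c, c), ContDiffAt ℝ 1 f' p :=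
      (hf'.of_le (m := 1) ENat.LEInfty.out).eventually (by simp)
    exact this.mono fun p hp => hp.differentiableAt one_ne_zero
  have hfd : DifferentiableAt ℝ (fderiv ℝ f') (c, c) :=
    ((hf'.of_le (m := 2) ENat.LEInfty.out).fderiv_right (m := 1)
      (by norm_num [one_add_one_eq_two])).differentiableAt one_ne_zero
  have hsymm : IsSymmSndFDerivAt ℝ f' (c, c) :=
    (hf'.of_le (m := 2) ENat.LEInfty.out).isSymmSndFDerivAt (by simp)
  have t1 : Filter.Tendsto (fun s : E => (s, c)) (𝓝 c) (𝓝 (c, c)) :=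
    Continuous.tendsto (by fun_prop) c
  have t2 : Filter.Tendsto (fun s : E => (c, s)) (𝓝 c) (𝓝 (c, c)) :=
    Continuous.tendsto (by fun_prop) c
  have tgt : χ.target ∈ 𝓝 c := extChartAt_target_mem_nhds 1
  have l1 : χ.symm c = 1 := χ.left_inv h1
  -- the inner derivatives in the chart
  have e1 : (fun x => dirDeriv (fun y => f x y) (1 : G) Y) ∘ χ.symm =ᶠ[𝓝 c]
      fun s => fderiv ℝ f' (s, c) (0, Y') := by
    filter_upwards [t1.eventually hd] with s hs
    have hcomp : HasFDerivAt (fun t : E => f' (s, t))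
        ((fderiv ℝ f' (s, c)).comp (ContinuousLinearMap.inr ℝ E E)) c :=
      HasFDerivAt.comp (g := f') c hs.hasFDerivAt (hasFDerivAt_prodMk_right s c)
    have := dirDeriv_eq_chart (1 : G) (fun y => f (χ.symm s) y) h1 hcomp.differentiableAt Y
    rw [Function.comp, this]
    change fderiv ℝ (fun t : E => f' (s, t)) c Y' = _
    rw [hcomp.fderiv]
    rfl
  have e2 : (fun y => dirDeriv (fun x => f x y) (1 : G) X) ∘ χ.symm =ᶠ[𝓝 c]
      fun s => fderiv ℝ f' (c, s) (X', 0) := by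
    filter_upwards [t2.eventually hd] with s hs
    have hcomp : HasFDerivAt (fun t : E => f' (t, s))
        ((fderiv ℝ f' (c, s)).comp (ContinuousLinearMap.inl ℝ E E)) c :=
      HasFDerivAt.comp (f := fun t : E => (t, s)) (g := f') c hs.hasFDerivAt
        (hasFDerivAt_prodMk_left c s)
    have := dirDeriv_eq_chart (1 : G) (fun x => f x (χ.symm s)) h1 hcomp.differentiableAt X
    rw [Function.comp, this]
    change fderiv ℝ (fun t : E => f' (t, s)) c X' = _
    rw [hcomp.fderiv]
    rfl
  have g1 : HasFDerivAt (fun s : E => fderiv ℝ f' (s, c) (0, Y'))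
      (((fderiv ℝ (fderiv ℝ f') (c, c)).comp (ContinuousLinearMap.inl ℝ E E)).flip (0, Y')) c := by
    have := (HasFDerivAt.comp (f := fun s : E => (s, c)) (g := fderiv ℝ f') c hfd.hasFDerivAt
      (hasFDerivAt_prodMk_left c c)).clm_apply (hasFDerivAt_const ((0 : E), Y') c)
    simpa using this
  have g2 : HasFDerivAt (fun s : E => fderiv ℝ f' (c, s) (X', 0))
      (((fderiv ℝ (fderiv ℝ f') (c, c)).comp (ContinuousLinearMap.inr ℝ E E)).flip (X', 0)) c := by
    have := (HasFDerivAt.comp (f := fun s : E => (c, s)) (g := fderiv ℝ f') c hfd.hasFDerivAt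
      (hasFDerivAt_prodMk_right c c)).clm_apply (hasFDerivAt_const (X', (0 : E)) c)
    simpa using this
  rw [dirDeriv_eq_chart (1 : G) _ h1 (g1.differentiableAt.congr_of_eventuallyEq e1),
    dirDeriv_eq_chart (1 : G) _ h1 (g2.differentiableAt.congr_of_eventuallyEq e2)]
  change fderiv ℝ (_ ∘ χ.symm) c X' = fderiv ℝ (_ ∘ χ.symm) c Y'
  rw [e1.fderiv_eq, e2.fderiv_eq, g1.fderiv, g2.fderiv]
  exact hsymm (X', 0) (0, Y')

/-- Smooth dependence on parameters of the derivative at `1`. The parameter space is any charted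
space, so that `G^N` with its product model is allowed. -/
theorem contMDiffAt_dirDeriv {E₁ H₁ M₁ : Type*} [NormedAddCommGroup E₁] [NormedSpace ℝ E₁]
    [TopologicalSpace H₁] {I₁ : ModelWithCorners ℝ E₁ H₁} [TopologicalSpace M₁] [ChartedSpace H₁ M₁]
    {f : M₁ → G → F} {x₀ : M₁}
    (hf : ContMDiffAt (I₁.prod 𝓘(ℝ, E)) 𝓘(ℝ, F) ∞ (Function.uncurry f) (x₀, 1))
    (hd : ∀ᶠ x in 𝓝 x₀, ContMDiffAt 𝓘(ℝ, E) 𝓘(ℝ, F) 1 (f x) 1)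
    (X : GroupLieAlgebra 𝓘(ℝ, E) G) :
    ContMDiffAt I₁ 𝓘(ℝ, F) ∞ (fun x => dirDeriv (f x) (1 : G) X) x₀ := by
  rw [contMDiffAt_iff_source]
  refine ContDiffWithinAt.contMDiffWithinAt ?_
  set χ := extChartAt 𝓘(ℝ, E) (1 : G) with hχ
  have h1 : (1 : G) ∈ χ.source := mem_extChartAt_source 1
  have hw : ContDiffWithinAt ℝ ∞ (Function.uncurry fun s t =>
      f ((extChartAt I₁ x₀).symm s) (χ.symm t))
      (Set.range I₁ ×ˢ Set.univ) (extChartAt I₁ x₀ x₀, χ 1) := by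
    have := (contMDiffAt_iff.1 hf).2
    simp only [ModelWithCorners.range_prod, extChartAt_prod] at this
    simpa using! this
  obtain ⟨X', hX'⟩ : ∃ X' : E, X' = (mfderiv 𝓘(ℝ, E) 𝓘(ℝ, E) χ (1 : G) X : E) := ⟨_, rfl⟩
  have h2 := ContDiffWithinAt.fderivWithin_apply (m := ∞) (k := fun _ => X') hw
    (contDiffWithinAt_const (c := χ 1)) contDiffWithinAt_const uniqueDiffOn_univ (by simp)
    (by simp [extChartAt]) (by simp)
  have hc : ∀ᶠ s in 𝓝[Set.range I₁] (extChartAt I₁ x₀ x₀),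
      ContMDiffAt 𝓘(ℝ, E) 𝓘(ℝ, F) 1 (f ((extChartAt I₁ x₀).symm s)) 1 := by
    have := (continuousAt_extChartAt_symm (I := I₁) x₀).tendsto
    rw [extChartAt_to_inv x₀] at this
    exact (this.eventually hd).filter_mono nhdsWithin_le_nhds
  refine h2.congr_of_eventuallyEq_of_mem (hc.mono fun s hs => ?_) (by simp [extChartAt])
  beta_reduce
  rw [fderivWithin_univ, hX']
  have hs' := (contMDiffAt_iff.1 hs).2
  simp only [modelWithCornersSelf_coe, Set.range_id, contDiffWithinAt_univ] at hs'
  exact dirDeriv_eq_chart (1 : G) _ h1 (hs'.differentiableAt one_ne_zero) X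

theorem contMDiff_dirDeriv {E₁ H₁ M₁ : Type*} [NormedAddCommGroup E₁] [NormedSpace ℝ E₁]
    [TopologicalSpace H₁] {I₁ : ModelWithCorners ℝ E₁ H₁} [TopologicalSpace M₁] [ChartedSpace H₁ M₁]
    {f : M₁ → G → F}
    (hf : ContMDiff (I₁.prod 𝓘(ℝ, E)) 𝓘(ℝ, F) ∞ (Function.uncurry f))
    (X : GroupLieAlgebra 𝓘(ℝ, E) G) :
    ContMDiff I₁ 𝓘(ℝ, F) ∞ (fun x => dirDeriv (f x) (1 : G) X) := fun x₀ =>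
  contMDiffAt_dirDeriv (hf (x₀, 1)) (Filter.Eventually.of_forall fun x =>
    (ContMDiffAt.comp (g := Function.uncurry f) (f := fun y : G => (x, y)) (1 : G) (hf _)
        (contMDiffAt_const.prodMk contMDiffAt_id)).of_le ENat.LEInfty.out) X

/-- The derivative along the diagonal is the sum of the two partial derivatives. -/
theorem dirDeriv_diag {f : G → G → F}
    (hf : ContMDiffAt (𝓘(ℝ, E).prod 𝓘(ℝ, E)) 𝓘(ℝ, F) ∞ (Function.uncurry f) (1, 1))
    (X : GroupLieAlgebra 𝓘(ℝ, E) G) :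
    dirDeriv (fun x => f x x) (1 : G) X =
      dirDeriv (fun x => f x 1) (1 : G) X + dirDeriv (fun x => f 1 x) (1 : G) X := by
  set χ := extChartAt 𝓘(ℝ, E) (1 : G) with hχ
  set c : E := χ 1 with hc
  let f' : E × E → F := fun p => f (χ.symm p.1) (χ.symm p.2)
  have h1 : (1 : G) ∈ χ.source := mem_extChartAt_source 1
  have l1 : χ.symm c = 1 := χ.left_inv h1
  have hf' : HasFDerivAt f' (fderiv ℝ f' (c, c)) (c, c) := by
    have := (contMDiffAt_iff.1 hf).2
    simp only [ModelWithCorners.range_eq_univ, contDiffWithinAt_univ, extChartAt_prod] at this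
    exact (this.differentiableAt (by simp)).hasFDerivAt
  have d1 := HasFDerivAt.comp (f := fun s : E => (s, c)) c hf' (hasFDerivAt_prodMk_left c c)
  have d2 := HasFDerivAt.comp (f := fun s : E => (c, s)) c hf' (hasFDerivAt_prodMk_right c c)
  have d3 := HasFDerivAt.comp (f := fun s : E => (s, s)) c hf'
    ((hasFDerivAt_id c).prodMk (hasFDerivAt_id c))
  have e1 : (f' ∘ fun s : E => (s, c)) = (fun x => f x 1) ∘ χ.symm := by
    funext s; simp only [Function.comp, f', l1]
  have e2 : (f' ∘ fun s : E => (c, s)) = (fun x => f 1 x) ∘ χ.symm := by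
    funext s; simp only [Function.comp, f', l1]
  rw [e1] at d1
  rw [e2] at d2
  rw [dirDeriv_eq_chart (1 : G) (fun x => f x x) h1 d3.differentiableAt,
    dirDeriv_eq_chart (1 : G) _ h1 d1.differentiableAt,
    dirDeriv_eq_chart (1 : G) _ h1 d2.differentiableAt]
  change fderiv ℝ (f' ∘ fun s : E => (s, s)) c _ = fderiv ℝ _ c _ + fderiv ℝ _ c _
  rw [d1.fderiv, d2.fderiv, d3.fderiv]
  have key : ∀ u : E,
      fderiv ℝ f' (c, c) (u, u) = fderiv ℝ f' (c, c) (u, 0) + fderiv ℝ f' (c, c) (0, u) := by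
    intro u
    rw [← map_add, Prod.mk_add_mk, add_zero, zero_add]
  exact key _

end Swap

/-! ### The adjoint action and its derivative -/

section Adjoint

variable {E F : Type*} [NormedAddCommGroup E] [NormedSpace ℝ E]
    [NormedAddCommGroup F] [NormedSpace ℝ F]
    {G : Type*} [TopologicalSpace G] [ChartedSpace E G] [Group G] [LieGroup 𝓘(ℝ, E) ∞ G]

theorem dirDeriv_inv {φ : G → F} (hφ : ContMDiffAt 𝓘(ℝ, E) 𝓘(ℝ, F) ∞ φ 1)
    (X : GroupLieAlgebra 𝓘(ℝ, E) G) :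
    dirDeriv (fun x => φ x⁻¹) (1 : G) X = -dirDeriv φ (1 : G) X := by
  have hf : ContMDiffAt (𝓘(ℝ, E).prod 𝓘(ℝ, E)) 𝓘(ℝ, F) ∞
      (Function.uncurry fun x y : G => φ (x * y⁻¹)) (1, 1) := by
    refine ContMDiffAt.comp (g := φ) (f := fun p : G × G => p.1 * p.2⁻¹) (1, 1) (by simpa using hφ)
      ?_
    exact (contMDiff_fst.mul contMDiff_snd.inv) _
  have := dirDeriv_diag hf X
  simp only [mul_inv_cancel, inv_one, mul_one, one_mul] at this
  have h0 : dirDeriv (fun _ : G => φ 1) (1 : G) X = 0 := by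
    unfold dirDeriv; rw [mfderiv_const]; rfl
  rw [h0] at this
  exact (neg_eq_of_add_eq_zero_right this.symm).symm

/-- Tangent vectors at `1` are separated by smooth functions. -/
theorem eq_of_dirDeriv {X Y : GroupLieAlgebra 𝓘(ℝ, E) G}
    (h : ∀ φ : G → E, ContMDiffAt 𝓘(ℝ, E) 𝓘(ℝ, E) ∞ φ 1 →
      dirDeriv φ (1 : G) X = dirDeriv φ (1 : G) Y) : X = Y := by
  have hinv : (mfderiv 𝓘(ℝ, E) 𝓘(ℝ, E) (extChartAt 𝓘(ℝ, E) (1 : G)) 1).IsInvertible :=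
    isInvertible_mfderiv_extChartAt (mem_extChartAt_source 1)
  exact hinv.injective (h _ contMDiffAt_extChartAt)

theorem adLin_mul (g h : G) (X : GroupLieAlgebra 𝓘(ℝ, E) G) :
    adLin (g * h) X = adLin g (adLin h X) := by
  refine eq_of_dirDeriv fun φ hφ => ?_
  have hd := hφ.mdifferentiableAt (by simp)
  have hg : MDifferentiableAt 𝓘(ℝ, E) 𝓘(ℝ, E) (fun x : G => φ (g * x * g⁻¹)) 1 :=
    MDifferentiableAt.comp (g := φ) (1 : G) (by simpa using hd)
      ((contMDiff_conj (E := E) g).mdifferentiable (by simp) 1)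
  rw [dirDeriv_adLin hd, dirDeriv_adLin hd, dirDeriv_adLin hg]
  simp only [mul_inv_rev, mul_assoc]

theorem adLin_one (X : GroupLieAlgebra 𝓘(ℝ, E) G) : adLin (1 : G) X = X := by
  refine eq_of_dirDeriv fun φ hφ => ?_
  rw [dirDeriv_adLin (hφ.mdifferentiableAt (by simp))]
  simp

theorem contMDiffAt_conj_uncurry {φ : G → F} (hφ : ContMDiffAt 𝓘(ℝ, E) 𝓘(ℝ, F) ∞ φ 1)
    (h : G) : ContMDiffAt (𝓘(ℝ, E).prod 𝓘(ℝ, E)) 𝓘(ℝ, F) ∞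
      (Function.uncurry fun x y : G => φ (x * y * x⁻¹)) (h, 1) := by
  refine ContMDiffAt.comp (g := φ) (f := fun p : G × G => p.1 * p.2 * p.1⁻¹) (h, 1)
    (by simpa using hφ) ?_
  exact ((contMDiff_fst.mul contMDiff_snd).mul contMDiff_fst.inv) _

/-- The Lie algebra of `G`, being the tangent space at `1`, is the model space `E`. -/
def tangentCoord : GroupLieAlgebra 𝓘(ℝ, E) G ≃ₗ[ℝ] E := LinearEquiv.refl ℝ E

theorem contMDiff_adLin (X : GroupLieAlgebra 𝓘(ℝ, E) G) :
    ContMDiff 𝓘(ℝ, E) 𝓘(ℝ, E) ∞ (fun x : G => tangentCoord (adLin x X)) := by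
  have hχ : ContMDiffAt 𝓘(ℝ, E) 𝓘(ℝ, E) ∞ (extChartAt 𝓘(ℝ, E) (1 : G)) 1 := contMDiffAt_extChartAt
  have hinv : (mfderiv 𝓘(ℝ, E) 𝓘(ℝ, E) (extChartAt 𝓘(ℝ, E) (1 : G)) 1).IsInvertible :=
    isInvertible_mfderiv_extChartAt (mem_extChartAt_source 1)
  obtain ⟨L, hL⟩ := hinv
  have h1 : ContMDiff 𝓘(ℝ, E) 𝓘(ℝ, E) ∞ (fun x : G =>
      dirDeriv (fun y => extChartAt 𝓘(ℝ, E) (1 : G) (x * y * x⁻¹)) (1 : G) X) := fun x =>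
    contMDiffAt_dirDeriv (contMDiffAt_conj_uncurry hχ x) (Filter.Eventually.of_forall fun x =>
      (ContMDiffAt.comp (g := extChartAt 𝓘(ℝ, E) (1 : G)) (1 : G) (by simpa using hχ)
        (contMDiff_conj x 1)).of_le ENat.LEInfty.out) X
  let L' : E →L[ℝ] E := L.symm.toContinuousLinearMap
  refine (L'.contMDiff.comp h1).congr fun x => ?_
  rw [Function.comp, ← dirDeriv_adLin (hχ.mdifferentiableAt (by simp))]
  unfold dirDeriv
  rw [← hL]
  exact (L.symm_apply_apply _).symm

theorem eventually_contMDiffAt {φ : G → F} (hφ : ContMDiffAt 𝓘(ℝ, E) 𝓘(ℝ, F) ∞ φ 1) :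
    ∀ᶠ x in 𝓝 (1 : G), ContMDiffAt 𝓘(ℝ, E) 𝓘(ℝ, F) 1 φ x :=
  (contMDiffAt_iff_contMDiffAt_nhds (by simp)).1 (hφ.of_le (m := 1) ENat.LEInfty.out)

/-- The differential of the adjoint representation is the Lie bracket. -/
theorem dirDeriv_adLin_apply [CompleteSpace E] (L : E →L[ℝ] F) (X Y : GroupLieAlgebra 𝓘(ℝ, E) G) :
    dirDeriv (fun x : G => L (tangentCoord (adLin x Y))) (1 : G) X = L (tangentCoord ⁅X, Y⁆) := by
  rw [dirDeriv_clm L ((contMDiff_adLin Y).mdifferentiable (by simp) 1)]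
  congr 1
  suffices h : tangentCoord.symm (dirDeriv (fun x : G => tangentCoord (adLin x Y)) (1 : G) X) =
      ⁅X, Y⁆ from (LinearEquiv.symm_apply_eq _).1 h
  refine eq_of_dirDeriv fun φ hφ => ?_
  have hφd := hφ.mdifferentiableAt (n := ∞) (by simp)
  have : IsTopologicalGroup G := topologicalGroup_of_lieGroup 𝓘(ℝ, E) ∞
  have ev : ∀ᶠ p : G × G in 𝓝 (1, 1), ContMDiffAt 𝓘(ℝ, E) 𝓘(ℝ, E) 1
      (fun y : G => φ (p.1 * y * p.2⁻¹)) 1 := by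
    have ht : Filter.Tendsto (fun p : G × G => p.1 * p.2⁻¹) (𝓝 (1, 1)) (𝓝 1) := by
      have : Continuous (fun p : G × G => p.1 * p.2⁻¹) := by fun_prop
      simpa using this.tendsto (1, 1)
    filter_upwards [ht.eventually (eventually_contMDiffAt hφ)] with p hp
    refine ContMDiffAt.comp (g := φ) (f := fun y : G => p.1 * y * p.2⁻¹) 1 (by simpa using hp) ?_
    exact ((contMDiff_mul_right (I := 𝓘(ℝ, E)) (n := ∞) (a := p.2⁻¹)).comp
      (contMDiff_mul_left (a := p.1)) 1).of_le ENat.LEInfty.out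
  let ψ : G → G → E := fun a b => dirDeriv (fun y => φ (a * y * b⁻¹)) (1 : G) Y
  have hψ : ContMDiffAt (𝓘(ℝ, E).prod 𝓘(ℝ, E)) 𝓘(ℝ, E) ∞ (Function.uncurry ψ) (1, 1) := by
    refine contMDiffAt_dirDeriv (M₁ := G × G) (f := fun p y => φ (p.1 * y * p.2⁻¹)) ?_ ev Y
    refine ContMDiffAt.comp (g := φ) (f := fun q : (G × G) × G => q.1.1 * q.2 * q.1.2⁻¹) _
      (by simpa using hφ) ?_
    exact (((contMDiff_fst.comp contMDiff_fst).mul contMDiff_snd).mul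
      (contMDiff_snd.comp contMDiff_fst).inv) _
  have hmul : ContMDiffAt (𝓘(ℝ, E).prod 𝓘(ℝ, E)) 𝓘(ℝ, E) ∞
      (Function.uncurry fun b y : G => φ (y * b)) (1, 1) :=
    ContMDiffAt.comp (g := φ) (f := fun q : G × G => q.2 * q.1) _
      (by simpa using hφ) ((contMDiff_snd.mul contMDiff_fst) _)
  have e1 : dirDeriv (fun a => ψ a 1) (1 : G) X =
      dirDeriv (fun x : G => dirDeriv (fun y : G => φ (x * y)) (1 : G) Y) (1 : G) X := by
    simp [ψ]
  have e2 : dirDeriv (fun b => ψ 1 b) (1 : G) X =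
      -dirDeriv (fun x : G => dirDeriv (fun y : G => φ (x * y)) (1 : G) X) (1 : G) Y := by
    rw [← dirDeriv_swap hmul]
    rw [← dirDeriv_inv]
    · simp [ψ]
    · refine contMDiffAt_dirDeriv hmul ?_ Y
      filter_upwards [eventually_contMDiffAt hφ] with b hb
      exact ContMDiffAt.comp (g := φ) (f := fun y : G => y * b) 1 (by simpa using hb)
        ((contMDiff_mul_right (I := 𝓘(ℝ, E)) (n := ∞) (a := b) 1).of_le ENat.LEInfty.out)
  have e3 : dirDeriv φ (1 : G) ((tangentCoord (E := E) (G := G)).symm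
      (dirDeriv (fun x : G => tangentCoord (E := E) (adLin x Y)) (1 : G) X)) =
      dirDeriv (fun x => ψ x x) (1 : G) X := by
    let Λ : E →L[ℝ] E := mfderiv 𝓘(ℝ, E) 𝓘(ℝ, E) φ (1 : G)
    have : (fun x => ψ x x) = fun x : G => Λ (tangentCoord (adLin x Y)) := by
      funext x
      exact (dirDeriv_adLin hφd x Y).symm
    rw [this]
    exact (dirDeriv_clm Λ ((contMDiff_adLin Y).mdifferentiable (by simp) 1) X).symm
  rw [e3, dirDeriv_diag hψ, e1, e2, dirDeriv_bracket hφ, sub_eq_add_neg]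

end Adjoint

/-! ### Integration of infinitesimal invariance on a connected group -/

section Connected

variable {E F : Type*} [NormedAddCommGroup E] [NormedSpace ℝ E] [FiniteDimensional ℝ E]
    [NormedAddCommGroup F] [NormedSpace ℝ F]
    {G : Type*} [TopologicalSpace G] [ChartedSpace E G] [Group G] [LieGroup 𝓘(ℝ, E) ∞ G]

/-- A left invariant vector field is determined by its value at any point. -/
theorem mulInvariantVectorField_injective (a : G) {X Y : GroupLieAlgebra 𝓘(ℝ, E) G}
    (h : (mulInvariantVectorField X a : TangentSpace 𝓘(ℝ, E) a) = mulInvariantVectorField Y a) :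
    X = Y := by
  refine eq_of_dirDeriv (E := E) fun φ hφ => ?_
  have hφ' : MDifferentiableAt 𝓘(ℝ, E) 𝓘(ℝ, E) φ (a⁻¹ * a) := by
    simpa using hφ.mdifferentiableAt (by simp)
  have hψ : MDifferentiableAt 𝓘(ℝ, E) 𝓘(ℝ, E) (fun z => φ (a⁻¹ * z)) a :=
    hφ'.comp a ((contMDiff_mul_left (I := 𝓘(ℝ, E)) (n := ∞) (a := a⁻¹)).mdifferentiable (by simp) a)
  have e : ∀ Z : GroupLieAlgebra 𝓘(ℝ, E) G,
      dirDeriv (fun z => φ (a⁻¹ * z)) a (mulInvariantVectorField Z a) = dirDeriv φ (1 : G) Z := by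
    intro Z
    rw [dirDeriv_mulInvariantVectorField hψ]
    simp
  rw [← e, ← e, h]

/-- Left translates of a basis of `𝔤` form a frame, and the coordinates of a vector with respect to
this frame are locally bounded, in the chart at `x₀`. -/
theorem exists_bound_frame (x₀ : G) : ∃ C : ℝ, ∀ᶠ y in 𝓝 (extChartAt 𝓘(ℝ, E) x₀ x₀),
    ∀ v : E, ∃ X : GroupLieAlgebra 𝓘(ℝ, E) G, ‖tangentCoord X‖ ≤ C * ‖v‖ ∧
      chartField x₀ (mulInvariantVectorField X) y = v := by
  set χ := extChartAt 𝓘(ℝ, E) x₀ with hχ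
  have h0 : x₀ ∈ χ.source := mem_extChartAt_source x₀
  let L : E → E →L[ℝ] E := fun y =>
    (mfderiv 𝓘(ℝ, E) 𝓘(ℝ, E) χ (χ.symm y) : E →L[ℝ] E).comp
      (mfderiv 𝓘(ℝ, E) 𝓘(ℝ, E) (fun b : G => χ.symm y * b) (1 : G) : E →L[ℝ] E)
  have hL : ∀ y ∈ χ.target, ∀ X : GroupLieAlgebra 𝓘(ℝ, E) G,
      chartField x₀ (mulInvariantVectorField X) y = L y (tangentCoord X) := fun y hy X =>
    chartField_apply x₀ _ hy
  have tgt : χ.target ∈ 𝓝 (χ x₀) := extChartAt_target_mem_nhds x₀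
  have hc : ContinuousAt L (χ x₀) := by
    rw [continuousAt_clm_apply]
    intro v
    have h1 : ContinuousAt (chartField x₀ (mulInvariantVectorField (tangentCoord.symm v)))
        (χ x₀) := (differentiableAt_chartField x₀
          (mdifferentiableAt_mulInvariantVectorField (tangentCoord.symm v))).continuousAt
    refine h1.congr ?_
    filter_upwards [tgt] with y hy
    rw [hL y hy, LinearEquiv.apply_symm_apply]
  have hu : IsUnit (L (χ x₀)) := by
    rw [ContinuousLinearMap.isUnit_iff_bijective]
    have hinj : Function.Injective (L (χ x₀)) := by
      have hz : χ.symm (χ x₀) ∈ χ.source := χ.map_target (χ.map_source h0)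
      exact (isInvertible_mfderiv_extChartAt hz).injective.comp
        fun u v huv => mulInvariantVectorField_injective (χ.symm (χ x₀)) huv
    exact ⟨hinj, LinearMap.injective_iff_surjective (f := (L (χ x₀)).toLinearMap).1 hinj⟩
  have hinv : ContinuousAt (fun y => Ring.inverse (L y)) (χ x₀) := by
    obtain ⟨u, hu⟩ := hu
    refine ContinuousAt.comp (g := Ring.inverse) ?_ hc
    rw [← hu]
    exact NormedRing.inverse_continuousAt u
  refine ⟨‖Ring.inverse (L (χ x₀))‖ + 1, ?_⟩
  filter_upwards [tgt, hc.eventually (Units.isOpen.mem_nhds hu),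
    hinv.norm.eventually (gt_mem_nhds (lt_add_one _))] with y hy huy hny v
  refine ⟨tangentCoord.symm (Ring.inverse (L y) v), ?_, ?_⟩
  · rw [LinearEquiv.apply_symm_apply]
    exact (Ring.inverse (L y)).le_of_opNorm_le hny.le v
  · rw [hL y hy, LinearEquiv.apply_symm_apply, ← mul_apply_eq_comp,
      Ring.mul_inverse_cancel _ huy, one_apply_eq_self]

/-- A smooth function on a connected Lie group that solves a homogeneous linear system along the
left invariant vector fields and vanishes at `1` is zero. -/
theorem eq_zero_of_dirDeriv [FiniteDimensional ℝ F] [ConnectedSpace G] {φ : G → F}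
    (hφ : ContMDiff 𝓘(ℝ, E) 𝓘(ℝ, F) ∞ φ) (A : E →ₗ[ℝ] F →ₗ[ℝ] F)
    (hA : ∀ g (X : GroupLieAlgebra 𝓘(ℝ, E) G),
      dirDeriv (fun y => φ (g * y)) (1 : G) X = A (tangentCoord X) (φ g))
    (h1 : φ 1 = 0) (g : G) : φ g = 0 := by
  have hcl : IsClopen {g | φ g = 0} := by
    refine ⟨isClosed_eq hφ.continuous continuous_const, isOpen_iff_mem_nhds.2 fun x₀ hx₀ => ?_⟩
    set χ := extChartAt 𝓘(ℝ, E) x₀ with hχ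
    obtain ⟨C, hC⟩ := exists_bound_frame (E := E) x₀
    obtain ⟨D, hD⟩ : ∃ D : ℝ, ∀ X f, ‖A X f‖ ≤ D * ‖X‖ * ‖f‖ := by
      let B : E →L[ℝ] F →L[ℝ] F :=
        LinearMap.toContinuousLinearMap (LinearMap.toContinuousLinearMap.toLinearMap ∘ₗ A)
      exact ⟨‖B‖, fun X f => B.le_opNorm₂ X f⟩
    obtain ⟨r, hr, hball⟩ := Metric.eventually_nhds_iff_ball.1
      (hC.and (extChartAt_target_mem_nhds (I := 𝓘(ℝ, E)) x₀))
    have hdiff : ∀ y ∈ χ.target, DifferentiableAt ℝ (φ ∘ χ.symm) y := by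
      intro y hy
      have : ContMDiffAt 𝓘(ℝ, E) 𝓘(ℝ, F) ∞ (φ ∘ χ.symm) y :=
        hφ.contMDiffAt.comp y ((contMDiffOn_extChartAt_symm x₀).contMDiffAt
          ((isOpen_extChartAt_target x₀).mem_nhds hy))
      exact this.contDiffAt.differentiableAt (by simp)
    -- the differential of `φ` is bounded by `φ` itself on a ball
    have hbd : ∀ y ∈ Metric.ball (χ x₀) r, ∀ v,
        ‖fderiv ℝ (φ ∘ χ.symm) y v‖ ≤ |D| * |C| * ‖v‖ * ‖(φ ∘ χ.symm) y‖ := by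
      intro y hy v
      obtain ⟨hb, ht⟩ := hball y hy
      obtain ⟨X, hX, hv⟩ := hb v
      have hz : χ.symm y ∈ χ.source := χ.map_target ht
      have e : χ (χ.symm y) = y := χ.right_inv ht
      have := dirDeriv_eq_chart x₀ φ hz (by rw [← hχ, e]; exact hdiff y ht)
        (mulInvariantVectorField X (χ.symm y))
      rw [← hχ, e] at this
      rw [← hv, chartField_apply x₀ _ ht]
      refine (congrArg norm this.symm).trans_le ?_
      rw [dirDeriv_mulInvariantVectorField (hφ.mdifferentiable (by simp) _), hA]
      rw [← chartField_apply x₀ _ ht, hv]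
      calc _ ≤ D * ‖tangentCoord X‖ * ‖φ (χ.symm y)‖ := hD _ _
        _ ≤ |D| * (|C| * ‖v‖) * ‖φ (χ.symm y)‖ := by
          gcongr
          · exact le_abs_self D
          · exact hX.trans (by gcongr; exact le_abs_self C)
        _ = _ := by simp only [Function.comp]; ring
    have hzero : ∀ y ∈ Metric.ball (χ x₀) r, (φ ∘ χ.symm) y = 0 := by
      intro y hy
      have hseg : ∀ t ∈ Set.Icc (0 : ℝ) 1, AffineMap.lineMap (χ x₀) y t ∈ Metric.ball (χ x₀) r :=
        fun t ht => (convex_ball (χ x₀) r).lineMap_mem (Metric.mem_ball_self hr) hy ht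
      have hder : ∀ t ∈ Set.Icc (0 : ℝ) 1,
          HasDerivAt (fun t : ℝ => (φ ∘ χ.symm) (AffineMap.lineMap (χ x₀) y t))
            (fderiv ℝ (φ ∘ χ.symm) (AffineMap.lineMap (χ x₀) y t) (y - χ x₀)) t := fun t ht =>
        (hdiff _ (hball _ (hseg t ht)).2).hasFDerivAt.comp_hasDerivAt t
          AffineMap.hasDerivAt_lineMap
      have := eq_zero_of_abs_deriv_le_mul_abs_self_of_eq_zero_right
        (f := fun t : ℝ => (φ ∘ χ.symm) (AffineMap.lineMap (χ x₀) y t)) (a := 0) (b := 1)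
        (K := |D| * |C| * ‖y - χ x₀‖)
        (fun t ht => (hder t ht).continuousAt.continuousWithinAt)
        (fun t ht => (hder t (Set.Ico_subset_Icc_self ht)).hasDerivWithinAt)
        (by simpa [χ] using hx₀)
        (fun t ht => hbd _ (hseg t (Set.Ico_subset_Icc_self ht)) _) 1 (by simp)
      simpa using this
    filter_upwards [(continuousAt_extChartAt (I := 𝓘(ℝ, E)) x₀).preimage_mem_nhds
      (Metric.ball_mem_nhds _ hr), extChartAt_source_mem_nhds (I := 𝓘(ℝ, E)) x₀] with z hz hz'
    have := hzero _ hz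
    rwa [Function.comp, χ.left_inv hz'] at this
  have := hcl.eq_univ ⟨1, h1⟩
  exact this.ge (Set.mem_univ g)

variable {V : Type*} [AddCommGroup V] [Module ℂ V] {π : Representation ℂ G V}

/-- A vector annihilated by the Lie algebra is fixed by a connected group. -/
theorem IsFinSmooth.apply_eq_self [ConnectedSpace G] (h : IsFinSmooth E π) {v : V}
    (hv : ∀ X, diffReal h X v = 0) (g : G) : π g v = v := by
  refine eq_of_dual fun l => ?_
  have hs : ContMDiff 𝓘(ℝ, E) 𝓘(ℝ, ℂ) ∞ fun x => l (π x v) := h.smooth v l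
  rw [← sub_eq_zero]
  refine eq_zero_of_dirDeriv (E := E) (φ := fun g => l (π g v) - l v)
    (hs.sub contMDiff_const) 0 (fun g X => ?_) (by simp) g
  have hd := h.mdiff v (l ∘ₗ π g) 1
  have h0 : dirDeriv (fun _ : G => -l v) (1 : G) X = 0 := by
    unfold dirDeriv; rw [mfderiv_const]; rfl
  have := dirDeriv_add hd (mdifferentiableAt_const (c := -l v)) X
  rw [h0, add_zero, ← dual_diffReal h, hv, map_zero] at this
  simpa [sub_eq_add_neg, map_mul] using this

/-- A finite dimensional subspace stable under the Lie algebra is stable under a connected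
group. -/
theorem IsFinSmooth.apply_mem [ConnectedSpace G] (h : IsFinSmooth E π) {W : Submodule ℂ V}
    [FiniteDimensional ℂ W] (hW : ∀ X, ∀ w ∈ W, diffReal h X w ∈ W) (g : G) {w : V} (hw : w ∈ W) :
    π g w ∈ W := by
  rw [← Subspace.forall_mem_dualAnnihilator_apply_eq_zero_iff]
  intro l hl
  rw [Submodule.mem_dualAnnihilator] at hl
  let b := Module.finBasis ℂ W
  let T : GroupLieAlgebra 𝓘(ℝ, E) G → W → W := fun X w => ⟨diffReal h X w, hW X w w.2⟩
  let d := Module.finrank ℂ W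
  let A : E →ₗ[ℝ] (Fin d → ℂ) →ₗ[ℝ] (Fin d → ℂ) :=
    LinearMap.mk₂ ℝ (fun X f i => ∑ j, b.repr (T (tangentCoord.symm X) (b i)) j * f j)
      (fun X Y f => by
        ext i
        have : T (tangentCoord.symm (X + Y)) (b i) =
          T (tangentCoord.symm X) (b i) + T (tangentCoord.symm Y) (b i) := by
          ext; simp [T]
        simp only [this]
        simp [add_mul, Finset.sum_add_distrib])
      (fun a X f => by
        ext i
        have : T (tangentCoord.symm (a • X)) (b i) = (a : ℂ) • T (tangentCoord.symm X) (b i) := by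
          ext; simp [T]
        simp only [this]
        simp only [map_smul, Finsupp.smul_apply, smul_eq_mul, Pi.smul_apply,
          Complex.real_smul, Finset.mul_sum, mul_assoc])
      (fun X f f' => by ext i; simp [mul_add, Finset.sum_add_distrib])
      (fun a X f => by
        ext i; simp only [Pi.smul_apply, Complex.real_smul, Finset.mul_sum]
        exact Finset.sum_congr rfl fun _ _ => by ring)
  have hs : ∀ v, ContMDiff 𝓘(ℝ, E) 𝓘(ℝ, ℂ) ∞ fun x => l (π x v) := fun v => h.smooth v l
  have key := eq_zero_of_dirDeriv (E := E) (φ := fun g (i : Fin d) => l (π g (b i)))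
    (contMDiff_pi_space.2 fun i => hs _) A (fun g X => ?_)
    (by ext i; simpa using hl _ (b i).2)
  · have : ∀ w : W, l (π g w) = 0 := by
      intro w
      rw [← b.sum_repr w]
      simp only [Submodule.coe_sum, map_sum, Submodule.coe_smul, map_smul]
      exact Finset.sum_eq_zero fun i _ => by rw [show l (π g (b i)) = 0 from congrFun (key g) i,
        smul_zero]
    exact this ⟨w, hw⟩
  · ext i
    have hsm : ContMDiff 𝓘(ℝ, E) 𝓘(ℝ, Fin d → ℂ) ∞ (fun y (i : Fin d) => l (π (g * y) (b i))) :=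
      contMDiff_pi_space.2 fun i => (hs _).comp (contMDiff_mul_left (a := g))
    have e := dirDeriv_clm (ContinuousLinearMap.proj (R := ℝ) (φ := fun _ : Fin d => ℂ) i)
      (hsm.mdifferentiable (by simp) 1) X
    simp only [ContinuousLinearMap.proj_apply] at e
    rw [← e]
    have e2 := dual_diffReal h X (b i) (l ∘ₗ π g)
    simp only [LinearMap.comp_apply] at e2
    simp only [map_mul, Module.End.mul_apply]
    rw [← e2]
    have e3 : diffReal h X (b i) = ((∑ j, b.repr (T X (b i)) j • b j : W) : V) := by
      rw [b.sum_repr]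
    rw [e3]
    simp only [Submodule.coe_sum, map_sum, Submodule.coe_smul, map_smul, A]
    rfl

end Connected

/-! ### Averaging over a compact group -/

section Average

variable {K : Type*} [Group K] {U : Type*} [AddCommGroup U] [Module ℂ U]

/-- Every orbit map `x ↦ π(x) v` is a finite combination of fixed vectors with continuous
coefficients. -/
def IsFinContinuous [TopologicalSpace K] (π : Representation ℂ K U) : Prop :=
  ∀ v : U, ∃ (d : ℕ) (c : Fin d → K → ℂ) (w : Fin d → U),
    (∀ k, Continuous (c k)) ∧ ∀ x, π x v = ∑ k, c k x • w k

/-- Averaging over a compact group: the affine span of every orbit contains an invariant vector. -/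
theorem IsFinContinuous.exists_invariant [TopologicalSpace K] [IsTopologicalGroup K]
    [CompactSpace K] {π : Representation ℂ K U} (h : IsFinContinuous π) (v : U) :
    ∃ w, (∀ x, π x w = w) ∧ w - v ∈ Submodule.span ℂ (Set.range fun x => π x v - v) := by
  let _ : MeasurableSpace K := borel K
  have : BorelSpace K := ⟨rfl⟩
  let μ : MeasureTheory.Measure K := MeasureTheory.Measure.haarMeasure ⊤
  have : MeasureTheory.IsProbabilityMeasure μ := ⟨MeasureTheory.Measure.haarMeasure_self⟩
  obtain ⟨d, c, w, hc, hw⟩ := h v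
  have hint : ∀ k, MeasureTheory.Integrable (c k) μ := fun k =>
    (hc k).integrable_of_hasCompactSupport (HasCompactSupport.of_compactSpace _)
  have key : ∀ l : Module.Dual ℂ U, l (∑ k, (∫ x, c k x ∂μ) • w k) = ∫ x, l (π x v) ∂μ := by
    intro l
    simp only [hw, map_sum, map_smul, smul_eq_mul]
    rw [MeasureTheory.integral_finsetSum _ fun k _ => (hint k).mul_const _]
    exact Finset.sum_congr rfl fun k _ => (MeasureTheory.integral_mul_const _ _).symm
  refine ⟨∑ k, (∫ x, c k x ∂μ) • w k, fun y => eq_of_dual fun l => ?_, ?_⟩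
  · have := key (l ∘ₗ π y)
    rw [LinearMap.comp_apply] at this
    rw [this, key]
    have e := MeasureTheory.integral_mul_left_eq_self (μ := μ) (fun x => l (π x v)) y
    simpa only [map_mul, Module.End.mul_apply, LinearMap.comp_apply] using e
  · rw [← Subspace.forall_mem_dualAnnihilator_apply_eq_zero_iff]
    intro l hl
    rw [Submodule.mem_dualAnnihilator] at hl
    have hl' : ∀ x, l (π x v) = l v := fun x => by
      rw [← sub_eq_zero, ← map_sub]
      exact hl _ (Submodule.subset_span ⟨x, rfl⟩)
    rw [map_sub, key]
    simp [hl']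

/-- If a linear map is constant on an orbit, then it takes the same value on the average. -/
theorem map_eq_of_sub_mem_span {U' : Type*} [AddCommGroup U'] [Module ℂ U']
    {π : Representation ℂ K U} {v w : U}
    (hw : w - v ∈ Submodule.span ℂ (Set.range fun x => π x v - v)) (T : U →ₗ[ℂ] U') {u : U'}
    (hT : ∀ x, T (π x v) = u) : T w = u := by
  have hv : T v = u := by simpa using hT 1
  have : Submodule.span ℂ (Set.range fun x => π x v - v) ≤ LinearMap.ker T := by
    rw [Submodule.span_le]
    rintro _ ⟨x, rfl⟩
    simp [hT, hv]
  have := this hw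
  rw [LinearMap.mem_ker, map_sub, sub_eq_zero] at this
  rw [this, hv]

end Average

/-! ### The universal enveloping algebra, its center and its antipode -/

section Enveloping

variable {E : Type*} [NormedAddCommGroup E] [NormedSpace ℝ E] [CompleteSpace E]
    {G : Type*} [TopologicalSpace G] [ChartedSpace E G] [Group G] [LieGroup 𝓘(ℝ, E) ∞ G]

/-- The algebra `U𝔤` is generated by `𝔤`. -/
theorem ug_subalgebra_eq_top {S : Subalgebra ℂ (Ug E G)}
    (h : ∀ X : GroupLieAlgebra 𝓘(ℝ, E) G, ugIncl X ∈ S) : S = ⊤ := by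
  let f : GroupLieAlgebra 𝓘(ℝ, E) G →ₗ[ℝ] S :=
    { toFun := fun X => ⟨ugIncl X, h X⟩
      map_add' := fun X Y => Subtype.ext (map_add ugIncl X Y)
      map_smul' := fun a X => Subtype.ext (map_smul ugIncl a X) }
  have hf : ∀ X Y, f ⁅X, Y⁆ = f X * f Y - f Y * f X := fun X Y => Subtype.ext (ugIncl_lie X Y)
  have e : S.val.comp (ugLift f hf) = AlgHom.id ℂ (Ug E G) := ug_hom_ext fun X => by
    rw [AlgHom.comp_apply, ugLift_ugIncl]
    rfl
  refine eq_top_iff.2 fun u _ => ?_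
  have := DFunLike.congr_fun e u
  rw [← show _ = u from this]
  exact (ugLift f hf u).2

theorem adUg_ugIncl (g : G) (X : GroupLieAlgebra 𝓘(ℝ, E) G) :
    adUg g (ugIncl X) = ugIncl (adLin g X) := ugLift_ugIncl _ _ X

variable (E G) in
/-- The adjoint representation of `G` on `U𝔤`. -/
def adRep : Representation ℂ G (Ug E G) where
  toFun g := (adUg g).toLinearMap
  map_one' := by
    have : (adUg (1 : G) : Ug E G →ₐ[ℂ] Ug E G) = AlgHom.id ℂ _ := ug_hom_ext fun X => by
      rw [adUg_ugIncl, adLin_one]; rfl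
    rw [this]; rfl
  map_mul' g h := by
    have : (adUg (g * h) : Ug E G →ₐ[ℂ] Ug E G) = (adUg g).comp (adUg h) := ug_hom_ext fun X => by
      rw [AlgHom.comp_apply, adUg_ugIncl, adUg_ugIncl, adUg_ugIncl, adLin_mul]
    rw [this]; rfl

theorem adRep_apply (g : G) (u : Ug E G) : adRep E G g u = adUg g u := rfl

/-- The adjoint representation on `U𝔤` is locally finite: the elements with a finite dimensional
smooth orbit form a subalgebra, which contains `𝔤`. -/
theorem isFinSmooth_adRep [FiniteDimensional ℝ E] : IsFinSmooth E (adRep E G) := by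
  let S : Subalgebra ℂ (Ug E G) :=
    { carrier := {u | ∃ (d : ℕ) (c : G → Fin d → ℂ) (w : Fin d → Ug E G),
        ContMDiff 𝓘(ℝ, E) 𝓘(ℝ, Fin d → ℂ) ∞ c ∧ ∀ x, adRep E G x u = ∑ k, c x k • w k}
      mul_mem' := by
        rintro u v ⟨d, c, w, hc, hw⟩ ⟨d', c', w', hc', hw'⟩
        refine ⟨d * d', fun x k => c x (finProdFinEquiv.symm k).1 * c' x (finProdFinEquiv.symm k).2,
          fun k => w (finProdFinEquiv.symm k).1 * w' (finProdFinEquiv.symm k).2, ?_, fun x => ?_⟩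
        · rw [contMDiff_pi_space] at hc hc' ⊢
          exact fun k => (contDiff_mul (𝕜 := ℝ) (𝔸 := ℂ) (n := ∞)).contMDiff.comp
            ((hc _).prodMk_space (hc' _))
        · rw [adRep_apply, map_mul, ← adRep_apply, ← adRep_apply, hw, hw', Finset.sum_mul_sum,
            ← finProdFinEquiv.sum_comp, Fintype.sum_prod_type]
          simp only [Equiv.symm_apply_apply, smul_mul_smul_comm]
      add_mem' := by
        rintro u v ⟨d, c, w, hc, hw⟩ ⟨d', c', w', hc', hw'⟩
        refine ⟨d + d', fun x => Fin.append (c x) (c' x), Fin.append w w', ?_, fun x => ?_⟩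
        · rw [contMDiff_pi_space] at hc hc' ⊢
          intro i
          induction i using Fin.addCases with
          | left i => simpa using hc i
          | right i => simpa using hc' i
        · rw [map_add, hw, hw', Fin.sum_univ_add]
          simp
      algebraMap_mem' := fun a => ⟨1, fun _ _ => a, fun _ => 1, contMDiff_const, fun x => by
        rw [adRep_apply, AlgHom.commutes, Algebra.algebraMap_eq_smul_one]
        simp⟩ }
  have hS : S = ⊤ := ug_subalgebra_eq_top fun X => by
    let b := Module.finBasis ℝ E
    refine ⟨_, fun x k => (b.repr (tangentCoord (adLin x X)) k : ℂ),
      fun k => ugIncl (tangentCoord.symm (b k)), ?_, fun x => ?_⟩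
    · refine contMDiff_pi_space.2 fun k => ?_
      let L : E →L[ℝ] ℂ := Complex.ofRealCLM.comp
        (LinearMap.toContinuousLinearMap (b.coord k))
      exact L.contMDiff.comp (contMDiff_adLin X)
    · rw [adRep_apply, adUg_ugIncl]
      have h1 : adLin x X = ∑ k, b.repr (tangentCoord (adLin x X)) k • tangentCoord.symm (b k) := by
        apply tangentCoord.injective
        rw [map_sum]
        simp only [map_smul, LinearEquiv.apply_symm_apply]
        exact (b.sum_repr _).symm
      conv_lhs => rw [h1]
      rw [map_sum]
      exact Finset.sum_congr rfl fun k _ => by rw [map_smul, Complex.coe_smul]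
  intro u
  have hu : u ∈ S := hS ▸ Algebra.mem_top
  exact hu

theorem IsFinSmooth.isFinContinuous {V : Type*} [AddCommGroup V] [Module ℂ V]
    {π : Representation ℂ G V} (h : IsFinSmooth E π) : IsFinContinuous π := by
  intro v
  obtain ⟨d, c, w, hc, hw⟩ := h v
  exact ⟨d, fun k x => c x k, w, fun k => (continuous_apply k).comp hc.continuous, hw⟩

theorem contMDiff_mul_fun {E₁ H₁ M₁ : Type*} [NormedAddCommGroup E₁] [NormedSpace ℝ E₁]
    [TopologicalSpace H₁] {I₁ : ModelWithCorners ℝ E₁ H₁} [TopologicalSpace M₁]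
    [ChartedSpace H₁ M₁] {f g : M₁ → ℂ} (hf : ContMDiff I₁ 𝓘(ℝ, ℂ) ∞ f)
    (hg : ContMDiff I₁ 𝓘(ℝ, ℂ) ∞ g) : ContMDiff I₁ 𝓘(ℝ, ℂ) ∞ fun x => f x * g x :=
  (contDiff_mul (𝕜 := ℝ) (𝔸 := ℂ) (n := ∞)).contMDiff.comp (hf.prodMk_space hg)

/-- The differential of the adjoint representation on `U𝔤` is given by commutators. -/
theorem diffReal_adRep [FiniteDimensional ℝ E] (X : GroupLieAlgebra 𝓘(ℝ, E) G) (u : Ug E G) :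
    diffReal isFinSmooth_adRep X u = ugIncl X * u - u * ugIncl X := by
  let D := diffReal (isFinSmooth_adRep (E := E) (G := G)) X
  -- `D` and the commutator with `X` are derivations that agree on `𝔤`
  have hmul : ∀ u v, D (u * v) = D u * v + u * D v := by
    intro u v
    refine eq_of_dual fun l => ?_
    rw [dual_diffReal, map_add]
    obtain ⟨d, c, w, hc, hw⟩ := isFinSmooth_adRep (E := E) u
    obtain ⟨d', c', w', hc', hw'⟩ := isFinSmooth_adRep (E := E) v
    rw [contMDiff_pi_space] at hc hc'
    have hs : ContMDiff (𝓘(ℝ, E).prod 𝓘(ℝ, E)) 𝓘(ℝ, ℂ) ∞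
        (Function.uncurry fun a b : G => l (adRep E G a u * adRep E G b v)) := by
      have : (Function.uncurry fun a b : G => l (adRep E G a u * adRep E G b v)) =
          fun p : G × G => ∑ i, ∑ j, c p.1 i * c' p.2 j * l (w i * w' j) := by
        funext p
        simp only [Function.uncurry, hw, hw', Finset.sum_mul_sum, smul_mul_smul_comm, map_sum,
          map_smul, smul_eq_mul]
      rw [this]
      refine contMDiff_finsetSum fun i _ => contMDiff_finsetSum fun j _ => ?_
      exact contMDiff_mul_fun (contMDiff_mul_fun ((hc i).comp contMDiff_fst)
        ((hc' j).comp contMDiff_snd)) contMDiff_const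
    have e := dirDeriv_diag (hs (1, 1)) X
    have e1 : (fun x => l (adRep E G x (u * v))) =
        fun x => l (adRep E G x u * adRep E G x v) := by
      funext x; simp only [adRep_apply, map_mul]
    rw [e1, e]
    congr 1
    · rw [← LinearMap.mulRight_apply (R := ℂ) v (D u), ← LinearMap.comp_apply, dual_diffReal]
      simp
    · rw [← LinearMap.mulLeft_apply (R := ℂ) u (D v), ← LinearMap.comp_apply, dual_diffReal]
      simp
  let S : Subalgebra ℂ (Ug E G) :=
    { carrier := {u | D u = ugIncl X * u - u * ugIncl X}
      mul_mem' := by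
        intro u v hu hv
        simp only [Set.mem_ofPred_eq] at hu hv ⊢
        rw [hmul, hu, hv]
        noncomm_ring
      add_mem' := by
        intro u v hu hv
        simp only [Set.mem_ofPred_eq] at hu hv ⊢
        rw [map_add, hu, hv]
        noncomm_ring
      algebraMap_mem' := fun a => by
        have h1 : D 1 = 0 := by
          have := hmul 1 1
          rw [mul_one, mul_one, one_mul] at this
          exact left_eq_add.1 this
        simp [Algebra.algebraMap_eq_smul_one, h1] }
  have hS : S = ⊤ := ug_subalgebra_eq_top fun Y => by
    change D (ugIncl Y) = _
    rw [← ugIncl_lie]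
    refine eq_of_dual fun l => ?_
    rw [dual_diffReal]
    let L : E →L[ℝ] ℂ := LinearMap.toContinuousLinearMap
      (l.restrictScalars ℝ ∘ₗ ugIncl ∘ₗ tangentCoord.symm.toLinearMap)
    have e := dirDeriv_adLin_apply L X Y
    have hL : ∀ Z : GroupLieAlgebra 𝓘(ℝ, E) G, L (tangentCoord Z) = l (ugIncl Z) := fun Z => by
      simp [L]
    simp only [hL] at e
    simpa only [adRep_apply, adUg_ugIncl] using e
  have hu : u ∈ S := hS ▸ Algebra.mem_top
  exact hu

/-- The center of `U𝔤` consists of invariants of the adjoint action of a connected group. -/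
theorem adUg_eq_self_of_mem_center [FiniteDimensional ℝ E] [ConnectedSpace G] {z : Ug E G}
    (hz : z ∈ Subalgebra.center ℂ (Ug E G)) (g : G) : adUg g z = z := by
  refine isFinSmooth_adRep.apply_eq_self (fun X => ?_) g
  rw [diffReal_adRep, (Subalgebra.mem_center_iff.1 hz) (ugIncl X), sub_self]

/-- Invariants of the adjoint action are central, since they commute with `𝔤` by differentiation. In
contrast with the converse, the group need not be connected. -/
theorem mem_center_of_adUg_eq_self [FiniteDimensional ℝ E] {z : Ug E G}
    (hz : ∀ g, adUg g z = z) : z ∈ Subalgebra.center ℂ (Ug E G) := by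
  have hS : Subalgebra.centralizer ℂ {z} = (⊤ : Subalgebra ℂ (Ug E G)) :=
    ug_subalgebra_eq_top fun X => by
      rw [Subalgebra.mem_centralizer_iff]
      intro z' hz'
      rw [Set.mem_singleton_iff.1 hz']
      have h0 : diffReal isFinSmooth_adRep X z = 0 := eq_of_dual fun l => by
        rw [dual_diffReal]
        simp only [adRep_apply, hz]
        unfold dirDeriv
        rw [mfderiv_const, map_zero]
        rfl
      rw [diffReal_adRep, sub_eq_zero] at h0
      exact h0.symm
  rw [Subalgebra.mem_center_iff]
  intro u
  have hu : u ∈ Subalgebra.centralizer ℂ {z} := hS ▸ Algebra.mem_top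
  exact ((Subalgebra.mem_centralizer_iff ℂ).1 hu z rfl).symm

theorem antipode_mul (u v : Ug E G) : antipode (u * v) = antipode v * antipode u := by
  simp [antipode]

theorem antipode_ugIncl (X : GroupLieAlgebra 𝓘(ℝ, E) G) :
    antipode (ugIncl X : Ug E G) = -ugIncl X := by
  rw [antipode, antipodeOp, ugLift_ugIncl]
  simp

/-- The antipode as a linear map. -/
def antipodeLin : Ug E G →ₗ[ℂ] Ug E G :=
  (MulOpposite.opLinearEquiv ℂ).symm.toLinearMap ∘ₗ antipodeOp.toLinearMap

theorem antipodeLin_apply (u : Ug E G) : antipodeLin u = antipode u := rfl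

theorem antipode_antipode (u : Ug E G) : antipode (antipode u) = u := by
  let S : Subalgebra ℂ (Ug E G) :=
    { carrier := {u | antipode (antipode u) = u}
      mul_mem' := by
        intro u v hu hv
        simp only [Set.mem_ofPred_eq] at hu hv ⊢
        rw [antipode_mul, antipode_mul, hu, hv]
      add_mem' := by
        intro u v hu hv
        simp only [Set.mem_ofPred_eq, ← antipodeLin_apply] at hu hv ⊢
        rw [map_add, map_add, hu, hv]
      algebraMap_mem' := fun a => by simp [antipode] }
  have hS : S = ⊤ := ug_subalgebra_eq_top fun X => by
    change antipode (antipode (ugIncl X)) = ugIncl X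
    rw [antipode_ugIncl, ← antipodeLin_apply, map_neg, antipodeLin_apply, antipode_ugIncl, neg_neg]
  have hu : u ∈ S := hS ▸ Algebra.mem_top
  exact hu

theorem antipode_mem_center {z : Ug E G} (hz : z ∈ Subalgebra.center ℂ (Ug E G)) :
    antipode z ∈ Subalgebra.center ℂ (Ug E G) := by
  rw [Subalgebra.mem_center_iff] at hz ⊢
  intro u
  have := congrArg antipode (hz (antipode u))
  rw [antipode_mul, antipode_mul, antipode_antipode] at this
  exact this.symm

end Enveloping

/-! ### Tensor products of algebras -/

section PiTensor

variable {N : ℕ} {A B : Fin N → Type*} [∀ i, Ring (A i)] [∀ i, Algebra ℂ (A i)]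
    [∀ i, Ring (B i)] [∀ i, Algebra ℂ (B i)]

/-- A tensor product of algebras is generated by its factors. -/
theorem piTensor_subalgebra_eq_top {S : Subalgebra ℂ (⨂[ℂ] i, A i)}
    (h : ∀ j a, PiTensorProduct.singleAlgHom (R := ℂ) (A := A) j a ∈ S) : S = ⊤ := by
  refine eq_top_iff.2 fun u _ => ?_
  induction u using PiTensorProduct.induction_on with
  | smul_tprod r a =>
    refine S.smul_mem ?_ r
    have hx : ((Finset.univ : Finset (Fin N)) : Set (Fin N)).Pairwise
        (Function.onFun Commute fun i => Pi.mulSingle i (a i)) :=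
      fun i _ j _ _ => Pi.mulSingle_apply_commute a i j
    have e := PiTensorProduct.tprod_noncommProd (R := ℂ) Finset.univ
      (fun i => Pi.mulSingle i (a i)) hx
    rw [Finset.noncommProd_mulSingle] at e
    rw [e]
    exact S.toSubmonoid.noncommProd_mem _ _ _ fun i _ => h i (a i)
  | add x y hx hy => exact S.add_mem (hx trivial) (hy trivial)

theorem piTensorMap_tprod (f : ∀ i, A i →ₐ[ℂ] B i) (a : ∀ i, A i) :
    piTensorMap f (PiTensorProduct.tprod ℂ a) = PiTensorProduct.tprod ℂ fun i => f i (a i) :=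
  PiTensorProduct.lift.tprod a

theorem piTensorMap_singleAlgHom (f : ∀ i, A i →ₐ[ℂ] B i) (j : Fin N) (a : A j) :
    piTensorMap f (PiTensorProduct.singleAlgHom (R := ℂ) (A := A) j a) =
      PiTensorProduct.singleAlgHom (R := ℂ) (A := B) j (f j a) := by
  rw [PiTensorProduct.singleAlgHom_apply, PiTensorProduct.singleAlgHom_apply, piTensorMap_tprod]
  congr 1
  funext i
  by_cases hi : i = j
  · subst hi; simp
  · simp [Pi.mulSingle_eq_of_ne hi]

theorem list_prod_ofFn_eq {M : Type*} [Monoid M] {n : ℕ} {f : Fin n → M} (j : Fin n)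
    (h : ∀ i, i ≠ j → f i = 1) : (List.ofFn f).prod = f j := by
  induction n with
  | zero => exact j.elim0
  | succ n ih =>
    rw [List.ofFn_succ, List.prod_cons]
    cases j using Fin.cases with
    | zero =>
      rw [List.prod_eq_one, mul_one]
      intro x hx
      obtain ⟨i, rfl⟩ := (List.mem_ofFn' _ _).1 hx
      exact h _ (Fin.succ_ne_zero i)
    | succ j =>
      rw [h 0 (Fin.succ_ne_zero j).symm, one_mul]
      exact ih j fun i hi => h _ fun e => hi (Fin.succ_injective _ e)

end PiTensor

/-! ### Invariant differential operators on smooth functions -/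

section SmoothFunctions

variable {E : Type*} [NormedAddCommGroup E] [NormedSpace ℝ E] [CompleteSpace E]
    {G : Type*} [TopologicalSpace G] [ChartedSpace E G] [Group G] [LieGroup 𝓘(ℝ, E) ∞ G] {N : ℕ}

/-- A relation `t φ(u) = ψ(u) t` between two actions of `U𝔤` need only be checked on `𝔤`. -/
theorem ug_intertwine {A : Type*} [Ring A] [Algebra ℂ A] {φ ψ : Ug E G →ₐ[ℂ] A} {t : A}
    (h : ∀ X : GroupLieAlgebra 𝓘(ℝ, E) G, t * φ (ugIncl X) = ψ (ugIncl X) * t) (u : Ug E G) :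
    t * φ u = ψ u * t := by
  let S : Subalgebra ℂ (Ug E G) :=
    { carrier := {u | t * φ u = ψ u * t}
      mul_mem' := by
        intro u v hu hv
        simp only [Set.mem_ofPred_eq] at hu hv ⊢
        rw [map_mul, map_mul, ← mul_assoc, hu, mul_assoc, hv, mul_assoc]
      add_mem' := by
        intro u v hu hv
        simp only [Set.mem_ofPred_eq] at hu hv ⊢
        rw [map_add, map_add, mul_add, add_mul, hu, hv]
      algebraMap_mem' := fun a => by
        simp only [Set.mem_ofPred_eq, AlgHom.commutes]
        exact (Algebra.commutes a t).symm }
  have hS : S = ⊤ := ug_subalgebra_eq_top h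
  have hu : u ∈ S := hS ▸ Algebra.mem_top
  exact hu

theorem ug_commute {A : Type*} [Ring A] [Algebra ℂ A] {φ ψ : Ug E G →ₐ[ℂ] A}
    (h : ∀ X Y : GroupLieAlgebra 𝓘(ℝ, E) G, Commute (φ (ugIncl X)) (ψ (ugIncl Y)))
    (u v : Ug E G) : Commute (φ u) (ψ v) :=
  ug_intertwine (fun Y => (ug_intertwine (fun X => (h X Y).symm) u).symm) v

theorem contMDiff_piApply (i : Fin N) :
    ContMDiff (powModel E N) 𝓘(ℝ, E) ∞ fun g : Fin N → G => g i := by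
  intro g
  rw [contMDiffAt_iff]
  refine ⟨(continuous_apply i).continuousAt, ?_⟩
  have hnhds : ∀ᶠ y in 𝓝 (extChartAt (powModel E N) g g), y i ∈ (extChartAt 𝓘(ℝ, E) (g i)).target :=
    (continuous_apply (A := fun _ : Fin N => E) i).continuousAt.eventually_mem
      (extChartAt_target_mem_nhds (I := 𝓘(ℝ, E)) (g i))
  have hproj : ContDiffWithinAt ℝ ∞ (fun y : Fin N → E => y i) (Set.range (powModel E N))
      (extChartAt (powModel E N) g g) := (contDiff_apply ℝ E i).contDiffWithinAt
  refine hproj.congr_of_eventuallyEq (eventually_nhdsWithin_of_eventually_nhds ?_) ?_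
  · filter_upwards [hnhds] with y hy
    exact (extChartAt 𝓘(ℝ, E) (g i)).right_inv hy
  · exact (extChartAt 𝓘(ℝ, E) (g i)).right_inv hnhds.self_of_nhds

variable (E G N) in
/-- A smooth right action of the Lie group `G` on the manifold `G^N`. -/
structure RightAction where
  act : G → (Fin N → G) → Fin N → G
  act_one : ∀ g, act 1 g = g
  act_mul : ∀ x y g, act (x * y) g = act y (act x g)
  smooth : ContMDiff ((powModel E N).prod 𝓘(ℝ, E)) (powModel E N) ∞
    fun p : (Fin N → G) × G => act p.2 p.1

namespace RightAction

variable (α β : RightAction E G N)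

theorem contMDiff_comp {E₁ H₁ M₁ : Type*} [NormedAddCommGroup E₁] [NormedSpace ℝ E₁]
    [TopologicalSpace H₁] {I₁ : ModelWithCorners ℝ E₁ H₁} [TopologicalSpace M₁]
    [ChartedSpace H₁ M₁] {a : M₁ → Fin N → G} {b : M₁ → G} (ha : ContMDiff I₁ (powModel E N) ∞ a)
    (hb : ContMDiff I₁ 𝓘(ℝ, E) ∞ b) :
    ContMDiff I₁ (powModel E N) ∞ fun x => α.act (b x) (a x) :=
  α.smooth.comp (f := fun x => (a x, b x)) (ha.prodMk hb)

theorem contMDiff_orbit (f : smoothFun E G N) (g : Fin N → G) :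
    ContMDiff 𝓘(ℝ, E) 𝓘(ℝ, ℂ) ∞ fun x => f.1 (α.act x g) :=
  ContMDiff.comp (g := f.1) f.2 (α.contMDiff_comp contMDiff_const contMDiff_id)

/-- The vector field on `G^N` generated by `X ∈ 𝔤`, as an operator on smooth functions. -/
def deriv : GroupLieAlgebra 𝓘(ℝ, E) G →ₗ[ℝ] Module.End ℂ (smoothFun E G N) where
  toFun X :=
    { toFun := fun f => ⟨fun g => dirDeriv (fun x => f.1 (α.act x g)) (1 : G) X,
        contMDiff_dirDeriv (f := fun g x => f.1 (α.act x g)) (ContMDiff.comp (g := f.1) f.2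
          (α.contMDiff_comp contMDiff_fst contMDiff_snd)) X⟩
      map_add' := fun f f' => Subtype.ext <| funext fun g =>
        dirDeriv_add ((α.contMDiff_orbit f g).mdifferentiable (by simp) 1)
          ((α.contMDiff_orbit f' g).mdifferentiable (by simp) 1) X
      map_smul' := fun a f => Subtype.ext <| funext fun g =>
        dirDeriv_const_mul ((α.contMDiff_orbit f g).mdifferentiable (by simp) 1) a X }
  map_add' X Y := LinearMap.ext fun f => Subtype.ext <| funext fun g =>
    map_add (mfderiv 𝓘(ℝ, E) 𝓘(ℝ, ℂ) (fun x => f.1 (α.act x g)) 1) X Y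
  map_smul' a X := LinearMap.ext fun f => Subtype.ext <| funext fun g => by
    have e : dirDeriv (fun x => f.1 (α.act x g)) (1 : G) (a • X) =
      a • dirDeriv (fun x => f.1 (α.act x g)) (1 : G) X :=
      map_smul (mfderiv 𝓘(ℝ, E) 𝓘(ℝ, ℂ) (fun x => f.1 (α.act x g)) 1) a X
    exact e

theorem deriv_apply (X : GroupLieAlgebra 𝓘(ℝ, E) G) (f : smoothFun E G N) (g : Fin N → G) :
    (α.deriv X f).1 g = dirDeriv (fun x => f.1 (α.act x g)) (1 : G) X := rfl

theorem deriv_lie (X Y : GroupLieAlgebra 𝓘(ℝ, E) G) :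
    α.deriv ⁅X, Y⁆ = α.deriv X * α.deriv Y - α.deriv Y * α.deriv X := by
  refine LinearMap.ext fun f => Subtype.ext <| funext fun g => ?_
  rw [deriv_apply, dirDeriv_bracket (α.contMDiff_orbit f g 1)]
  simp only [act_mul]
  rfl

theorem deriv_commute (h : ∀ x y g, α.act x (β.act y g) = β.act y (α.act x g))
    (X Y : GroupLieAlgebra 𝓘(ℝ, E) G) : Commute (α.deriv X) (β.deriv Y) := by
  refine LinearMap.ext fun f => Subtype.ext <| funext fun g => ?_
  have hs : ContMDiff (𝓘(ℝ, E).prod 𝓘(ℝ, E)) 𝓘(ℝ, ℂ) ∞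
      (Function.uncurry fun x y : G => f.1 (β.act y (α.act x g))) :=
    ContMDiff.comp (g := f.1) f.2
      (β.contMDiff_comp (α.contMDiff_comp contMDiff_const contMDiff_fst) contMDiff_snd)
  have := dirDeriv_swap (hs (1, 1)) X Y
  simp only [Module.End.mul_apply, deriv_apply]
  rw [this]
  simp only [h]

/-- Vector fields are derivations. -/
theorem deriv_mul (X : GroupLieAlgebra 𝓘(ℝ, E) G) (f f' : smoothFun E G N) :
    α.deriv X (f * f') = α.deriv X f * f' + f * α.deriv X f' := by
  refine Subtype.ext <| funext fun g => ?_
  have hs : ContMDiff (𝓘(ℝ, E).prod 𝓘(ℝ, E)) 𝓘(ℝ, ℂ) ∞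
      (Function.uncurry fun x y : G => f.1 (α.act x g) * f'.1 (α.act y g)) :=
    contMDiff_mul_fun ((α.contMDiff_orbit f g).comp contMDiff_fst)
      ((α.contMDiff_orbit f' g).comp contMDiff_snd)
  refine (dirDeriv_diag (hs (1, 1)) X).trans ?_
  simp only [act_one]
  refine congrArg₂ (· + ·) ?_ ?_
  · have := dirDeriv_const_mul ((α.contMDiff_orbit f g).mdifferentiable (by simp) 1) (f'.1 g) X
    simp only [mul_comm (f'.1 g)] at this
    exact this
  · exact dirDeriv_const_mul ((α.contMDiff_orbit f' g).mdifferentiable (by simp) 1) (f.1 g) X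

theorem isDiffOpLT_deriv (X : GroupLieAlgebra 𝓘(ℝ, E) G) : IsDiffOpLT 2 (α.deriv X) := by
  intro f
  have : α.deriv X * LinearMap.mulLeft ℂ f - LinearMap.mulLeft ℂ f * α.deriv X =
      LinearMap.mulLeft ℂ (α.deriv X f) := by
    refine LinearMap.ext fun f' => ?_
    simp [deriv_mul]
  rw [this]
  intro f'
  refine LinearMap.ext fun f'' => ?_
  simp [mul_left_comm]

/-- The action of `U𝔤` on smooth functions by differential operators. -/
def ug : Ug E G →ₐ[ℂ] Module.End ℂ (smoothFun E G N) :=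
  ugLift (A := Module.End ℂ (smoothFun E G N)) α.deriv α.deriv_lie

theorem ug_ugIncl (X : GroupLieAlgebra 𝓘(ℝ, E) G) : α.ug (ugIncl X) = α.deriv X :=
  ugLift_ugIncl _ _ X

theorem ug_commute_ug (h : ∀ x y g, α.act x (β.act y g) = β.act y (α.act x g)) (u v : Ug E G) :
    Commute (α.ug u) (β.ug v) :=
  ug_commute (A := Module.End ℂ (smoothFun E G N)) (φ := α.ug) (ψ := β.ug)
    (fun X Y => by rw [ug_ugIncl, ug_ugIncl]; exact deriv_commute α β h X Y) u v

end RightAction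

variable (E) in
/-- The action `g ↦ (g_1, …, x⁻¹ g_j, …, g_N)`. -/
def leftAction (j : Fin N) : RightAction E G N where
  act x g := Pi.mulSingle j x⁻¹ * g
  act_one g := by simp
  act_mul x y g := by rw [mul_inv_rev, Pi.mulSingle_mul, mul_assoc]
  smooth := contMDiff_toPi fun i => by
    by_cases h : i = j
    · subst h
      simp only [Pi.mul_apply, Pi.mulSingle_eq_same]
      exact contMDiff_snd.inv.mul ((contMDiff_piApply i).comp contMDiff_fst)
    · simp only [Pi.mul_apply, Pi.mulSingle_eq_of_ne h, one_mul]
      exact (contMDiff_piApply i).comp contMDiff_fst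

variable (E) in
/-- The action `g ↦ (g_1, …, g_j x, …, g_N)`. -/
def rightAction (j : Fin N) : RightAction E G N where
  act x g := g * Pi.mulSingle j x
  act_one g := by simp
  act_mul x y g := by rw [Pi.mulSingle_mul, mul_assoc]
  smooth := contMDiff_toPi fun i => by
    by_cases h : i = j
    · subst h
      simp only [Pi.mul_apply, Pi.mulSingle_eq_same]
      exact ((contMDiff_piApply i).comp contMDiff_fst).mul contMDiff_snd
    · simp only [Pi.mul_apply, Pi.mulSingle_eq_of_ne h, mul_one]
      exact (contMDiff_piApply i).comp contMDiff_fst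

theorem leftAction_act (j : Fin N) (x : G) (g : Fin N → G) :
    (leftAction E j).act x g = Pi.mulSingle j x⁻¹ * g := rfl

theorem rightAction_act (j : Fin N) (x : G) (g : Fin N → G) :
    (rightAction E j).act x g = g * Pi.mulSingle j x := rfl

variable (E) in
/-- The translation operator `f ↦ (g ↦ f(a g b))`. -/
def transl (a b : Fin N → G) : Module.End ℂ (smoothFun E G N) where
  toFun f := ⟨fun g => f.1 (a * g * b), ContMDiff.comp (g := f.1) f.2 <| contMDiff_toPi fun i => by
    simp only [Pi.mul_apply]
    exact (contMDiff_const.mul (contMDiff_piApply i)).mul contMDiff_const⟩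
  map_add' _ _ := rfl
  map_smul' _ _ := rfl

theorem transl_apply (a b : Fin N → G) (f : smoothFun E G N) (g : Fin N → G) :
    (transl E a b f).1 g = f.1 (a * g * b) := rfl

theorem mulSingle_conj (j : Fin N) (a : Fin N → G) (x : G) :
    Pi.mulSingle j (a j * x * (a j)⁻¹) = a * Pi.mulSingle j x * a⁻¹ := by
  funext i
  by_cases h : i = j
  · subst h; simp
  · simp [Pi.mulSingle_eq_of_ne h]

/-- Translations carry the left action of `U𝔤` to its twist by the adjoint action. -/
theorem transl_leftAction (a b : Fin N → G) (j : Fin N) (u : Ug E G) :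
    transl E a b * (leftAction E j).ug u =
      (leftAction E j).ug (adUg (a j)⁻¹ u) * transl E a b := by
  refine ug_intertwine (A := Module.End ℂ (smoothFun E G N))
    (φ := (leftAction E j).ug) (ψ := ((leftAction E j).ug).comp (adUg (a j)⁻¹)) (fun X => ?_) u
  rw [AlgHom.comp_apply, adUg_ugIncl, RightAction.ug_ugIncl, RightAction.ug_ugIncl]
  refine LinearMap.ext fun f => Subtype.ext <| funext fun g => ?_
  simp only [Module.End.mul_apply, RightAction.deriv_apply, transl_apply]
  have had := dirDeriv_adLin (((leftAction E j).contMDiff_orbit (transl E a b f)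
    g).mdifferentiable (by simp) 1) (a j)⁻¹ X
  simp only [transl_apply] at had
  rw [had]
  congr 1
  funext x
  simp only [leftAction_act]
  have := mulSingle_conj j a⁻¹ x⁻¹
  simp only [Pi.inv_apply, inv_inv] at this
  simp only [mul_inv_rev, inv_inv, ← mul_assoc] at this ⊢
  rw [this]
  simp [mul_assoc]

theorem transl_rightAction (a b : Fin N → G) (j : Fin N) (u : Ug E G) :
    transl E a b * (rightAction E j).ug u =
      (rightAction E j).ug (adUg (b j) u) * transl E a b := by
  refine ug_intertwine (A := Module.End ℂ (smoothFun E G N))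
    (φ := (rightAction E j).ug) (ψ := ((rightAction E j).ug).comp (adUg (b j))) (fun X => ?_) u
  rw [AlgHom.comp_apply, adUg_ugIncl, RightAction.ug_ugIncl, RightAction.ug_ugIncl]
  refine LinearMap.ext fun f => Subtype.ext <| funext fun g => ?_
  simp only [Module.End.mul_apply, RightAction.deriv_apply, transl_apply]
  have had := dirDeriv_adLin (((rightAction E j).contMDiff_orbit (transl E a b f)
    g).mdifferentiable (by simp) 1) (b j) X
  simp only [transl_apply] at had
  rw [had]
  congr 1
  funext x
  simp only [rightAction_act, mulSingle_conj]
  simp [mul_assoc]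

theorem leftAction_rightAction_commute (i j : Fin N) (u v : Ug E G) :
    Commute ((leftAction E i : RightAction E G N).ug u) ((rightAction E j).ug v) :=
  RightAction.ug_commute_ug _ _ (fun x y g => by
    simp only [leftAction_act, rightAction_act, mul_assoc]) u v

theorem leftAction_commute {i j : Fin N} (hij : i ≠ j) (u v : Ug E G) :
    Commute ((leftAction E i : RightAction E G N).ug u) ((leftAction E j).ug v) :=
  RightAction.ug_commute_ug _ _ (fun x y g => by
    simp only [leftAction_act, ← mul_assoc]
    rw [(Pi.mulSingle_commute (f := fun _ : Fin N => G) hij x⁻¹ y⁻¹).eq]) u v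

theorem rightAction_commute {i j : Fin N} (hij : i ≠ j) (u v : Ug E G) :
    Commute ((rightAction E i : RightAction E G N).ug u) ((rightAction E j).ug v) :=
  RightAction.ug_commute_ug _ _ (fun x y g => by
    simp only [rightAction_act, mul_assoc]
    rw [(Pi.mulSingle_commute (f := fun _ : Fin N => G) hij x y).eq]) u v

/-- At the identity, left and right invariant operators are related by the antipode. -/
theorem rightAction_apply_one (j : Fin N) (u : Ug E G) (f : smoothFun E G N) :
    ((rightAction E j).ug u f).1 1 = ((leftAction E j).ug (antipode u) f).1 1 := by
  let S : Subalgebra ℂ (Ug E G) :=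
    { carrier := {u | ∀ f : smoothFun E G N,
        ((rightAction E j).ug u f).1 1 = ((leftAction E j).ug (antipode u) f).1 1}
      mul_mem' := by
        intro u v hu hv f
        rw [map_mul, Module.End.mul_apply, hu, ← Module.End.mul_apply,
          (leftAction_rightAction_commute j j _ v).eq, Module.End.mul_apply, hv, antipode_mul,
          map_mul, Module.End.mul_apply]
      add_mem' := by
        intro u v hu hv f
        have h : antipode (u + v) = antipode u + antipode v := map_add antipodeLin u v
        rw [map_add, h, map_add]
        exact congrArg₂ (· + ·) (hu f) (hv f)
      algebraMap_mem' := fun a f => by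
        have h : antipode (algebraMap ℂ (Ug E G) a) = algebraMap ℂ (Ug E G) a := by simp [antipode]
        rw [h, AlgHom.commutes, AlgHom.commutes] }
  have hS : S = ⊤ := ug_subalgebra_eq_top fun X f => by
    rw [antipode_ugIncl, map_neg, RightAction.ug_ugIncl, RightAction.ug_ugIncl]
    have h1 : ((-(leftAction E j).deriv X) f).1 1 = -((leftAction E j).deriv X f).1 1 := rfl
    rw [h1, RightAction.deriv_apply, RightAction.deriv_apply]
    have := dirDeriv_inv ((rightAction E j).contMDiff_orbit f 1 1) X
    simp only [leftAction_act, rightAction_act, mul_one, one_mul] at this ⊢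
    rw [this, neg_neg]
  have hu : u ∈ S := hS ▸ Algebra.mem_top
  exact hu f

/-- On functions on a connected group, `z ⊗ 1` and `1 ⊗ S(z)` act in the same way for central
`z`. -/
theorem leftAction_eq_rightAction_antipode [FiniteDimensional ℝ E] [ConnectedSpace G] (j : Fin N)
    {z : Ug E G} (hz : z ∈ Subalgebra.center ℂ (Ug E G)) :
    (leftAction E j : RightAction E G N).ug z = (rightAction E j).ug (antipode z) := by
  refine LinearMap.ext fun f => Subtype.ext <| funext fun g => ?_
  -- by translation invariance the two operators need only be compared at the identity
  have hL := LinearMap.congr_fun (transl_leftAction g 1 j z) f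
  have hR := LinearMap.congr_fun (transl_rightAction g 1 j (antipode z)) f
  rw [adUg_eq_self_of_mem_center hz] at hL
  have h1 : adUg ((1 : Fin N → G) j) (antipode z) = antipode z :=
    adUg_eq_self_of_mem_center (antipode_mem_center hz) _
  rw [h1] at hR
  simp only [Module.End.mul_apply] at hL hR
  have hL' := congrFun (congrArg Subtype.val hL) 1
  have hR' := congrFun (congrArg Subtype.val hR) 1
  rw [rightAction_apply_one, antipode_antipode, ← hL'] at hR'
  simpa [transl_apply] using hR'.symm

end SmoothFunctions

/-! ### Commuting homomorphisms from the factors of a tensor product -/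

section PiLift

variable {N : ℕ} {B : Fin N → Type*} [∀ i, Ring (B i)] [∀ i, Algebra ℂ (B i)]
    {A : Type*} [Ring A] [Algebra ℂ A]

/-- Homomorphisms from the factors with commuting images induce a homomorphism from the tensor
product of algebras. -/
def piTensorLift (s : ∀ i, B i →ₐ[ℂ] A) (hs : ∀ i j, i ≠ j → ∀ a b, Commute (s i a) (s j b)) :
    (⨂[ℂ] i, B i) →ₐ[ℂ] A :=
  PiTensorProduct.liftAlgHom
    ((MultilinearMap.mkPiAlgebraFin ℂ N A).compLinearMap fun j => (s j).toLinearMap)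
    (by
      simp only [MultilinearMap.compLinearMap_apply, MultilinearMap.mkPiAlgebraFin_apply,
        Pi.one_apply, AlgHom.toLinearMap_apply, map_one]
      simp)
    (fun x y => by
      simp only [MultilinearMap.compLinearMap_apply, MultilinearMap.mkPiAlgebraFin_apply,
        Pi.mul_apply, AlgHom.toLinearMap_apply, map_mul]
      exact list_prod_ofFn_mul _ _ fun i j hij => hs i j hij _ _)

theorem piTensorLift_singleAlgHom (s : ∀ i, B i →ₐ[ℂ] A)
    (hs : ∀ i j, i ≠ j → ∀ a b, Commute (s i a) (s j b)) (j : Fin N) (b : B j) :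
    piTensorLift s hs (PiTensorProduct.singleAlgHom (R := ℂ) (A := B) j b) = s j b := by
  have e : piTensorLift s hs (PiTensorProduct.singleAlgHom (R := ℂ) (A := B) j b) =
      (List.ofFn fun i => s i ((Pi.mulSingle j b : ∀ i, B i) i)).prod :=
    PiTensorProduct.lift.tprod _
  rw [e, list_prod_ofFn_eq j fun i hi => by rw [Pi.mulSingle_eq_of_ne hi, map_one],
    Pi.mulSingle_eq_same]

end PiLift

/-! ### The quantum moment map and gauge transformations -/

section

variable {E : Type*} [NormedAddCommGroup E] [NormedSpace ℝ E] [CompleteSpace E]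
    {G : Type*} [TopologicalSpace G] [ChartedSpace E G] [Group G] [LieGroup 𝓘(ℝ, E) ∞ G] {N : ℕ}

/-- The embedding `v ↦ v ⊗ 1` of `U𝔤` in the `j`-th factor of `(U𝔤 ⊗ U𝔤)^{⊗N}`. -/
def inL (j : Fin N) : Ug E G →ₐ[ℂ] ⨂[ℂ] _ : Fin N, UgUg E G :=
  (PiTensorProduct.singleAlgHom (R := ℂ) (A := fun _ : Fin N => UgUg E G) j).comp
    Algebra.TensorProduct.includeLeft

/-- The embedding `v ↦ 1 ⊗ v` of `U𝔤` in the `j`-th factor of `(U𝔤 ⊗ U𝔤)^{⊗N}`. -/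
def inR (j : Fin N) : Ug E G →ₐ[ℂ] ⨂[ℂ] _ : Fin N, UgUg E G :=
  (PiTensorProduct.singleAlgHom (R := ℂ) (A := fun _ : Fin N => UgUg E G) j).comp
    Algebra.TensorProduct.includeRight

theorem inL_apply (j : Fin N) (v : Ug E G) : inL j v =
    PiTensorProduct.singleAlgHom (R := ℂ) (A := fun _ : Fin N => UgUg E G) j (v ⊗ₜ 1) := rfl

theorem inR_apply (j : Fin N) (v : Ug E G) : inR j v =
    PiTensorProduct.singleAlgHom (R := ℂ) (A := fun _ : Fin N => UgUg E G) j (1 ⊗ₜ v) := rfl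

/-- The algebra `(U𝔤 ⊗ U𝔤)^{⊗N}` is generated by the `2N` copies of `U𝔤`. -/
theorem tensorUg_subalgebra_eq_top {S : Subalgebra ℂ (⨂[ℂ] _ : Fin N, UgUg E G)}
    (hL : ∀ j v, inL j v ∈ S) (hR : ∀ j v, inR j v ∈ S) : S = ⊤ := by
  refine piTensor_subalgebra_eq_top fun j a => ?_
  induction a using TensorProduct.induction_on with
  | zero => rw [map_zero]; exact S.zero_mem
  | add x y hx hy => rw [map_add]; exact S.add_mem hx hy
  | tmul x y =>
    have e : x ⊗ₜ[ℂ] y = (x ⊗ₜ[ℂ] (1 : Ug E G)) * ((1 : Ug E G) ⊗ₜ[ℂ] y) := by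
      rw [Algebra.TensorProduct.tmul_mul_tmul, one_mul, mul_one]
    rw [e, map_mul]
    exact S.mul_mem (hL j x) (hR j y)

/-- A linear map intertwining the generators of `(U𝔤 ⊗ U𝔤)^{⊗N}` intertwines all elements. -/
theorem tensorUg_intertwine {M M' : Type*} [AddCommGroup M] [Module ℂ M] [AddCommGroup M']
    [Module ℂ M'] {φ : (⨂[ℂ] _ : Fin N, UgUg E G) →ₐ[ℂ] Module.End ℂ M}
    {ψ : (⨂[ℂ] _ : Fin N, UgUg E G) →ₐ[ℂ] Module.End ℂ M'} {t : M →ₗ[ℂ] M'}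
    (hL : ∀ j v m, t (φ (inL j v) m) = ψ (inL j v) (t m))
    (hR : ∀ j v m, t (φ (inR j v) m) = ψ (inR j v) (t m))
    (u : ⨂[ℂ] _ : Fin N, UgUg E G) (m : M) : t (φ u m) = ψ u (t m) := by
  let S : Subalgebra ℂ (⨂[ℂ] _ : Fin N, UgUg E G) :=
    { carrier := {u | ∀ m, t (φ u m) = ψ u (t m)}
      mul_mem' := by
        intro u v hu hv m
        rw [map_mul, map_mul, Module.End.mul_apply, Module.End.mul_apply, hu, hv]
      add_mem' := by
        intro u v hu hv m
        rw [map_add, map_add, LinearMap.add_apply, LinearMap.add_apply, map_add, hu, hv]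
      algebraMap_mem' := fun a m => by
        rw [AlgHom.commutes, AlgHom.commutes, Module.algebraMap_end_apply,
          Module.algebraMap_end_apply, map_smul] }
  have hS : S = ⊤ := tensorUg_subalgebra_eq_top hL hR
  have hu : u ∈ S := hS ▸ Algebra.mem_top
  exact hu m

/-- A linear map intertwining the action of `𝔤` intertwines the action of `U𝔤`. -/
theorem ug_intertwine_linear {M M' : Type*} [AddCommGroup M] [Module ℂ M] [AddCommGroup M']
    [Module ℂ M'] {φ : Ug E G →ₐ[ℂ] Module.End ℂ M}
    {ψ : Ug E G →ₐ[ℂ] Module.End ℂ M'} {t : M →ₗ[ℂ] M'}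
    (h : ∀ X m, t (φ (ugIncl X) m) = ψ (ugIncl X) (t m))
    (u : Ug E G) (m : M) : t (φ u m) = ψ u (t m) := by
  let S : Subalgebra ℂ (Ug E G) :=
    { carrier := {u | ∀ m, t (φ u m) = ψ u (t m)}
      mul_mem' := by
        intro u v hu hv m
        rw [map_mul, map_mul, Module.End.mul_apply, Module.End.mul_apply, hu, hv]
      add_mem' := by
        intro u v hu hv m
        rw [map_add, map_add, LinearMap.add_apply, LinearMap.add_apply, map_add, hu, hv]
      algebraMap_mem' := fun a m => by
        rw [AlgHom.commutes, AlgHom.commutes, Module.algebraMap_end_apply,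
          Module.algebraMap_end_apply, map_smul] }
  have hS : S = ⊤ := ug_subalgebra_eq_top h
  have hu : u ∈ S := hS ▸ Algebra.mem_top
  exact hu m

theorem momentMap_singleAlgHom (j : Fin N) (w : UgUg E G) :
    momentMap E G N (PiTensorProduct.singleAlgHom (R := ℂ) (A := fun _ : Fin N => UgUg E G) j w) =
      slotAction E j w := by
  have e : momentMap E G N (PiTensorProduct.singleAlgHom (R := ℂ) (A := fun _ : Fin N => UgUg E G)
      j w) = (List.ofFn fun i => slotAction (G := G) (N := N) E i
        ((Pi.mulSingle j w : Fin N → UgUg E G) i)).prod :=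
    PiTensorProduct.lift.tprod _
  rw [e, list_prod_ofFn_eq j fun i hi => by rw [Pi.mulSingle_eq_of_ne hi, map_one],
    Pi.mulSingle_eq_same]

theorem momentMap_inL (j : Fin N) (v : Ug E G) : momentMap E G N (inL j v) = momentL E j v := by
  rw [inL_apply, momentMap_singleAlgHom, slotAction, Algebra.TensorProduct.lift_tmul, map_one,
    mul_one]

theorem momentMap_inR (j : Fin N) (v : Ug E G) : momentMap E G N (inR j v) = momentR E j v := by
  rw [inR_apply, momentMap_singleAlgHom, slotAction, Algebra.TensorProduct.lift_tmul, map_one,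
    one_mul]

theorem gaugeAd_inL [NeZero N] (h : Fin N → G) (j : Fin N) (v : Ug E G) :
    gaugeAd E h (inL j v) = inL j (adUg (h j) v) := by
  rw [inL_apply, gaugeAd, piTensorMap_singleAlgHom, Algebra.TensorProduct.map_tmul, map_one]
  rfl

theorem gaugeAd_inR [NeZero N] (h : Fin N → G) (j : Fin N) (v : Ug E G) :
    gaugeAd E h (inR j v) = inR j (adUg (h (j + 1)) v) := by
  rw [inR_apply, gaugeAd, piTensorMap_singleAlgHom, Algebra.TensorProduct.map_tmul, map_one]
  rfl

section Smooth

/-- The action of `U𝔤 ⊗ U𝔤` on smooth functions on `G^N` through the `j`-th argument. -/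
def slotSmooth (j : Fin N) : UgUg E G →ₐ[ℂ] Module.End ℂ (smoothFun E G N) :=
  Algebra.TensorProduct.lift (leftAction E j).ug (rightAction E j).ug
    (leftAction_rightAction_commute j j)

theorem slotSmooth_tmul (j : Fin N) (a b : Ug E G) :
    slotSmooth (N := N) j (a ⊗ₜ b) = (leftAction E j).ug a * (rightAction E j).ug b :=
  Algebra.TensorProduct.lift_tmul _ _ _ _ _

theorem slotSmooth_commute {i j : Fin N} (hij : i ≠ j) (a b : UgUg E G) :
    Commute (slotSmooth (N := N) i a) (slotSmooth j b) := by
  induction a using TensorProduct.induction_on with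
  | zero => rw [map_zero]; exact Commute.zero_left _
  | add a a' ha ha' => rw [map_add]; exact ha.add_left ha'
  | tmul a a' =>
    induction b using TensorProduct.induction_on with
    | zero => rw [map_zero]; exact Commute.zero_right _
    | add b b' hb hb' => rw [map_add]; exact hb.add_right hb'
    | tmul b b' =>
      rw [slotSmooth_tmul, slotSmooth_tmul]
      exact ((leftAction_commute hij a b).mul_right
        (leftAction_rightAction_commute i j a b')).mul_left
        ((leftAction_rightAction_commute j i b a').symm.mul_right (rightAction_commute hij a' b'))

variable [FiniteDimensional ℝ E] [ConnectedSpace G]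

/-- The action of `U𝔤 ⊗_{Z(𝔤)} U𝔤` on smooth functions on `G^N` through the `j`-th argument. -/
def slotBalanced (j : Fin N) : UgZUg E G →ₐ[ℂ] Module.End ℂ (smoothFun E G N) :=
  RingQuot.liftAlgHom ℂ ⟨slotSmooth j, by
    rintro _ _ ⟨z, hz⟩
    rw [slotSmooth_tmul, slotSmooth_tmul, map_one, map_one, mul_one, one_mul,
      leftAction_eq_rightAction_antipode j hz]⟩

theorem slotBalanced_mk (j : Fin N) (a : UgUg E G) :
    slotBalanced (N := N) j (RingQuot.mkAlgHom ℂ (CentralRel E G) a) = slotSmooth j a :=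
  RingQuot.liftAlgHom_mkAlgHom_apply _ _ _ _

theorem slotBalanced_commute {i j : Fin N} (hij : i ≠ j) (a b : UgZUg E G) :
    Commute (slotBalanced (N := N) i a) (slotBalanced j b) := by
  obtain ⟨a, rfl⟩ := RingQuot.mkAlgHom_surjective ℂ (CentralRel E G) a
  obtain ⟨b, rfl⟩ := RingQuot.mkAlgHom_surjective ℂ (CentralRel E G) b
  rw [slotBalanced_mk, slotBalanced_mk]
  exact slotSmooth_commute hij a b

variable (E G N) in
/-- The action of `(U𝔤 ⊗ U𝔤)^{⊗N}` on smooth functions on `G^N`. It is defined through the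
quotient `(U𝔤 ⊗_{Z(𝔤)} U𝔤)^{⊗N}`. -/
def smoothAction : (⨂[ℂ] _ : Fin N, UgUg E G) →ₐ[ℂ] Module.End ℂ (smoothFun E G N) :=
  (piTensorLift (A := Module.End ℂ (smoothFun E G N)) (fun j => slotBalanced j)
    fun _ _ hij => slotBalanced_commute hij).comp (toBalanced E G N)

theorem smoothAction_singleAlgHom (j : Fin N) (w : UgUg E G) :
    smoothAction E G N
      (PiTensorProduct.singleAlgHom (R := ℂ) (A := fun _ : Fin N => UgUg E G) j w) =
      slotSmooth j w := by
  rw [smoothAction, AlgHom.comp_apply, toBalanced, piTensorMap_singleAlgHom,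
    piTensorLift_singleAlgHom (A := Module.End ℂ (smoothFun E G N)), slotBalanced_mk]

theorem smoothAction_inL (j : Fin N) (v : Ug E G) :
    smoothAction E G N (inL j v) = (leftAction E j).ug v := by
  rw [inL_apply, smoothAction_singleAlgHom, slotSmooth_tmul, map_one, mul_one]

theorem smoothAction_inR (j : Fin N) (v : Ug E G) :
    smoothAction E G N (inR j v) = (rightAction E j).ug v := by
  rw [inR_apply, smoothAction_singleAlgHom, slotSmooth_tmul, map_one, one_mul]

variable (E G N) in
/-- The inclusion of `𝓡(G^N)` in the smooth functions as a linear map. -/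
def toSmoothLin : RG E G N →ₗ[ℂ] smoothFun E G N where
  toFun := toSmooth E G N
  map_add' _ _ := rfl
  map_smul' _ _ := rfl

theorem toSmoothLin_injective : Function.Injective (toSmoothLin E G N) := fun _ _ h =>
  Subtype.ext (congrArg (fun f : smoothFun E G N => f.1) h)

theorem toSmoothLin_momentL (j : Fin N) (v : Ug E G) (f : RG E G N) :
    toSmoothLin E G N (momentL E j v f) = (leftAction E j).ug v (toSmoothLin E G N f) :=
  ug_intertwine_linear (φ := momentL E j) (ψ := (leftAction E j).ug) (fun X f => by
    rw [RightAction.ug_ugIncl]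
    exact Subtype.ext (funext fun g => momentL_ugIncl E j X f g)) v f

theorem toSmoothLin_momentR (j : Fin N) (v : Ug E G) (f : RG E G N) :
    toSmoothLin E G N (momentR E j v f) = (rightAction E j).ug v (toSmoothLin E G N f) :=
  ug_intertwine_linear (φ := momentR E j) (ψ := (rightAction E j).ug) (fun X f => by
    rw [RightAction.ug_ugIncl]
    exact Subtype.ext (funext fun g => momentR_ugIncl E j X f g)) v f

theorem toSmoothLin_momentMap (u : ⨂[ℂ] _ : Fin N, UgUg E G) (f : RG E G N) :
    toSmoothLin E G N (momentMap E G N u f) = smoothAction E G N u (toSmoothLin E G N f) :=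
  tensorUg_intertwine (φ := momentMap E G N) (ψ := smoothAction E G N)
    (fun j v f => by rw [momentMap_inL, smoothAction_inL, toSmoothLin_momentL])
    (fun j v f => by rw [momentMap_inR, smoothAction_inR, toSmoothLin_momentR]) u f

/-- The left and right quantum moment maps on `𝓡(G^N)` agree on the center up to the antipode. -/
theorem momentL_antipode (j : Fin N) {z : Ug E G} (hz : z ∈ Subalgebra.center ℂ (Ug E G)) :
    momentL (G := G) (N := N) E j (antipode z) = momentR E j z := by
  refine LinearMap.ext fun f => toSmoothLin_injective ?_
  rw [toSmoothLin_momentL, toSmoothLin_momentR,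
    leftAction_eq_rightAction_antipode j (antipode_mem_center hz), antipode_antipode]

theorem RightAction.ug_mem_diffOps (α : RightAction E G N) (u : Ug E G) :
    α.ug u ∈ diffOps (smoothFun E G N) := by
  have hS : (diffOps (smoothFun E G N)).comap α.ug = ⊤ := ug_subalgebra_eq_top fun X =>
    ⟨2, (α.ug_ugIncl X).symm ▸ α.isDiffOpLT_deriv X⟩
  have hu : u ∈ (diffOps (smoothFun E G N)).comap α.ug := hS ▸ Algebra.mem_top
  exact hu

theorem smoothAction_mem_diffOps (u : ⨂[ℂ] _ : Fin N, UgUg E G) :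
    smoothAction E G N u ∈ diffOps (smoothFun E G N) := by
  have hS : (diffOps (smoothFun E G N)).comap (smoothAction E G N) = ⊤ :=
    tensorUg_subalgebra_eq_top
      (fun j v => by
        rw [Subalgebra.mem_comap, smoothAction_inL]; exact (leftAction E j).ug_mem_diffOps v)
      (fun j v => by
        rw [Subalgebra.mem_comap, smoothAction_inR]; exact (rightAction E j).ug_mem_diffOps v)
  have hu : u ∈ (diffOps (smoothFun E G N)).comap (smoothAction E G N) := hS ▸ Algebra.mem_top
  exact hu

variable [NeZero N]

theorem transl_smoothAction (h : Fin N → G) (u : ⨂[ℂ] _ : Fin N, UgUg E G)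
    (f : smoothFun E G N) :
    transl E h⁻¹ (shift G N h) (smoothAction E G N u f) =
      smoothAction E G N (gaugeAd E h u) (transl E h⁻¹ (shift G N h) f) := by
  refine tensorUg_intertwine (φ := smoothAction E G N)
    (ψ := (smoothAction E G N).comp (gaugeAd E h)) (fun j v f => ?_) (fun j v f => ?_) u f
  · rw [AlgHom.comp_apply, gaugeAd_inL, smoothAction_inL, smoothAction_inL]
    have := LinearMap.congr_fun (transl_leftAction h⁻¹ (shift G N h) j v) f
    simpa using this
  · rw [AlgHom.comp_apply, gaugeAd_inR, smoothAction_inR, smoothAction_inR]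
    exact LinearMap.congr_fun (transl_rightAction h⁻¹ (shift G N h) j v) f

theorem toSmoothLin_gaugeRep (h : Fin N → G) (f : RG E G N) :
    toSmoothLin E G N (gaugeRep E h f) = transl E h⁻¹ (shift G N h) (toSmoothLin E G N f) := rfl

/-- The moment map is gauge equivariant. -/
theorem gaugeRep_momentMap (h : Fin N → G) (u : ⨂[ℂ] _ : Fin N, UgUg E G) (f : RG E G N) :
    gaugeRep E h (momentMap E G N u f) = momentMap E G N (gaugeAd E h u) (gaugeRep E h f) := by
  apply toSmoothLin_injective
  rw [toSmoothLin_gaugeRep, toSmoothLin_momentMap, toSmoothLin_momentMap, toSmoothLin_gaugeRep,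
    transl_smoothAction]

/-- A gauge invariant class in `(U𝔤 ⊗_{Z(𝔤)} U𝔤)^{⊗N}` acts like each of its gauge transforms. This
uses that the action on smooth functions factors through the quotient. -/
theorem smoothAction_gaugeAd {u : ⨂[ℂ] _ : Fin N, UgUg E G} (hu : u ∈ gaugeInvariants E G N)
    (h : Fin N → G) : smoothAction E G N (gaugeAd E h u) = smoothAction E G N u := by
  have := (Algebra.mem_iInf.1 hu) h
  rw [AlgHom.mem_equalizer, AlgHom.comp_apply] at this
  rw [smoothAction, AlgHom.comp_apply, AlgHom.comp_apply, this]

/-- Quantum integrals are gauge invariant differential operators. -/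
theorem momentMap_mem_invDiffOpsOn {u : ⨂[ℂ] _ : Fin N, UgUg E G}
    (hu : u ∈ gaugeInvariants E G N) : momentMap E G N u ∈ invDiffOpsOn E G N := by
  refine ⟨smoothAction E G N u, ⟨smoothAction_mem_diffOps u, fun f hf => ?_, ?_⟩, fun f => ?_⟩
  · have := toSmoothLin_momentMap u ⟨f.1, hf⟩
    have e : toSmoothLin E G N ⟨f.1, hf⟩ = f := rfl
    rw [e] at this
    rw [← this]
    exact (momentMap E G N u ⟨f.1, hf⟩).2
  · intro h f f' hf g
    have ht : ∀ (f : smoothFun E G N) g, (transl E h⁻¹⁻¹ (shift G N h⁻¹) f).1 g =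
        f.1 (gaugeAct h g) := by
      intro f g
      have e : h⁻¹⁻¹ * g * shift G N h⁻¹ = gaugeAct h g := by
        funext j
        simp [gaugeAct, shift]
      rw [transl_apply, e]
    have e : f' = transl E h⁻¹⁻¹ (shift G N h⁻¹) f := Subtype.ext (funext fun g => by
      rw [ht, hf])
    rw [← ht, transl_smoothAction, smoothAction_gaugeAd hu, e]
  · exact congrArg Subtype.val (toSmoothLin_momentMap u f)

/-- The algebra `Z(𝔤)^{⊗N}` is generated by its factors. -/
theorem centerLeft_le {S : Subalgebra ℂ (⨂[ℂ] _ : Fin N, UgUg E G)}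
    (h : ∀ j, ∀ z ∈ Subalgebra.center ℂ (Ug E G), inL j z ∈ S) : centerLeft E G N ≤ S := by
  rw [centerLeft, ← Algebra.map_top, Subalgebra.map_le]
  refine (piTensor_subalgebra_eq_top fun j z => ?_).ge
  rw [Subalgebra.mem_comap, piTensorMap_singleAlgHom]
  exact h j z.1 z.2

theorem inL_mem_centerLeft (j : Fin N) {z : Ug E G} (hz : z ∈ Subalgebra.center ℂ (Ug E G)) :
    inL j z ∈ centerLeft E G N :=
  ⟨PiTensorProduct.singleAlgHom (R := ℂ) (A := fun _ : Fin N => Subalgebra.center ℂ (Ug E G)) j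
    ⟨z, hz⟩, by
    exact piTensorMap_singleAlgHom (B := fun _ : Fin N => UgUg E G) _ j _⟩

theorem centerLeft_le_gaugeInvariants : centerLeft E G N ≤ gaugeInvariants E G N := by
  refine centerLeft_le fun j z hz => Algebra.mem_iInf.2 fun h => ?_
  rw [AlgHom.mem_equalizer, AlgHom.comp_apply, gaugeAd_inL, adUg_eq_self_of_mem_center hz]

theorem centerLeft_le_center : centerLeft E G N ≤ Subalgebra.center ℂ _ := by
  refine centerLeft_le fun j z hz => ?_
  rw [Subalgebra.mem_center_iff] at hz ⊢
  intro u
  have hc : ∀ a b : UgUg E G, ∀ i ≠ j, Commute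
      (PiTensorProduct.singleAlgHom (R := ℂ) (A := fun _ : Fin N => UgUg E G) i a)
      (PiTensorProduct.singleAlgHom (R := ℂ) (A := fun _ : Fin N => UgUg E G) j b) := by
    intro a b i hij
    have := (Pi.mulSingle_commute (f := fun _ : Fin N => UgUg E G) hij a b).map
      (PiTensorProduct.tprodMonoidHom ℂ (A := fun _ : Fin N => UgUg E G))
    exact this
  have hs : ∀ a : UgUg E G, Commute a (z ⊗ₜ[ℂ] 1) → ∀ i, Commute
      (PiTensorProduct.singleAlgHom (R := ℂ) (A := fun _ : Fin N => UgUg E G) i a)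
      (inL j z) := by
    intro a ha i
    by_cases hij : i = j
    · subst hij
      exact ha.map (PiTensorProduct.singleAlgHom (R := ℂ) (A := fun _ : Fin N => UgUg E G) i)
    · exact hc a _ i hij
  have hS : Subalgebra.centralizer ℂ {inL (E := E) (G := G) j z} = ⊤ :=
    tensorUg_subalgebra_eq_top
      (fun i v => by
        rw [Subalgebra.mem_centralizer_iff]
        rintro _ rfl
        refine (hs (v ⊗ₜ 1) ?_ i).symm
        rw [Commute, SemiconjBy, Algebra.TensorProduct.tmul_mul_tmul,
          Algebra.TensorProduct.tmul_mul_tmul, hz])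
      (fun i v => by
        rw [Subalgebra.mem_centralizer_iff]
        rintro _ rfl
        refine (hs (1 ⊗ₜ v) ?_ i).symm
        rw [Commute, SemiconjBy, Algebra.TensorProduct.tmul_mul_tmul,
          Algebra.TensorProduct.tmul_mul_tmul, one_mul, mul_one, one_mul, mul_one])
  have hu : u ∈ Subalgebra.centralizer ℂ {inL (E := E) (G := G) j z} := hS ▸ Algebra.mem_top
  exact ((Subalgebra.mem_centralizer_iff ℂ).1 hu _ rfl).symm

end Smooth

end

/-! ### Irreducible algebras of operators -/

section Burnside

variable {M : Type*} [AddCommGroup M] [Module ℂ M]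

/-- Burnside's theorem: an irreducible algebra of operators on a finite dimensional space contains
all operators. -/
theorem subalgebra_end_eq_top [FiniteDimensional ℂ M] {B : Subalgebra ℂ (Module.End ℂ M)}
    (h : ∀ W : Submodule ℂ M, IsStable B W → W = ⊥ ∨ W = ⊤) : B = ⊤ := by
  rcases subsingleton_or_nontrivial M with hM | hM
  · refine eq_top_iff.2 fun T _ => ?_
    rw [Subsingleton.elim T 0]
    exact B.zero_mem
  -- by Schur's lemma every operator is linear over the commutant, so density applies
  have hsimple : IsSimpleModule B M := by
    rw [isSimpleModule_iff]
    refine { exists_pair_ne := ⟨⊥, ⊤, bot_ne_top⟩, eq_bot_or_eq_top := fun W => ?_ }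
    have := h (W.restrictScalars ℂ) fun b hb w hw => W.smul_mem ⟨b, hb⟩ hw
    rcases this with h | h
    · exact Or.inl ((Submodule.restrictScalars_eq_bot_iff ℂ B M).1 h)
    · exact Or.inr ((Submodule.restrictScalars_eq_top_iff ℂ B M).1 h)
  refine eq_top_iff.2 fun T _ => ?_
  have hschur := (IsSimpleModule.algebraMap_end_bijective_of_isAlgClosed (A := B) (V := M) ℂ).2
  let f : Module.End (Module.End B M) M :=
    { toFun := T
      map_add' := map_add T
      map_smul' := fun a m => by
        obtain ⟨c, rfl⟩ := hschur a
        exact map_smul T c m }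
  classical
  let b := Module.finBasis ℂ M
  obtain ⟨r, hr⟩ := jacobson_density (R := B) f (Finset.univ.image b)
  have : T = r.1 := b.ext fun i => hr (b i) (Finset.mem_image_of_mem b (Finset.mem_univ i))
  rw [this]
  exact r.2

/-- The algebra of all operators has no proper ideals. -/
theorem bimodule_end_eq_top [FiniteDimensional ℂ M] {W : Submodule ℂ (Module.End ℂ M)}
    (hl : ∀ T, ∀ A ∈ W, T * A ∈ W) (hr : ∀ T, ∀ A ∈ W, A * T ∈ W) (hW : W ≠ ⊥) : W = ⊤ := by
  obtain ⟨A, hA, hA0⟩ := Submodule.exists_mem_ne_zero_of_ne_bot hW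
  obtain ⟨v, hv⟩ : ∃ v, A v ≠ 0 := by
    by_contra! h
    exact hA0 (LinearMap.ext h)
  obtain ⟨l, hl1⟩ : ∃ l : Module.Dual ℂ M, l (A v) ≠ 0 := by
    by_contra! h
    exact hv ((Module.forall_dual_apply_eq_zero_iff ℂ _).1 h)
  have hone : ∀ (k : Module.Dual ℂ M) (w : M), k.smulRight w ∈ W := by
    intro k w
    have e : k.smulRight w = (l (A v))⁻¹ • ((l.smulRight w : Module.End ℂ M) *
        (A * (k.smulRight v : Module.End ℂ M))) := by
      ext m
      simp only [LinearMap.smulRight_apply, LinearMap.smul_apply, Module.End.mul_apply, map_smul,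
        smul_smul]
      rw [mul_comm (k m), inv_mul_cancel_left₀ hl1]
    rw [e]
    exact W.smul_mem _ (hl _ _ (hr _ _ hA))
  refine eq_top_iff.2 fun T _ => ?_
  let b := Module.finBasis ℂ M
  have : T = ∑ i, (b.coord i).smulRight (T (b i)) := by
    refine b.ext fun i => ?_
    simp [Finsupp.single_apply]
  rw [this]
  exact W.sum_mem fun i _ => hone _ _

/-- If the first of two actions of an algebra is irreducible and there is an element acting by `0`
in the second only, then there is one acting by `1` in the first and by `0` in the second. -/
theorem exists_map_eq_one {A M' : Type*} [Ring A] [Algebra ℂ A] [AddCommGroup M']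
    [Module ℂ M'] [FiniteDimensional ℂ M] {c : A →ₐ[ℂ] Module.End ℂ M}
    {d : A →ₐ[ℂ] Module.End ℂ M'} (hc : Function.Surjective c) (h : ∃ u, d u = 0 ∧ c u ≠ 0) :
    ∃ u, c u = 1 ∧ d u = 0 := by
  obtain ⟨u, hu, hu'⟩ := h
  have := bimodule_end_eq_top (W := (LinearMap.ker d.toLinearMap).map c.toLinearMap)
    (by
      rintro T _ ⟨x, hx, rfl⟩
      obtain ⟨y, rfl⟩ := hc T
      have hx' : d x = 0 := hx
      refine ⟨y * x, ?_, map_mul c y x⟩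
      change d (y * x) = 0
      rw [map_mul, hx', mul_zero])
    (by
      rintro T _ ⟨x, hx, rfl⟩
      obtain ⟨y, rfl⟩ := hc T
      have hx' : d x = 0 := hx
      refine ⟨x * y, ?_, map_mul c x y⟩
      change d (x * y) = 0
      rw [map_mul, hx', zero_mul])
    (fun h0 => hu' <| (Submodule.mem_bot ℂ).1 (h0 ▸ Submodule.mem_map_of_mem (f := c.toLinearMap)
      (show u ∈ LinearMap.ker d.toLinearMap from hu)))
  obtain ⟨x, hx, hx'⟩ : (1 : Module.End ℂ M) ∈
    (LinearMap.ker d.toLinearMap).map c.toLinearMap := this ▸ Submodule.mem_top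
  exact ⟨x, hx', hx⟩

/-- Let `a` and `b` be irreducible actions of an algebra on finite dimensional spaces. Either they
are isomorphic, or some element acts by `1` in the first and by `0` in the second. -/
theorem exists_separating_or_equiv {A M' : Type*} [Ring A] [Algebra ℂ A] [AddCommGroup M']
    [Module ℂ M'] [FiniteDimensional ℂ M] [FiniteDimensional ℂ M'] {a : A →ₐ[ℂ] Module.End ℂ M}
    {b : A →ₐ[ℂ] Module.End ℂ M'} (ha : Function.Surjective a) (hb : Function.Surjective b) :
    (∃ u, a u = 1 ∧ b u = 0) ∨ ∃ e : M ≃ₗ[ℂ] M', ∀ u m, e (a u m) = b u (e m) := by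
  by_cases h1 : ∃ u, b u = 0 ∧ a u ≠ 0
  · exact Or.inl (exists_map_eq_one ha h1)
  by_cases h2 : ∃ u, a u = 0 ∧ b u ≠ 0
  · obtain ⟨u, hu, hu'⟩ := exists_map_eq_one hb h2
    exact Or.inl ⟨1 - u, by rw [map_sub, map_one, hu', sub_zero], by
      rw [map_sub, map_one, hu, sub_self]⟩
  push Not at h1 h2
  right
  have hab : ∀ {u v}, a u = a v → b u = b v := fun {u v} h => by
    rw [← sub_eq_zero, ← map_sub] at h ⊢
    exact h2 _ h
  have hba : ∀ {u v}, b u = b v → a u = a v := fun {u v} h => by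
    rw [← sub_eq_zero, ← map_sub] at h ⊢
    exact h1 _ h
  have hs := Function.surjInv_eq ha
  -- equal kernels give an isomorphism of matrix algebras, which is inner by Skolem–Noether
  let c : Module.End ℂ M →ₐ[ℂ] Module.End ℂ M' :=
    AlgHom.ofLinearMap
      { toFun := fun T => b (Function.surjInv ha T)
        map_add' := fun S T => by
          rw [← map_add]
          exact hab (by rw [hs, map_add, hs, hs])
        map_smul' := fun r T => by
          rw [RingHom.id_apply, ← map_smul]
          exact hab (by rw [hs, map_smul, hs]) }
      (by
        rw [← map_one b]
        exact hab (by rw [hs, map_one]))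
      (fun S T => by
        change b _ = b _ * b _
        rw [← map_mul]
        exact hab (by rw [hs, map_mul, hs, hs]))
  have hc : ∀ u, c (a u) = b u := fun u => hab (hs _)
  have hcb : Function.Bijective c := by
    constructor
    · intro S T h
      have := hba (show b _ = b _ from h)
      rwa [hs, hs] at this
    · intro T
      obtain ⟨u, rfl⟩ := hb T
      exact ⟨a u, hc u⟩
  obtain ⟨e, he⟩ := AlgEquiv.eq_linearEquivConjAlgEquiv (AlgEquiv.ofBijective c hcb)
  refine ⟨e, fun u m => ?_⟩
  have h := hc u
  have h2 : c (a u) = e.conjAlgEquiv ℂ (a u) := DFunLike.congr_fun he (a u)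
  rw [← h, h2]
  simp [LinearEquiv.conjAlgEquiv_apply]

/-- An operator commuting with all operators is a scalar. -/
theorem exists_eq_smul_of_commute {T : Module.End ℂ M} (h : ∀ S : Module.End ℂ M, Commute S T) :
    ∃ c : ℂ, T = c • 1 := by
  have : T ∈ Subalgebra.center ℂ (Module.End ℂ M) :=
    Subalgebra.mem_center_iff.2 fun S => (h S).eq
  rw [Algebra.IsCentral.center_eq_bot] at this
  obtain ⟨c, rfl⟩ := Algebra.mem_bot.1 this
  exact ⟨c, Algebra.algebraMap_eq_smul_one c⟩

/-- Subspaces on which operators `T i` act by scalars, with different families of eigenvalues on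
different subspaces, are independent. -/
theorem iSupIndep_of_apply_eq_smul {κ ι : Type*} {W : κ → Submodule ℂ M} (T : ι → Module.End ℂ M)
    (χ : κ → ι → ℂ) (hχ : Function.Injective χ) (h : ∀ k i, ∀ w ∈ W k, T i w = χ k i • w) :
    iSupIndep W := by
  classical
  rw [iSupIndep_iff_finsetSum_eq_zero_imp_eq_zero]
  intro s
  induction s using Finset.induction_on with
  | empty => simp
  | insert k s hk ih =>
    intro x hx hsum
    have hs : ∀ j ∈ s, x j = 0 := by
      intro j hj
      obtain ⟨i, hi⟩ : ∃ i, χ j i ≠ χ k i := by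
        by_contra! hne
        exact hk (hχ (funext hne) ▸ hj)
      have h1 : ∑ l ∈ s, (χ l i - χ k i) • x l = 0 := by
        have h2 := congrArg (fun y => T i y - χ k i • y) hsum
        simp only [map_sum, map_zero, smul_zero, sub_zero, Finset.smul_sum,
          ← Finset.sum_sub_distrib] at h2
        rw [Finset.sum_insert hk, h k i _ (hx k (Finset.mem_insert_self k s)), sub_self,
          zero_add] at h2
        rw [← h2]
        refine Finset.sum_congr rfl fun l hl => ?_
        rw [h l i _ (hx l (Finset.mem_insert_of_mem hl)), sub_smul]
      have h3 := ih (fun l => (χ l i - χ k i) • x l)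
        (fun l hl => (W l).smul_mem _ (hx l (Finset.mem_insert_of_mem hl))) h1 j hj
      exact (smul_eq_zero.1 h3).resolve_left (sub_ne_zero.2 hi)
    intro j hj
    rcases Finset.mem_insert.1 hj with rfl | hj
    · rwa [Finset.sum_insert hk, Finset.sum_eq_zero hs, add_zero] at hsum
    · exact hs j hj

theorem eq_bot_or_eq_top_of_isIrreducible {K : Type*} [Group K] {ρ : Representation ℂ K M}
    (hρ : ρ.IsIrreducible) {W : Submodule ℂ M} (hW : ∀ g, ∀ w ∈ W, ρ g w ∈ W) :
    W = ⊥ ∨ W = ⊤ := by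
  rcases hρ.eq_bot_or_eq_top (⟨W, fun g w hw => hW g w hw⟩ : Subrepresentation ρ) with h | h
  · exact Or.inl (congrArg Subrepresentation.toSubmodule h)
  · exact Or.inr (congrArg Subrepresentation.toSubmodule h)

theorem nontrivial_of_isIrreducible {K : Type*} [Group K] {ρ : Representation ℂ K M}
    (hρ : ρ.IsIrreducible) : Nontrivial M := by
  obtain ⟨a, b, hab⟩ := hρ.exists_pair_ne
  by_contra hM
  rw [not_nontrivial_iff_subsingleton] at hM
  exact hab (Subrepresentation.toSubmodule_injective (Subsingleton.elim _ _))

theorem isIrreducible_of_stable {K : Type*} [Group K] {ρ : Representation ℂ K M} [Nontrivial M]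
    (h : ∀ W : Submodule ℂ M, (∀ g, ∀ w ∈ W, ρ g w ∈ W) → W = ⊥ ∨ W = ⊤) :
    ρ.IsIrreducible where
  exists_pair_ne := ⟨⊥, ⊤, fun e => bot_ne_top (α := Submodule ℂ M)
    (congrArg Subrepresentation.toSubmodule e)⟩
  eq_bot_or_eq_top W := (h W.toSubmodule fun g _ hw => W.apply_mem_toSubmodule g hw).imp
    (fun e => Subrepresentation.toSubmodule_injective e)
    (fun e => Subrepresentation.toSubmodule_injective e)

theorem subalgebra_eq_top_of_isIrreducible [FiniteDimensional ℂ M] {K : Type*} [Group K]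
    {ρ : Representation ℂ K M} (hρ : ρ.IsIrreducible) {B : Subalgebra ℂ (Module.End ℂ M)}
    (hB : ∀ g, ρ g ∈ B) : B = ⊤ :=
  subalgebra_end_eq_top fun _ hW =>
    eq_bot_or_eq_top_of_isIrreducible hρ fun g w hw => hW _ (hB g) w hw

end Burnside

/-! ### External tensor products of irreducible representations -/

section ExtTensor

variable {K : Type*} [Group K] {N : ℕ} {V : Fin N → Type*} [∀ i, AddCommGroup (V i)]
    [∀ i, Module ℂ (V i)] [∀ i, FiniteDimensional ℂ (V i)] {π : ∀ i, Representation ℂ K (V i)}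

/-- The external tensor product of irreducible representations generates all operators. -/
theorem subalgebra_extTensor_eq_top (hπ : ∀ i, (π i).IsIrreducible)
    {B : Subalgebra ℂ (Module.End ℂ (⨂[ℂ] i, V i))} (hB : ∀ h, extTensor π h ∈ B) : B = ⊤ := by
  have hsingle : ∀ (i : Fin N) (A : Module.End ℂ (V i)),
      PiTensorProduct.map (Pi.mulSingle i A : ∀ i, Module.End ℂ (V i)) ∈ B := by
    intro i A
    let φ : Module.End ℂ (V i) →ₐ[ℂ] Module.End ℂ (⨂[ℂ] i, V i) :=
      AlgHom.ofLinearMap ((PiTensorProduct.mapMultilinear ℂ V V).toLinearMap 1 i)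
        (by
          change PiTensorProduct.map (Function.update 1 i 1) = 1
          rw [show Function.update (1 : ∀ i, Module.End ℂ (V i)) i 1 = 1 from
            Function.update_eq_self i 1]
          exact PiTensorProduct.map_one)
        (fun S T => by
          change PiTensorProduct.map (Pi.mulSingle i (S * T) : ∀ i, Module.End ℂ (V i)) =
            PiTensorProduct.map (Pi.mulSingle i S) * PiTensorProduct.map (Pi.mulSingle i T)
          rw [← PiTensorProduct.map_mul, Pi.mulSingle_mul]
          rfl)
    have htop : B.comap φ = ⊤ := subalgebra_eq_top_of_isIrreducible (hπ i) fun g => by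
      have e : φ (π i g) = extTensor π (Pi.mulSingle i g) := by
        change PiTensorProduct.map (Pi.mulSingle i (π i g) : ∀ i, Module.End ℂ (V i)) =
          PiTensorProduct.map _
        congr 1
        funext j
        by_cases hj : j = i
        · subst hj; simp
        · simp [Pi.mulSingle_eq_of_ne hj]
      rw [Subalgebra.mem_comap, e]
      exact hB _
    have hA : A ∈ B.comap φ := htop ▸ Algebra.mem_top
    exact hA
  have hmap : ∀ A : ∀ i, Module.End ℂ (V i), PiTensorProduct.map A ∈ B := by
    intro A
    have hx : ((Finset.univ : Finset (Fin N)) : Set (Fin N)).Pairwise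
        (Function.onFun Commute fun i => Pi.mulSingle i (A i)) :=
      fun i _ j _ _ => Pi.mulSingle_apply_commute A i j
    have e := Finset.map_noncommProd Finset.univ (fun i => Pi.mulSingle i (A i)) hx
      (PiTensorProduct.mapMonoidHom (R := ℂ) (s := V))
    rw [Finset.noncommProd_mulSingle] at e
    have e' : PiTensorProduct.map A = _ := e
    rw [e']
    exact B.toSubmonoid.noncommProd_mem _ _ _ fun i _ => hsingle i (A i)
  let b := Basis.piTensorProduct fun i => Module.finBasis ℂ (V i)
  refine subalgebra_end_eq_top fun W hW => ?_
  by_cases h0 : W = ⊥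
  · exact Or.inl h0
  obtain ⟨w, hw, hw0⟩ := Submodule.exists_mem_ne_zero_of_ne_bot h0
  obtain ⟨p, hp⟩ : ∃ p, b.repr w p ≠ 0 := by
    by_contra! h
    exact hw0 (b.repr.map_eq_zero_iff.1 (Finsupp.ext h))
  right
  rw [← top_le_iff, ← b.span_eq, Submodule.span_le]
  rintro _ ⟨q, rfl⟩
  -- products of matrix units send any nonzero vector to any basis vector
  have e : PiTensorProduct.map (fun i => ((Module.finBasis ℂ (V i)).coord (p i)).smulRight
      (Module.finBasis ℂ (V i) (q i))) = (b.coord p).smulRight (b q) := by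
    refine PiTensorProduct.ext (MultilinearMap.ext fun v => ?_)
    simp only [LinearMap.compMultilinearMap_apply, PiTensorProduct.map_tprod,
      LinearMap.smulRight_apply, Module.Basis.coord_apply, b,
      Basis.piTensorProduct_repr_tprod_apply, Basis.piTensorProduct_apply]
    exact MultilinearMap.map_smul_univ _ _ _
  have hm := hW _ (hmap fun i => ((Module.finBasis ℂ (V i)).coord (p i)).smulRight
    (Module.finBasis ℂ (V i) (q i))) w hw
  rw [e, LinearMap.smulRight_apply, Module.Basis.coord_apply] at hm
  exact (W.smul_mem_iff hp).1 hm

end ExtTensor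

/-! ### The infinitesimal action and infinitesimal characters -/

section InfinitesimalAction

variable {E : Type*} [NormedAddCommGroup E] [NormedSpace ℝ E] [CompleteSpace E]
    {G : Type*} [TopologicalSpace G] [ChartedSpace E G] [Group G] [LieGroup 𝓘(ℝ, E) ∞ G]
    {V V' : Type*} [AddCommGroup V] [Module ℂ V] [AddCommGroup V'] [Module ℂ V']
    {π : Representation ℂ G V} {π' : Representation ℂ G V'}

theorem IsSmoothRep.isFinSmooth [FiniteDimensional ℂ V] (h : IsSmoothRep 𝓘(ℝ, E) π) :
    IsFinSmooth E π := fun v =>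
  ⟨_, fun x k => (Module.finBasis ℂ V).repr (π x v) k, Module.finBasis ℂ V,
    contMDiff_pi_space.2 fun k => h v ((Module.finBasis ℂ V).coord k),
    fun x => ((Module.finBasis ℂ V).sum_repr (π x v)).symm⟩

theorem ugAction_ugIncl (h : IsFinSmooth E π) (X : GroupLieAlgebra 𝓘(ℝ, E) G) :
    ugAction h (ugIncl X) = diffReal h X := ugLift_ugIncl _ _ X

/-- An intertwiner of representations intertwines the infinitesimal actions. -/
theorem ugAction_intertwine (h : IsFinSmooth E π) (h' : IsFinSmooth E π') {T : V →ₗ[ℂ] V'}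
    (hT : ∀ x v, T (π x v) = π' x (T v)) (u : Ug E G) (v : V) :
    T (ugAction h u v) = ugAction h' u (T v) := by
  refine ug_intertwine_linear (φ := ugAction h) (ψ := ugAction h') (fun X v => ?_) u v
  rw [ugAction_ugIncl, ugAction_ugIncl]
  refine eq_of_dual fun l => ?_
  rw [dual_diffReal, ← LinearMap.comp_apply, dual_diffReal]
  simp only [LinearMap.comp_apply, hT]

/-- The infinitesimal action preserves the subspaces preserved by the group. -/
theorem ugAction_mem (h : IsFinSmooth E π) {W : Submodule ℂ V}
    (hW : ∀ x, ∀ w ∈ W, π x w ∈ W) (u : Ug E G) {w : V} (hw : w ∈ W) : ugAction h u w ∈ W := by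
  let S : Subalgebra ℂ (Ug E G) :=
    { carrier := {u | ∀ w ∈ W, ugAction h u w ∈ W}
      mul_mem' := by
        intro u v hu hv w hw
        rw [map_mul]
        exact hu _ (hv w hw)
      add_mem' := by
        intro u v hu hv w hw
        rw [map_add]
        exact W.add_mem (hu w hw) (hv w hw)
      algebraMap_mem' := fun a w hw => by
        rw [AlgHom.commutes, Module.algebraMap_end_apply]
        exact W.smul_mem a hw }
  have hS : S = ⊤ := ug_subalgebra_eq_top fun X w hw => by
    rw [ugAction_ugIncl, ← Subspace.forall_mem_dualAnnihilator_apply_eq_zero_iff]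
    intro l hl
    rw [Submodule.mem_dualAnnihilator] at hl
    rw [dual_diffReal, show (fun x => l (π x w)) = fun _ => 0 from
      funext fun x => hl _ (hW x w hw)]
    unfold dirDeriv
    rw [mfderiv_const]
    rfl
  have hu : u ∈ S := hS ▸ Algebra.mem_top
  exact hu w hw

/-- Stability under `U𝔤` implies stability under a connected group. -/
theorem apply_mem_of_ugAction [FiniteDimensional ℝ E] [ConnectedSpace G] (h : IsFinSmooth E π)
    {W : Submodule ℂ V} [FiniteDimensional ℂ W] (hW : ∀ u, ∀ w ∈ W, ugAction h u w ∈ W) (x : G)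
    {w : V} (hw : w ∈ W) : π x w ∈ W :=
  h.apply_mem (fun X w hw => ugAction_ugIncl h X ▸ hW (ugIncl X) w hw) x hw

theorem ugAction_adUg (h : IsFinSmooth E π) (x : G) (u : Ug E G) :
    π x * ugAction h u = ugAction h (adUg x u) * π x := by
  refine ug_intertwine (φ := ugAction h) (ψ := (ugAction h).comp (adUg x)) (fun X => ?_) u
  rw [AlgHom.comp_apply, adUg_ugIncl, ugAction_ugIncl, ugAction_ugIncl]
  refine LinearMap.ext fun v => eq_of_dual fun l => ?_
  rw [Module.End.mul_apply, Module.End.mul_apply, dual_diffReal, ← LinearMap.comp_apply,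
    dual_diffReal, dirDeriv_adLin (h.mdiff _ _ _)]
  congr 1
  funext y
  simp only [LinearMap.comp_apply, map_mul, Module.End.mul_apply]
  rw [← Module.End.mul_apply (π x⁻¹), ← map_mul, inv_mul_cancel, map_one, Module.End.one_apply]

/-- A linear map intertwining the infinitesimal actions of a connected group intertwines the
representations: its graph is a subspace stable under the Lie algebra. -/
theorem intertwine_of_ugAction [FiniteDimensional ℝ E] [ConnectedSpace G] [FiniteDimensional ℂ V]
    (h : IsFinSmooth E π) (h' : IsFinSmooth E π') {T : V →ₗ[ℂ] V'}
    (hT : ∀ u v, T (ugAction h u v) = ugAction h' u (T v)) (x : G) (v : V) :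
    T (π x v) = π' x (T v) := by
  have hρ : IsFinSmooth E (π.prod π') := by
    rintro ⟨v, v'⟩
    obtain ⟨d, c, w, hc, hw⟩ := h v
    obtain ⟨d', c', w', hc', hw'⟩ := h' v'
    refine ⟨d + d', fun x => Fin.append (c x) (c' x),
      Fin.append (fun k => (w k, 0)) (fun k => (0, w' k)), ?_, fun x => ?_⟩
    · rw [contMDiff_pi_space] at hc hc' ⊢
      intro i
      induction i using Fin.addCases with
      | left i => simpa using hc i
      | right i => simpa using hc' i
    · rw [Fin.sum_univ_add]
      simp only [Fin.append_left, Fin.append_right]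
      refine Prod.ext ?_ ?_
      · change π x v = _
        simpa [Prod.fst_sum] using hw x
      · change π' x v' = _
        simpa [Prod.snd_sum] using hw' x
  have h1 : ∀ u p, (ugAction hρ u p).1 = ugAction h u p.1 :=
    fun u p => ugAction_intertwine hρ h (T := LinearMap.fst ℂ V V') (fun _ _ => rfl) u p
  have h2 : ∀ u p, (ugAction hρ u p).2 = ugAction h' u p.2 :=
    fun u p => ugAction_intertwine hρ h' (T := LinearMap.snd ℂ V V') (fun _ _ => rfl) u p
  have : FiniteDimensional ℂ T.graph := by
    rw [LinearMap.graph_eq_range_prod]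
    infer_instance
  have key := apply_mem_of_ugAction hρ (W := T.graph) (fun u p hp => by
    rw [LinearMap.mem_graph_iff] at hp ⊢
    rw [h1, h2, hp, hT]) x (w := (v, T v)) (by rw [LinearMap.mem_graph_iff])
  rw [LinearMap.mem_graph_iff] at key
  exact key.symm

/-- The density theorem for an irreducible representation of a connected group. -/
theorem ugAction_surjective [FiniteDimensional ℝ E] [ConnectedSpace G] [FiniteDimensional ℂ V]
    (h : IsFinSmooth E π) (hπ : π.IsIrreducible) : Function.Surjective (ugAction h) := by
  rw [← AlgHom.range_eq_top]
  refine subalgebra_end_eq_top fun W hW => eq_bot_or_eq_top_of_isIrreducible hπ fun x w hw => ?_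
  exact apply_mem_of_ugAction h (fun u w hw => hW _ ⟨u, rfl⟩ w hw) x hw

/-- The center of `U𝔤` acts by scalars in an irreducible representation. -/
theorem exists_ugAction_center [FiniteDimensional ℝ E] [ConnectedSpace G] [FiniteDimensional ℂ V]
    (h : IsFinSmooth E π) (hπ : π.IsIrreducible) {z : Ug E G}
    (hz : z ∈ Subalgebra.center ℂ (Ug E G)) : ∃ c : ℂ, ∀ v, ugAction h z v = c • v := by
  obtain ⟨c, hc⟩ := exists_eq_smul_of_commute (T := ugAction h z) fun S => by
    obtain ⟨u, rfl⟩ := ugAction_surjective h hπ S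
    have : Commute u z := Subalgebra.mem_center_iff.1 hz u
    exact this.map (ugAction h)
  exact ⟨c, fun v => by rw [hc]; rfl⟩

theorem eq_of_mul_apply_eq (π : Representation ℂ G V) (x : G) {A B : Module.End ℂ V}
    (h : A * π x = B * π x) : A = B := by
  have := congrArg (· * π x⁻¹) h
  simpa only [mul_assoc, ← map_mul, mul_inv_cancel, map_one, mul_one] using this

/-- The infinitesimal characters of irreducible representations of a compact connected group
separate isomorphism classes: by the density theorem some `u ∈ U𝔤` acts by `1` in the first
representation and by `0` in the second, and so does its average over the adjoint action, which is
central. -/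
theorem exists_center_separating [FiniteDimensional ℝ E] [ConnectedSpace G] [CompactSpace G]
    [FiniteDimensional ℂ V] [FiniteDimensional ℂ V'] (h : IsFinSmooth E π) (h' : IsFinSmooth E π')
    (hπ : π.IsIrreducible) (hπ' : π'.IsIrreducible) (hne : ¬ Nonempty (π.Equiv π')) :
    ∃ z ∈ Subalgebra.center ℂ (Ug E G), ugAction h z = 1 ∧ ugAction h' z = 0 := by
  rcases exists_separating_or_equiv (ugAction_surjective h hπ) (ugAction_surjective h' hπ') with
    ⟨u, hu, hu'⟩ | ⟨e, he⟩
  · have : IsTopologicalGroup G := topologicalGroup_of_lieGroup 𝓘(ℝ, E) ∞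
    obtain ⟨z, hz, hzu⟩ := (isFinSmooth_adRep (E := E) (G := G)).isFinContinuous.exists_invariant u
    refine ⟨z, mem_center_of_adUg_eq_self hz, ?_, ?_⟩
    · refine map_eq_of_sub_mem_span hzu (ugAction h).toLinearMap fun x => ?_
      refine eq_of_mul_apply_eq π x ?_
      rw [AlgHom.toLinearMap_apply, adRep_apply, ← ugAction_adUg, hu, one_mul, mul_one]
    · refine map_eq_of_sub_mem_span hzu (ugAction h').toLinearMap fun x => ?_
      refine eq_of_mul_apply_eq π' x ?_
      rw [AlgHom.toLinearMap_apply, adRep_apply, ← ugAction_adUg, hu', zero_mul, mul_zero]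
  · refine absurd ?_ hne
    have hx := intertwine_of_ugAction h h' (T := e.toLinearMap) he
    exact ⟨.mk e fun x => LinearMap.ext fun v => hx x v⟩

end InfinitesimalAction

/-! ### Spaces of matrix elements -/

section MatrixElements

variable {K : Type*} [Group K] {V V' : Type*} [AddCommGroup V] [Module ℂ V] [AddCommGroup V']
    [Module ℂ V']

/-- Transport of a representation along a linear isomorphism. -/
def conjRep (ρ : Representation ℂ K V) (e : V ≃ₗ[ℂ] V') : Representation ℂ K V' where
  toFun x := e.conj (ρ x)
  map_one' := by rw [map_one]; exact e.conj_id
  map_mul' x y := by rw [map_mul]; exact e.conj_comp _ _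

theorem conjRep_apply (ρ : Representation ℂ K V) (e : V ≃ₗ[ℂ] V') (x : K) (v : V') :
    conjRep ρ e x v = e (ρ x (e.symm v)) := rfl

theorem isIrreducible_conjRep {ρ : Representation ℂ K V} (hρ : ρ.IsIrreducible)
    (e : V ≃ₗ[ℂ] V') : (conjRep ρ e).IsIrreducible := by
  have := nontrivial_of_isIrreducible hρ
  have := e.symm.toEquiv.nontrivial
  refine isIrreducible_of_stable fun W hW => ?_
  have h := eq_bot_or_eq_top_of_isIrreducible hρ (W := W.comap e.toLinearMap) fun g w hw => by
    have := hW g (e w) hw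
    rwa [conjRep_apply, e.symm_apply_apply] at this
  have hmap : (W.comap e.toLinearMap).map e.toLinearMap = W :=
    Submodule.map_comap_eq_of_surjective e.surjective W
  rcases h with h | h
  · exact Or.inl (by rw [← hmap, h, Submodule.map_bot])
  · exact Or.inr (by rw [← hmap, h, Submodule.map_top]; exact LinearMap.range_eq_top.2 e.surjective)

theorem matrixElement_eq_of_equiv {ρ : Representation ℂ K V} {ρ' : Representation ℂ K V'}
    (e : V ≃ₗ[ℂ] V') (he : ∀ x v, e (ρ x v) = ρ' x (e v)) (v : V) (l : Module.Dual ℂ V) :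
    matrixElement ρ v l = matrixElement ρ' (e v) (l ∘ₗ e.symm.toLinearMap) := by
  funext x
  simp [matrixElement, ← he]

/-- The function `g ↦ tr(ρ(g) A)`. -/
def traceFun (ρ : Representation ℂ K V) : Module.End ℂ V →ₗ[ℂ] K → ℂ where
  toFun A g := LinearMap.trace ℂ V (ρ g * A)
  map_add' A B := by funext g; simp [mul_add]
  map_smul' a A := by funext g; simp

theorem traceFun_apply (ρ : Representation ℂ K V) (A : Module.End ℂ V) (g : K) :
    traceFun ρ A g = LinearMap.trace ℂ V (ρ g * A) := rfl

theorem traceFun_translate (ρ : Representation ℂ K V) (A : Module.End ℂ V) (a b g : K) :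
    traceFun ρ A (a * g * b) = traceFun ρ (ρ b * A * ρ a) g := by
  have e : ρ (a * g * b) * A = ρ a * (ρ g * ρ b * A) := by
    rw [map_mul, map_mul]
    simp only [mul_assoc]
  rw [traceFun_apply, traceFun_apply, e, LinearMap.trace_mul_comm]
  simp only [mul_assoc]

variable [FiniteDimensional ℂ V]

theorem traceFun_smulRight (ρ : Representation ℂ K V) (v : V) (l : Module.Dual ℂ V) :
    traceFun ρ (l.smulRight v) = matrixElement ρ v l := by
  funext g
  have e : ρ g * (l.smulRight v : Module.End ℂ V) = l.smulRight (ρ g v) := by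
    ext w
    simp
  rw [traceFun_apply, e, LinearMap.trace_smulRight]
  rfl

theorem span_matrixElement (ρ : Representation ℂ K V) :
    Submodule.span ℂ {f | ∃ v l, f = matrixElement ρ v l} = LinearMap.range (traceFun ρ) := by
  refine le_antisymm (Submodule.span_le.2 ?_) ?_
  · rintro _ ⟨v, l, rfl⟩
    exact ⟨_, traceFun_smulRight ρ v l⟩
  · rintro _ ⟨A, rfl⟩
    let b := Module.finBasis ℂ V
    have : A = ∑ i, (b.coord i).smulRight (A (b i)) := by
      refine b.ext fun i => ?_
      simp [Finsupp.single_apply]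
    rw [this, map_sum]
    refine Submodule.sum_mem _ fun i _ => Submodule.subset_span ⟨_, _, traceFun_smulRight ρ _ _⟩

/-- The matrix elements of a representation generating all operators form an irreducible bimodule
of functions. -/
theorem eq_bot_or_eq_range_traceFun {ρ : Representation ℂ K V}
    (hρ : ∀ B : Subalgebra ℂ (Module.End ℂ V), (∀ g, ρ g ∈ B) → B = ⊤) {W : Submodule ℂ (K → ℂ)}
    (hW : W ≤ LinearMap.range (traceFun ρ))
    (hstable : ∀ a b, ∀ f ∈ W, (fun g => f (a * g * b)) ∈ W) :
    W = ⊥ ∨ W = LinearMap.range (traceFun ρ) := by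
  have hmap : (W.comap (traceFun ρ)).map (traceFun ρ) = W := by
    rw [Submodule.map_comap_eq, inf_eq_right.2 hW]
  have hL : ∀ g, ∀ A ∈ W.comap (traceFun ρ), ρ g * A ∈ W.comap (traceFun ρ) := fun g A hA => by
    have := hstable 1 g _ hA
    simp only [traceFun_translate, map_one, mul_one] at this
    exact this
  have hR : ∀ g, ∀ A ∈ W.comap (traceFun ρ), A * ρ g ∈ W.comap (traceFun ρ) := fun g A hA => by
    have := hstable g 1 _ hA
    simp only [traceFun_translate, map_one, one_mul] at this
    exact this
  by_cases h0 : W.comap (traceFun ρ) = ⊥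
  · left
    rw [← hmap, h0, Submodule.map_bot]
  · right
    have := bimodule_end_eq_top (W := W.comap (traceFun ρ)) (fun T => ?_) (fun T => ?_) h0
    · rw [← hmap, this, Submodule.map_top]
    -- the multipliers preserving a subspace form an algebra, which contains all `ρ g`
    · let B : Subalgebra ℂ (Module.End ℂ V) :=
        { carrier := {T | ∀ A ∈ W.comap (traceFun ρ), T * A ∈ W.comap (traceFun ρ)}
          mul_mem' := fun hS hT A hA => by rw [mul_assoc]; exact hS _ (hT A hA)
          add_mem' := fun hS hT A hA => by
            rw [add_mul]; exact Submodule.add_mem _ (hS A hA) (hT A hA)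
          algebraMap_mem' := fun a A hA => by
            rw [← Algebra.smul_def]; exact Submodule.smul_mem _ a hA }
      have hT : T ∈ B := hρ B hL ▸ Algebra.mem_top
      exact hT
    · let B : Subalgebra ℂ (Module.End ℂ V) :=
        { carrier := {T | ∀ A ∈ W.comap (traceFun ρ), A * T ∈ W.comap (traceFun ρ)}
          mul_mem' := fun hS hT A hA => by rw [← mul_assoc]; exact hT _ (hS A hA)
          add_mem' := fun hS hT A hA => by
            rw [mul_add]; exact Submodule.add_mem _ (hS A hA) (hT A hA)
          algebraMap_mem' := fun a A hA => by
            rw [← Algebra.commutes, ← Algebra.smul_def]; exact Submodule.smul_mem _ a hA }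
      have hT : T ∈ B := hρ B hR ▸ Algebra.mem_top
      exact hT

section Smooth

variable {F H : Type*} [NormedAddCommGroup F] [NormedSpace ℝ F] [TopologicalSpace H]
    {J : ModelWithCorners ℝ F H} [TopologicalSpace K] [ChartedSpace H K]

theorem isSmoothRep_conjRep {ρ : Representation ℂ K V} (hρ : IsSmoothRep J ρ) (e : V ≃ₗ[ℂ] V') :
    IsSmoothRep J (conjRep ρ e) := fun v l => hρ (e.symm v) (l ∘ₗ e.toLinearMap)

theorem matrixElement_mem_repFun {ρ : Representation ℂ K V} (hρ : IsSmoothRep J ρ) (v : V)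
    (l : Module.Dual ℂ V) : matrixElement ρ v l ∈ repFun J K := by
  let e := (Module.finBasis ℂ V).equivFun
  rw [matrixElement_eq_of_equiv (ρ' := conjRep ρ e) e
    (fun x v => by rw [conjRep_apply, e.symm_apply_apply])]
  exact Submodule.subset_span ⟨_, _, isSmoothRep_conjRep hρ e, _, _, rfl⟩

end Smooth

end MatrixElements

/-! ### Smoothness of external tensor products -/

section ExtTensor

variable {E : Type*} [NormedAddCommGroup E] [NormedSpace ℝ E] [CompleteSpace E]
    {G : Type*} [TopologicalSpace G] [ChartedSpace E G] [Group G] [LieGroup 𝓘(ℝ, E) ∞ G] {N : ℕ}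
    {V : Fin N → Type*} [∀ i, AddCommGroup (V i)] [∀ i, Module ℂ (V i)]
    {π : ∀ i, Representation ℂ G (V i)}

theorem extTensor_tprod (h : Fin N → G) (v : ∀ i, V i) :
    extTensor π h (PiTensorProduct.tprod ℂ v) = PiTensorProduct.tprod ℂ fun i => π i (h i) (v i) :=
  PiTensorProduct.map_tprod _ _

theorem isSmoothRep_extTensor [∀ i, FiniteDimensional ℂ (V i)]
    (hπ : ∀ i, IsSmoothRep 𝓘(ℝ, E) (π i)) : IsSmoothRep (powModel E N) (extTensor π) := by
  intro v l
  suffices h : (fun g => l (extTensor π g v)) ∈ smoothFun E G N from h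
  induction v using PiTensorProduct.induction_on with
  | smul_tprod r v =>
    let b := fun i => Module.finBasis ℂ (V i)
    have e : (fun g => l (extTensor π g (r • PiTensorProduct.tprod ℂ v))) =
        ∑ p : ∀ i, Fin (Module.finrank ℂ (V i)),
          (r * l (PiTensorProduct.tprod ℂ fun i => b i (p i))) •
            ∏ i, fun g : Fin N → G => (b i).coord (p i) (π i (g i) (v i)) := by
      funext g
      have e2 : (fun i => π i (g i) (v i)) =
          fun i => ∑ k, (b i).coord k (π i (g i) (v i)) • b i k :=
        funext fun i => ((b i).sum_repr _).symm
      rw [map_smul, extTensor_tprod, e2, MultilinearMap.map_sum, map_smul, map_sum,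
        Finset.smul_sum, Finset.sum_apply]
      refine Finset.sum_congr rfl fun p _ => ?_
      rw [MultilinearMap.map_smul_univ, map_smul, Pi.smul_apply, Finset.prod_apply]
      simp only [smul_eq_mul]
      ring
    rw [e]
    refine sum_mem fun p _ => Subalgebra.smul_mem _ ((smoothFun E G N).prod_mem fun i _ => ?_) _
    exact ContMDiff.comp (g := fun x : G => (b i).coord (p i) (π i x (v i)))
      (hπ i (v i) ((b i).coord (p i))) (contMDiff_piApply i)
  | add v w hv hw =>
    simp only [map_add]
    exact add_mem hv hw

end ExtTensor

/-! ### The blocks of the algebra of representative functions -/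

section Blocks

variable {E : Type*} [NormedAddCommGroup E] [NormedSpace ℝ E] [CompleteSpace E]
    {G : Type*} [TopologicalSpace G] [ChartedSpace E G] [Group G] [LieGroup 𝓘(ℝ, E) ∞ G] {N : ℕ}

/-- The representation `V_{ν_1} ⊗ ⋯ ⊗ V_{ν_N}` of `G^N`. -/
abbrev extRep (σ : Fin N → IrrRep E G) :
    Representation ℂ (Fin N → G) (⨂[ℂ] i, (Fin (σ i).dim → ℂ)) := extTensor fun i => (σ i).rep

/-- A choice of representatives of isomorphism classes. -/
def representatives (ν : Fin N → IrrClass E G) (i : Fin N) : IrrRep E G := (ν i).out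

theorem mk_representatives (ν : Fin N → IrrClass E G) (i : Fin N) :
    (⟦representatives ν i⟧ : IrrClass E G) = ν i := Quotient.out_eq _

theorem range_traceFun_le (σ : Fin N → IrrRep E G) :
    LinearMap.range (traceFun (extRep σ)) ≤ RG E G N := by
  rw [← span_matrixElement, Submodule.span_le]
  rintro _ ⟨v, l, rfl⟩
  exact matrixElement_mem_repFun (isSmoothRep_extTensor fun i => (σ i).smooth) v l

/-- The matrix elements of `V_{ν_1} ⊗ ⋯ ⊗ V_{ν_N}` for a fixed functional. -/
def matrixLin (σ : Fin N → IrrRep E G) (l : Module.Dual ℂ (⨂[ℂ] i, (Fin (σ i).dim → ℂ))) :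
    (⨂[ℂ] i, (Fin (σ i).dim → ℂ)) →ₗ[ℂ] RG E G N where
  toFun v := ⟨matrixElement (extRep σ) v l,
    matrixElement_mem_repFun (isSmoothRep_extTensor fun i => (σ i).smooth) v l⟩
  map_add' v w := Subtype.ext <| funext fun g =>
    (congrArg l (map_add (extRep σ g) v w)).trans (map_add l _ _)
  map_smul' a v := Subtype.ext <| funext fun g =>
    (congrArg l (map_smul (extRep σ g) a v)).trans (map_smul l _ _)

theorem matrixLin_apply (σ : Fin N → IrrRep E G)
    (l : Module.Dual ℂ (⨂[ℂ] i, (Fin (σ i).dim → ℂ))) (v : ⨂[ℂ] i, (Fin (σ i).dim → ℂ))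
    (g : Fin N → G) : (matrixLin σ l v).1 g = l (extRep σ g v) := rfl

/-- The space `𝓡^{(ν)}(G^N)` is spanned by the matrix elements of one representative of `ν`. -/
theorem map_RGblock {ν : Fin N → IrrClass E G} {σ : Fin N → IrrRep E G}
    (hσ : ∀ i, (⟦σ i⟧ : IrrClass E G) = ν i) :
    (RGblock E ν).map (RG E G N).subtype = LinearMap.range (traceFun (extRep σ)) := by
  have : Submodule.span ℂ {f | ∃ σ : Fin N → IrrRep E G, (∀ i, (⟦σ i⟧ : IrrClass E G) = ν i) ∧
      ∃ v l, f = matrixElement (extTensor fun i => (σ i).rep) v l} =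
      LinearMap.range (traceFun (extRep σ)) := by
    rw [← span_matrixElement]
    refine le_antisymm (Submodule.span_le.2 ?_) (Submodule.span_mono ?_)
    · rintro _ ⟨σ', hσ', v, l, rfl⟩
      have he : ∀ i, Nonempty ((σ' i).rep.Equiv (σ i).rep) := fun i =>
        Quotient.exact ((hσ' i).trans (hσ i).symm)
      let e := fun i => (he i).some
      have hT : ∀ g w, PiTensorProduct.congr (fun i => (e i).toLinearEquiv) (extRep σ' g w) =
          extRep σ g (PiTensorProduct.congr (fun i => (e i).toLinearEquiv) w) := by
        intro g w
        induction w using PiTensorProduct.induction_on with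
        | smul_tprod r w =>
          simp only [map_smul]
          rw [extTensor_tprod, PiTensorProduct.congr_tprod, PiTensorProduct.congr_tprod,
            extTensor_tprod]
          congr 2
          funext i
          exact LinearMap.congr_fun ((e i).isIntertwining' (g i)) (w i)
        | add w w' hw hw' => simp only [map_add, hw, hw']
      rw [matrixElement_eq_of_equiv _ hT]
      exact Submodule.subset_span ⟨_, _, rfl⟩
    · rintro _ ⟨v, l, rfl⟩
      exact ⟨σ, hσ, v, l, rfl⟩
  rw [RGblock, this, Submodule.map_comap_subtype, inf_eq_right.2 (range_traceFun_le σ)]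

instance finiteDimensional_RGblock (ν : Fin N → IrrClass E G) :
    FiniteDimensional ℂ (RGblock E ν) := by
  have e := Submodule.equivMapOfInjective (RG E G N).subtype (RG E G N).injective_subtype
    (RGblock E ν)
  rw [map_RGblock (mk_representatives ν)] at e
  exact e.symm.finiteDimensional

theorem mem_RGblock_iff {ν : Fin N → IrrClass E G} {σ : Fin N → IrrRep E G}
    (hσ : ∀ i, (⟦σ i⟧ : IrrClass E G) = ν i) {f : RG E G N} :
    f ∈ RGblock E ν ↔ ∃ A, traceFun (extRep σ) A = f.1 := by
  have h : f ∈ RGblock E ν ↔ f.1 ∈ (RGblock E ν).map (RG E G N).subtype := by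
    constructor
    · exact fun hf => ⟨f, hf, rfl⟩
    · rintro ⟨f', hf', h⟩
      rwa [← Subtype.ext h]
  rw [h, map_RGblock hσ]
  rfl

theorem biTrans_mem_RGblock (ν : Fin N → IrrClass E G) (p : (Fin N → G) × (Fin N → G))
    {f : RG E G N} (hf : f ∈ RGblock E ν) :
    biTrans (powModel E N) (Fin N → G) p f ∈ RGblock E ν := by
  rw [mem_RGblock_iff (mk_representatives ν)] at hf ⊢
  obtain ⟨A, hA⟩ := hf
  refine ⟨extRep (representatives ν) p.2 * A * extRep (representatives ν) p.1⁻¹,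
    funext fun g => ?_⟩
  rw [biTrans_apply, ← hA, traceFun_translate]

/-- The block `𝓡^{(ν)}(G^N)` is irreducible under left and right translations by `G^N`. -/
theorem eq_bot_or_eq_RGblock {ν : Fin N → IrrClass E G} {W : Submodule ℂ (RG E G N)}
    (hW : W ≤ RGblock E ν)
    (hstable : ∀ p, ∀ f ∈ W, biTrans (powModel E N) (Fin N → G) p f ∈ W) :
    W = ⊥ ∨ W = RGblock E ν := by
  have hinj := Submodule.map_injective_of_injective (RG E G N).injective_subtype
  have := eq_bot_or_eq_range_traceFun (ρ := extRep (representatives ν))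
    (W := W.map (RG E G N).subtype)
    (fun B hB => subalgebra_extTensor_eq_top (fun i => (representatives ν i).irreducible) hB)
    (by
      rw [← map_RGblock (mk_representatives ν)]
      exact Submodule.map_mono hW)
    (by
      rintro a b _ ⟨f, hf, rfl⟩
      refine ⟨_, hstable (a⁻¹, b) f hf, funext fun g => ?_⟩
      change (biTrans (powModel E N) (Fin N → G) (a⁻¹, b) f).1 g = _
      rw [biTrans_apply, inv_inv]
      rfl)
  rw [← map_RGblock (mk_representatives ν)] at this
  exact this.imp (fun h => hinj (h.trans (Submodule.map_bot _).symm)) (fun h => hinj h)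

theorem momentL_mem_RGblock (ν : Fin N → IrrClass E G) (j : Fin N) (u : Ug E G) {f : RG E G N}
    (hf : f ∈ RGblock E ν) : momentL E j u f ∈ RGblock E ν :=
  ugAction_mem (isFinSmooth_leftRep E j) (fun _ _ h => biTrans_mem_RGblock ν _ h) u hf

theorem momentR_mem_RGblock (ν : Fin N → IrrClass E G) (j : Fin N) (u : Ug E G) {f : RG E G N}
    (hf : f ∈ RGblock E ν) : momentR E j u f ∈ RGblock E ν :=
  ugAction_mem (isFinSmooth_rightRep E j) (fun _ _ h => biTrans_mem_RGblock ν _ h) u hf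

theorem momentMap_mem_RGblock (ν : Fin N → IrrClass E G) (u : ⨂[ℂ] _ : Fin N, UgUg E G)
    {f : RG E G N} (hf : f ∈ RGblock E ν) : momentMap E G N u f ∈ RGblock E ν := by
  let S : Subalgebra ℂ (⨂[ℂ] _ : Fin N, UgUg E G) :=
    { carrier := {u | ∀ f ∈ RGblock E ν, momentMap E G N u f ∈ RGblock E ν}
      mul_mem' := by
        intro u v hu hv f hf
        rw [map_mul]
        exact hu _ (hv f hf)
      add_mem' := by
        intro u v hu hv f hf
        rw [map_add]
        exact Submodule.add_mem _ (hu f hf) (hv f hf)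
      algebraMap_mem' := fun a f hf => by
        rw [AlgHom.commutes, Module.algebraMap_end_apply]
        exact Submodule.smul_mem _ a hf }
  have hS : S = ⊤ := tensorUg_subalgebra_eq_top
    (fun j v f hf => by rw [momentMap_inL]; exact momentL_mem_RGblock ν j v hf)
    (fun j v f hf => by rw [momentMap_inR]; exact momentR_mem_RGblock ν j v hf)
  have hu : u ∈ S := hS ▸ Algebra.mem_top
  exact hu f hf

section Connected

variable [FiniteDimensional ℝ E] [ConnectedSpace G]

/-- A subspace stable under each factor of `G^N` is stable under `G^N`. -/
theorem prod_mem_stabilizer {M : Type*} [AddCommGroup M] [Module ℂ M]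
    {ρ : Representation ℂ (Fin N → G) M} {W : Submodule ℂ M}
    (h : ∀ j x, ∀ w ∈ W, ρ (Pi.mulSingle j x) w ∈ W) (g : Fin N → G) {w : M} (hw : w ∈ W) :
    ρ g w ∈ W := by
  let S : Submonoid (Fin N → G) :=
    { carrier := {g | ∀ w ∈ W, ρ g w ∈ W}
      mul_mem' := fun ha hb w hw => by rw [map_mul]; exact ha _ (hb w hw)
      one_mem' := fun w hw => by rwa [map_one] }
  have hg : g ∈ S := by
    rw [← Finset.noncommProd_mulSingle g]
    exact S.noncommProd_mem _ _ _ fun i _ => h i (g i)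
  exact hg w hw

/-- By left and right invariant differential operators one obtains all operators on
`𝓡^{(ν)}(G^N)`. -/
theorem exists_momentMap_eq (ν : Fin N → IrrClass E G) (T : Module.End ℂ (RGblock E ν)) :
    ∃ u : ⨂[ℂ] _ : Fin N, UgUg E G, ∀ f : RGblock E ν, momentMap E G N u f = T f := by
  have htop : inducedOps (momentMap E G N).range (RGblock E ν) = ⊤ := by
    refine subalgebra_end_eq_top (M := RGblock E ν) fun W hW => ?_
    have hWu : ∀ u, ∀ f ∈ W.map (RGblock E ν).subtype,
        momentMap E G N u f ∈ W.map (RGblock E ν).subtype := by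
      rintro u _ ⟨f, hf, rfl⟩
      let T : Module.End ℂ (RGblock E ν) := (momentMap E G N u).restrict
        fun f hf => momentMap_mem_RGblock ν u hf
      exact ⟨T f, hW T ⟨_, ⟨u, rfl⟩, fun _ => rfl⟩ f hf, rfl⟩
    have : FiniteDimensional ℂ (W.map (RGblock E ν).subtype) :=
      Submodule.finiteDimensional_of_le (Submodule.map_subtype_le (RGblock E ν) W)
    have hL : ∀ j (x : G), ∀ f ∈ W.map (RGblock E ν).subtype,
        leftRep E j x f ∈ W.map (RGblock E ν).subtype := fun j x f hf =>
      apply_mem_of_ugAction (isFinSmooth_leftRep E j)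
        (W := W.map (RGblock E ν).subtype) (fun u f hf => by
        have := hWu (inL j u) f hf
        rwa [momentMap_inL] at this) x hf
    have hR : ∀ j (x : G), ∀ f ∈ W.map (RGblock E ν).subtype,
        rightRep E j x f ∈ W.map (RGblock E ν).subtype := fun j x f hf =>
      apply_mem_of_ugAction (isFinSmooth_rightRep E j)
        (W := W.map (RGblock E ν).subtype) (fun u f hf => by
        have := hWu (inR j u) f hf
        rwa [momentMap_inR] at this) x hf
    have := eq_bot_or_eq_RGblock (W := W.map (RGblock E ν).subtype)
      (Submodule.map_subtype_le _ _) (fun p f hf => by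
        have e : p = (p.1, 1) * (1, p.2) := by simp
        rw [e, map_mul]
        exact prod_mem_stabilizer (ρ := (biTrans (powModel E N) (Fin N → G)).comp
          (MonoidHom.inl _ _)) hL p.1 (prod_mem_stabilizer
            (ρ := (biTrans (powModel E N) (Fin N → G)).comp (MonoidHom.inr _ _)) hR p.2 hf))
    have hinj := Submodule.map_injective_of_injective (RGblock E ν).injective_subtype
    refine this.imp (fun h => hinj (h.trans (Submodule.map_bot _).symm)) (fun h => hinj ?_)
    rw [h, Submodule.map_top, Submodule.range_subtype]
  obtain ⟨_, ⟨u, rfl⟩, hu⟩ : T ∈ inducedOps (momentMap E G N).range (RGblock E ν) :=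
    htop ▸ Algebra.mem_top
  exact ⟨u, fun f => (hu f).symm⟩

/-- The scalar by which a central element acts in an irreducible representation. -/
def infChar (σ : IrrRep E G) (z : Subalgebra.center ℂ (Ug E G)) : ℂ :=
  (exists_ugAction_center σ.smooth.isFinSmooth σ.irreducible z.2).choose

theorem ugAction_eq_infChar (σ : IrrRep E G) (z : Subalgebra.center ℂ (Ug E G))
    (v : Fin σ.dim → ℂ) : ugAction σ.smooth.isFinSmooth z.1 v = infChar σ z • v :=
  (exists_ugAction_center σ.smooth.isFinSmooth σ.irreducible z.2).choose_spec v

/-- The scalars by which the `N` copies of the center act on `𝓡^{(ν)}(G^N)`. -/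
def blockChar (ν : Fin N → IrrClass E G) (p : Fin N × Subalgebra.center ℂ (Ug E G)) : ℂ :=
  infChar (representatives ν p.1) p.2

/-- The `N` copies of the center separate distinct blocks. -/
theorem exists_blockChar [CompactSpace G] {ν ν' : Fin N → IrrClass E G} (h : ν ≠ ν') :
    ∃ p, blockChar ν p = 1 ∧ blockChar ν' p = 0 := by
  obtain ⟨j, hj⟩ := Function.ne_iff.1 h
  obtain ⟨z, hz, h1, h0⟩ := exists_center_separating (representatives ν j).smooth.isFinSmooth
    (representatives ν' j).smooth.isFinSmooth (representatives ν j).irreducible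
    (representatives ν' j).irreducible (fun he => hj (by
      rw [← mk_representatives ν j, ← mk_representatives ν' j]
      exact Quotient.sound he))
  refine ⟨(j, ⟨z, hz⟩), ?_, ?_⟩
  · have := nontrivial_of_isIrreducible (representatives ν j).irreducible
    obtain ⟨v, hv⟩ := exists_ne (0 : Fin (representatives ν j).dim → ℂ)
    have := ugAction_eq_infChar (representatives ν j) ⟨z, hz⟩ v
    rw [h1, Module.End.one_apply] at this
    have h2 : (1 : ℂ) • v = infChar (representatives ν j) ⟨z, hz⟩ • v := by rwa [one_smul]
    exact (smul_left_injective ℂ hv h2).symm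
  · have := nontrivial_of_isIrreducible (representatives ν' j).irreducible
    obtain ⟨v, hv⟩ := exists_ne (0 : Fin (representatives ν' j).dim → ℂ)
    have := ugAction_eq_infChar (representatives ν' j) ⟨z, hz⟩ v
    rw [h0, LinearMap.zero_apply] at this
    exact (smul_eq_zero.1 this.symm).resolve_right hv

theorem blockChar_injective [CompactSpace G] :
    Function.Injective (blockChar : (Fin N → IrrClass E G) → _) := fun ν ν' h => by
  by_contra hne
  obtain ⟨p, h1, h0⟩ := exists_blockChar hne
  rw [h, h0] at h1
  exact zero_ne_one h1

/-- The map `w ↦ (⋯ ⊗ w ⊗ ⋯)`, with `w` in the `j`-th factor, followed by a matrix element map,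
intertwines `V_{ν_j}` and the right translations of the `j`-th argument. -/
theorem matrixLin_update (σ : Fin N → IrrRep E G)
    (l : Module.Dual ℂ (⨂[ℂ] i, (Fin (σ i).dim → ℂ))) (v : ∀ i, Fin (σ i).dim → ℂ) (j : Fin N)
    (x : G) (w : Fin (σ j).dim → ℂ) :
    matrixLin σ l ((PiTensorProduct.tprod ℂ).toLinearMap v j ((σ j).rep x w)) =
      rightRep E j x (matrixLin σ l ((PiTensorProduct.tprod ℂ).toLinearMap v j w)) := by
  refine Subtype.ext (funext fun g => ?_)
  rw [rightRep_apply, matrixLin_apply, matrixLin_apply, map_mul, Module.End.mul_apply,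
    MultilinearMap.toLinearMap_apply, MultilinearMap.toLinearMap_apply,
    extTensor_tprod (Pi.mulSingle j x)]
  congr 3
  funext i
  by_cases hi : i = j
  · subst hi; simp
  · simp [Function.update_of_ne hi, Pi.mulSingle_eq_of_ne hi]

theorem momentR_matrixLin (σ : Fin N → IrrRep E G)
    (l : Module.Dual ℂ (⨂[ℂ] i, (Fin (σ i).dim → ℂ))) (j : Fin N)
    (z : Subalgebra.center ℂ (Ug E G)) (v : ⨂[ℂ] i, (Fin (σ i).dim → ℂ)) :
    momentR E j z.1 (matrixLin σ l v) = infChar (σ j) z • matrixLin σ l v := by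
  have : momentR E j z.1 ∘ₗ matrixLin σ l = infChar (σ j) z • matrixLin σ l := by
    refine PiTensorProduct.ext (MultilinearMap.ext fun v => ?_)
    have key := ugAction_intertwine (σ j).smooth.isFinSmooth (isFinSmooth_rightRep E j)
      (T := matrixLin σ l ∘ₗ (PiTensorProduct.tprod ℂ).toLinearMap v j)
      (fun x w => matrixLin_update σ l v j x w) z.1 (v j)
    have e : (PiTensorProduct.tprod ℂ).toLinearMap v j (v j) = PiTensorProduct.tprod ℂ v := by
      rw [MultilinearMap.toLinearMap_apply, Function.update_eq_self]
    rw [ugAction_eq_infChar, map_smul, LinearMap.comp_apply, e] at key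
    exact key.symm
  exact LinearMap.congr_fun this v

/-- The center acts on `𝓡^{(ν)}(G^N)` by scalars. -/
theorem momentR_apply_RGblock {ν : Fin N → IrrClass E G}
    (p : Fin N × Subalgebra.center ℂ (Ug E G)) {f : RG E G N} (hf : f ∈ RGblock E ν) :
    momentR E p.1 p.2.1 f = blockChar ν p • f := by
  have hspan : f.1 ∈ Submodule.span ℂ {f | ∃ v l, f = matrixElement (extRep (representatives ν)) v
      l} := by
    rw [span_matrixElement, ← map_RGblock (mk_representatives ν)]
    exact ⟨f, hf, rfl⟩
  have hle : Submodule.span ℂ {f | ∃ v l, f = matrixElement (extRep (representatives ν)) v l} ≤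
      (LinearMap.ker (momentR E p.1 p.2.1 - blockChar ν p • (1 : Module.End ℂ (RG E G N)))).map
        (RG E G N).subtype := by
    rw [Submodule.span_le]
    rintro _ ⟨v, l, rfl⟩
    refine ⟨matrixLin _ l v, ?_, rfl⟩
    rw [SetLike.mem_coe, LinearMap.mem_ker, LinearMap.sub_apply, momentR_matrixLin, blockChar,
      LinearMap.smul_apply, Module.End.one_apply, sub_self]
  obtain ⟨f', hf', h⟩ := hle hspan
  rw [← show f' = f from Subtype.ext h]
  rwa [SetLike.mem_coe, LinearMap.mem_ker, LinearMap.sub_apply, sub_eq_zero] at hf'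

end Connected

end Blocks

/-! ### Complete reducibility -/

section CompleteReducibility

variable {K : Type*} [Group K] {V : Type*} [AddCommGroup V] [Module ℂ V]

theorem end_eq_sum [FiniteDimensional ℂ V] (A : Module.End ℂ V) :
    A = ∑ p : Fin (Module.finrank ℂ V) × Fin (Module.finrank ℂ V),
      (Module.finBasis ℂ V).coord p.1 (A (Module.finBasis ℂ V p.2)) •
        ((Module.finBasis ℂ V).coord p.2).smulRight (Module.finBasis ℂ V p.1) := by
  refine (Module.finBasis ℂ V).ext fun k => ?_
  rw [Fintype.sum_prod_type_right]
  conv_lhs => rw [← (Module.finBasis ℂ V).sum_repr (A (Module.finBasis ℂ V k))]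
  simp [Finsupp.single_apply, LinearMap.sum_apply]

/-- Local finiteness may be checked with an arbitrary finite index type. -/
theorem isFinContinuous_of_fintype [TopologicalSpace K] {U : Type*} [AddCommGroup U] [Module ℂ U]
    {π : Representation ℂ K U} (h : ∀ v : U, ∃ (ι : Type) (_ : Fintype ι) (c : ι → K → ℂ)
      (w : ι → U), (∀ k, Continuous (c k)) ∧ ∀ x, π x v = ∑ k, c k x • w k) :
    IsFinContinuous π := by
  intro v
  obtain ⟨ι, _, c, w, hc, hw⟩ := h v
  let e := Fintype.equivFin ι
  exact ⟨_, fun k => c (e.symm k), fun k => w (e.symm k), fun k => hc _, fun x => by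
    rw [hw]; exact (e.symm.sum_comp fun k => c k x • w k).symm⟩

theorem isFinContinuous_linHom [FiniteDimensional ℂ V] [TopologicalSpace K] [IsTopologicalGroup K]
    {ρ : Representation ℂ K V} (h : ∀ v (l : Module.Dual ℂ V), Continuous fun x => l (ρ x v)) :
    IsFinContinuous (Representation.linHom ρ ρ) := by
  refine isFinContinuous_of_fintype fun A => ?_
  let b := Module.finBasis ℂ V
  let ι := Fin (Module.finrank ℂ V) × Fin (Module.finrank ℂ V)
  let e : ι → Module.End ℂ V := fun p => (b.coord p.2).smulRight (b p.1)
  refine ⟨ι × ι, inferInstance,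
    fun p x => b.coord p.1.1 (ρ x (b p.1.2)) * b.coord p.2.1 (ρ x⁻¹ (b p.2.2)),
    fun p => e p.1 * A * e p.2, fun p => (h (b p.1.2) (b.coord p.1.1)).mul
      ((h (b p.2.2) (b.coord p.2.1)).comp continuous_inv), fun x => ?_⟩
  have : Representation.linHom ρ ρ x A = ρ x * A * ρ x⁻¹ := rfl
  rw [this]
  conv_lhs => rw [end_eq_sum (ρ x), end_eq_sum (ρ x⁻¹)]
  rw [Finset.sum_mul, Finset.sum_mul_sum]
  refine Eq.trans ?_ (Fintype.sum_prod_type (α₁ := ι) (α₂ := ι) _).symm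
  refine Finset.sum_congr rfl fun p _ => Finset.sum_congr rfl fun q _ => ?_
  rw [smul_mul_assoc, smul_mul_smul_comm]

/-- An invariant subspace of a continuous finite dimensional representation of a compact group is
the range of an equivariant projection. -/
theorem exists_invariant_projection [FiniteDimensional ℂ V] [TopologicalSpace K]
    [IsTopologicalGroup K] [CompactSpace K] {ρ : Representation ℂ K V}
    (h : ∀ v (l : Module.Dual ℂ V), Continuous fun x => l (ρ x v)) {W : Submodule ℂ V}
    (hW : ∀ g, ∀ w ∈ W, ρ g w ∈ W) :
    ∃ p : Module.End ℂ V, (∀ g v, p (ρ g v) = ρ g (p v)) ∧ (∀ v, p v ∈ W) ∧ ∀ w ∈ W, p w = w := by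
  obtain ⟨q, hq⟩ := W.exists_isCompl
  let p₀ : Module.End ℂ V := W.subtype ∘ₗ W.projectionOnto q hq
  obtain ⟨p, hp, hpp⟩ := (isFinContinuous_linHom h).exists_invariant p₀
  have hconj : ∀ x v, Representation.linHom ρ ρ x p₀ v = ρ x (p₀ (ρ x⁻¹ v)) := fun _ _ => rfl
  refine ⟨p, fun g v => ?_, fun v => ?_, fun w hw => ?_⟩
  · have := LinearMap.congr_fun (hp g) (ρ g v)
    change ρ g (p (ρ g⁻¹ (ρ g v))) = _ at this
    rw [← Module.End.mul_apply (ρ g⁻¹), ← map_mul, inv_mul_cancel, map_one,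
      Module.End.one_apply] at this
    exact this.symm
  · have := map_eq_of_sub_mem_span hpp (W.mkQ ∘ₗ LinearMap.applyₗ v) (u := 0) fun x => by
      rw [LinearMap.comp_apply, LinearMap.applyₗ_apply_apply, hconj, Submodule.mkQ_apply,
        Submodule.Quotient.mk_eq_zero]
      exact hW _ _ (W.projectionOnto q hq _).2
    rwa [LinearMap.comp_apply, LinearMap.applyₗ_apply_apply, Submodule.mkQ_apply,
      Submodule.Quotient.mk_eq_zero] at this
  · refine map_eq_of_sub_mem_span hpp (LinearMap.applyₗ w) fun x => ?_
    rw [LinearMap.applyₗ_apply_apply, hconj]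
    have e : p₀ (ρ x⁻¹ w) = ρ x⁻¹ w := by
      have := W.projectionOnto_apply_left hq ⟨_, hW x⁻¹ w hw⟩
      exact congrArg Subtype.val this
    rw [e, ← Module.End.mul_apply, ← map_mul, mul_inv_cancel, map_one, Module.End.one_apply]

end CompleteReducibility

/-! ### Representative functions are spanned by irreducible matrix elements -/

section PeterWeyl

variable {E : Type*} [NormedAddCommGroup E] [NormedSpace ℝ E] [CompleteSpace E]
    {G : Type*} [TopologicalSpace G] [ChartedSpace E G] [Group G] [LieGroup 𝓘(ℝ, E) ∞ G] {N : ℕ}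

variable (E G) in
/-- The matrix elements of irreducible representations of `G`. -/
def irrElements : Set (G → ℂ) :=
  {f | ∃ (σ : IrrRep E G) (v : _) (l : _), f = matrixElement σ.rep v l}

/-- Complete reducibility for matrix elements: induction on the dimension of a stable subspace `W`
containing the vector, which is split by an invariant projection unless `W` is irreducible. -/
theorem matrixElement_mem_span_irrElements [CompactSpace G] {V : Type*} [AddCommGroup V]
    [Module ℂ V] [FiniteDimensional ℂ V] {ρ : Representation ℂ G V} (hρ : IsSmoothRep 𝓘(ℝ, E) ρ)
    (v : V) (l : Module.Dual ℂ V) : matrixElement ρ v l ∈ Submodule.span ℂ (irrElements E G) := by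
  have : IsTopologicalGroup G := topologicalGroup_of_lieGroup 𝓘(ℝ, E) ∞
  suffices h : ∀ n, ∀ W : Submodule ℂ V, Module.finrank ℂ W ≤ n →
      (∀ g, ∀ w ∈ W, ρ g w ∈ W) → ∀ v ∈ W,
      matrixElement ρ v l ∈ Submodule.span ℂ (irrElements E G) from
    h _ ⊤ le_rfl (fun _ _ _ => trivial) v trivial
  intro n
  induction n with
  | zero =>
    intro W hn _ v hv
    have hW : W = ⊥ := Submodule.finrank_eq_zero.1 (Nat.le_zero.1 hn)
    rw [hW, Submodule.mem_bot] at hv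
    have : matrixElement ρ v l = 0 := funext fun g => by simp [matrixElement, hv]
    rw [this]
    exact zero_mem _
  | succ n ih =>
    intro W hn hW v hv
    by_cases hirr : ∀ W' ≤ W, (∀ g, ∀ w ∈ W', ρ g w ∈ W') → W' = ⊥ ∨ W' = W
    · by_cases h0 : v = 0
      · have : matrixElement ρ v l = 0 := funext fun g => by simp [matrixElement, h0]
        rw [this]
        exact zero_mem _
      let ρW : Representation ℂ G W :=
        (⟨W, fun g w hw => hW g w hw⟩ : Subrepresentation ρ).toRepresentation
      have hnt : Nontrivial W := ⟨⟨⟨v, hv⟩, 0, fun h => h0 (congrArg Subtype.val h)⟩⟩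
      have hρW : ρW.IsIrreducible := isIrreducible_of_stable fun U hU => by
        have hinj := Submodule.map_injective_of_injective W.injective_subtype
        refine (hirr (U.map W.subtype) (Submodule.map_subtype_le _ _) ?_).imp
          (fun h => hinj (h.trans (Submodule.map_bot _).symm))
          (fun h => hinj (h.trans (by rw [Submodule.map_top, Submodule.range_subtype])))
        rintro g _ ⟨w, hw, rfl⟩
        exact ⟨ρW g w, hU g w hw, rfl⟩
      have hsm : IsSmoothRep 𝓘(ℝ, E) ρW := fun w k => by
        obtain ⟨k', hk'⟩ := LinearMap.exists_extend k
        have : (fun g => k (ρW g w)) = fun g => k' (ρ g w) := funext fun g => by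
          rw [← hk']; rfl
        rw [this]
        exact hρ w k'
      let e := (Module.finBasis ℂ W).equivFun
      refine Submodule.subset_span ⟨⟨_, conjRep ρW e, isSmoothRep_conjRep hsm e,
        isIrreducible_conjRep hρW e⟩, e ⟨v, hv⟩,
        (l ∘ₗ W.subtype) ∘ₗ e.symm.toLinearMap, ?_⟩
      rw [← matrixElement_eq_of_equiv (ρ := ρW) (ρ' := conjRep ρW e) e
        (fun x v => by rw [conjRep_apply, e.symm_apply_apply])]
      rfl
    · push Not at hirr
      obtain ⟨W', hle, hW', hbot, hne⟩ := hirr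
      obtain ⟨p, hp, hpW, hpid⟩ := exists_invariant_projection
        (fun v l => (hρ v l).continuous) hW'
      have h1 := ih W' (Nat.le_of_lt_succ ((Submodule.finrank_lt_finrank_of_lt
        (lt_of_le_of_ne hle hne)).trans_le hn)) hW' (p v) (hpW v)
      have hlt : W ⊓ LinearMap.ker p < W := by
        refine lt_of_le_of_ne inf_le_left fun h => hbot ?_
        rw [eq_bot_iff]
        intro w hw
        have : w ∈ W ⊓ LinearMap.ker p := h.symm ▸ hle hw
        rw [Submodule.mem_bot, ← hpid w hw]
        exact this.2
      have h2 := ih (W ⊓ LinearMap.ker p) (Nat.le_of_lt_succ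
        ((Submodule.finrank_lt_finrank_of_lt hlt).trans_le hn))
        (fun g w hw => ⟨hW g w hw.1, by
          have hw2 : p w = 0 := hw.2
          rw [SetLike.mem_coe, LinearMap.mem_ker, hp, hw2, map_zero]⟩) (v - p v)
        ⟨W.sub_mem hv (hle (hpW v)), by
          rw [SetLike.mem_coe, LinearMap.mem_ker, map_sub, hpid _ (hpW v), sub_self]⟩
      have e : matrixElement ρ v l = matrixElement ρ (p v) l + matrixElement ρ (v - p v) l :=
        funext fun g => by simp [matrixElement]
      rw [e]
      exact add_mem h1 h2

/-- Functions of the `j`-th argument. -/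
def slotFun (j : Fin N) : (G → ℂ) →ₗ[ℂ] (Fin N → G) → ℂ :=
  LinearMap.funLeft ℂ ℂ fun g : Fin N → G => g j

/-- A matrix element of `G^N`, as a function of the arguments in `s`, is a sum of products of matrix
elements of `G`: the arguments are separated one at a time by inserting a basis. -/
theorem matrixElement_mem_prod [CompactSpace G] {d : ℕ}
    {ρ : Representation ℂ (Fin N → G) (Fin d → ℂ)} (hρ : IsSmoothRep (powModel E N) ρ)
    (v : Fin d → ℂ) (s : Finset (Fin N)) (l : Module.Dual ℂ (Fin d → ℂ)) :
    (fun g : Fin N → G => l (ρ (fun j => if j ∈ s then g j else 1) v)) ∈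
      ∏ j ∈ s, (Submodule.span ℂ (irrElements E G)).map (slotFun (N := N) j) := by
  induction s using Finset.induction_on generalizing l with
  | empty =>
    rw [Finset.prod_empty, Submodule.mem_one]
    refine ⟨l v, funext fun g => ?_⟩
    have : (fun j : Fin N => if j ∈ (∅ : Finset (Fin N)) then g j else 1) = 1 := by
      funext j; simp
    rw [this, map_one]
    rfl
  | insert j s hj ih =>
    rw [Finset.prod_insert hj]
    let b := Module.finBasis ℂ (Fin d → ℂ)
    have e : (fun g : Fin N → G => l (ρ (fun i => if i ∈ insert j s then g i else 1) v)) =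
        ∑ p : Fin (Module.finrank ℂ (Fin d → ℂ)) × Fin (Module.finrank ℂ (Fin d → ℂ)),
          slotFun j (fun x => b.coord p.1 (ρ (Pi.mulSingle j x) (b p.2))) *
            fun g => (l ∘ₗ (b.coord p.2).smulRight (b p.1))
              (ρ (fun i => if i ∈ s then g i else 1) v) := by
      funext g
      have hg : (fun i => if i ∈ insert j s then g i else 1) =
          Pi.mulSingle j (g j) * fun i => if i ∈ s then g i else 1 := by
        funext i
        by_cases hi : i = j
        · subst hi; simp [hj]
        · simp [hi]
      rw [hg, map_mul, Module.End.mul_apply, end_eq_sum (ρ (Pi.mulSingle j (g j))),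
        LinearMap.sum_apply, map_sum, Finset.sum_apply]
      refine Finset.sum_congr rfl fun p _ => ?_
      rw [LinearMap.smul_apply, map_smul]
      rfl
    rw [e]
    refine sum_mem fun p _ => Submodule.mul_mem_mul ⟨_, ?_, rfl⟩ (ih _)
    exact matrixElement_mem_span_irrElements
      (ρ := ρ.comp (MonoidHom.mulSingle (fun _ : Fin N => G) j))
      (fun v l => (hρ v l).comp (contMDiff_mulSingle E j)) _ _

/-- The algebraic part of the Peter–Weyl theorem for `G^N`. -/
theorem iSup_RGblock [CompactSpace G] : ⨆ ν, RGblock (G := G) (N := N) E ν = ⊤ := by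
  have hprod : (∏ j : Fin N, (Submodule.span ℂ (irrElements E G)).map (slotFun (N := N) j)) ≤
      (⨆ ν, RGblock E ν).map (RG E G N).subtype := by
    simp only [Submodule.map_span]
    rw [Submodule.prod_span, Submodule.span_le]
    intro f hf
    obtain ⟨m, hm, rfl⟩ := (Set.mem_fintype_prod _ _).1 hf
    choose m' hm' hmm using hm
    choose σ v l hσ using hm'
    let L : Module.Dual ℂ (⨂[ℂ] i, (Fin (σ i).dim → ℂ)) := PiTensorProduct.lift
      ((MultilinearMap.mkPiAlgebra ℂ (Fin N) ℂ).compLinearMap l)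
    refine ⟨matrixLin σ L (PiTensorProduct.tprod ℂ v), ?_, funext fun g => ?_⟩
    · refine Submodule.mem_iSup_of_mem (fun i => ⟦σ i⟧) ?_
      exact Submodule.subset_span ⟨σ, fun _ => rfl, PiTensorProduct.tprod ℂ v, L, rfl⟩
    · change (matrixLin σ L (PiTensorProduct.tprod ℂ v)).1 g = _
      rw [matrixLin_apply, extTensor_tprod, PiTensorProduct.lift.tprod, Finset.prod_apply]
      simp only [MultilinearMap.compLinearMap_apply, MultilinearMap.mkPiAlgebra_apply]
      refine Finset.prod_congr rfl fun i _ => ?_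
      rw [← hmm, hσ]
      rfl
  rw [eq_top_iff]
  rintro ⟨f, hf⟩ -
  suffices h : f ∈ (⨆ ν, RGblock E ν).map (RG E G N).subtype by
    obtain ⟨f', hf', h⟩ := h
    rwa [← show f' = ⟨f, hf⟩ from Subtype.ext h]
  induction hf using Submodule.span_induction with
  | mem f hf =>
    obtain ⟨d, ρ, hρ, v, l, rfl⟩ := hf
    have e : matrixElement ρ v l =
        fun g => l (ρ (fun j => if j ∈ (Finset.univ : Finset (Fin N)) then g j else 1) v) := by
      funext g
      simp [matrixElement]
    rw [e]
    exact hprod (matrixElement_mem_prod hρ v Finset.univ l)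
  | zero => exact zero_mem _
  | add f g _ _ hf hg => exact add_mem hf hg
  | smul a f _ hf => exact Submodule.smul_mem _ a hf

end PeterWeyl

/-! ### Averaging over the gauge group -/

section GaugeAverage

variable {E : Type*} [NormedAddCommGroup E] [NormedSpace ℝ E] [CompleteSpace E]
    {G : Type*} [TopologicalSpace G] [ChartedSpace E G] [Group G] [LieGroup 𝓘(ℝ, E) ∞ G] {N : ℕ}
    [NeZero N]

variable (E G N) in
/-- The gauge action on `(U𝔤 ⊗ U𝔤)^{⊗N}` as a representation. -/
def gaugeAdRep : Representation ℂ (Fin N → G) (⨂[ℂ] _ : Fin N, UgUg E G) where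
  toFun h := (gaugeAd E h).toLinearMap
  map_one' := by
    have hS : AlgHom.equalizer (gaugeAd E (1 : Fin N → G)) (AlgHom.id ℂ _) = ⊤ :=
      tensorUg_subalgebra_eq_top
        (fun j v => by
          have e : adUg ((1 : Fin N → G) j) v = v := LinearMap.congr_fun (map_one (adRep E G)) v
          rw [AlgHom.mem_equalizer, gaugeAd_inL, e]; rfl)
        (fun j v => by
          have e : adUg ((1 : Fin N → G) (j + 1)) v = v :=
            LinearMap.congr_fun (map_one (adRep E G)) v
          rw [AlgHom.mem_equalizer, gaugeAd_inR, e]; rfl)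
    refine LinearMap.ext fun u => ?_
    have hu : u ∈ AlgHom.equalizer (gaugeAd E (1 : Fin N → G)) (AlgHom.id ℂ _) :=
      hS ▸ Algebra.mem_top
    exact hu
  map_mul' g h := by
    have hS : AlgHom.equalizer (gaugeAd E (g * h)) ((gaugeAd E g).comp (gaugeAd E h)) = ⊤ :=
      tensorUg_subalgebra_eq_top
        (fun j v => by
          have e : adUg ((g * h) j) v = adUg (g j) (adUg (h j) v) :=
            LinearMap.congr_fun (map_mul (adRep E G) (g j) (h j)) v
          rw [AlgHom.mem_equalizer, AlgHom.comp_apply, gaugeAd_inL, gaugeAd_inL, gaugeAd_inL, e])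
        (fun j v => by
          have e : adUg ((g * h) (j + 1)) v = adUg (g (j + 1)) (adUg (h (j + 1)) v) :=
            LinearMap.congr_fun (map_mul (adRep E G) (g (j + 1)) (h (j + 1))) v
          rw [AlgHom.mem_equalizer, AlgHom.comp_apply, gaugeAd_inR, gaugeAd_inR, gaugeAd_inR, e])
    refine LinearMap.ext fun u => ?_
    have hu : u ∈ AlgHom.equalizer (gaugeAd E (g * h)) ((gaugeAd E g).comp (gaugeAd E h)) :=
      hS ▸ Algebra.mem_top
    exact hu

theorem smul_mul_smul_algebra {B : Type*} [Ring B] [Algebra ℂ B] (a b : ℂ) (x y : B) :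
    (a • x) * (b • y) = (a * b) • (x * y) := smul_mul_smul_comm a x b y

/-- The gauge action on `(U𝔤 ⊗ U𝔤)^{⊗N}` is locally finite and continuous, so that averaging over
`G^N` applies to it. -/
theorem isFinContinuous_gaugeAdRep [FiniteDimensional ℝ E] :
    IsFinContinuous (gaugeAdRep E G N) := by
  let S : Subalgebra ℂ (⨂[ℂ] _ : Fin N, UgUg E G) :=
    { carrier := {u | ∃ (ι : Type) (_ : Fintype ι) (c : ι → (Fin N → G) → ℂ)
        (w : ι → ⨂[ℂ] _ : Fin N, UgUg E G), (∀ k, Continuous (c k)) ∧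
          ∀ h, gaugeAd E h u = ∑ k, c k h • w k}
      mul_mem' := by
        rintro u v ⟨ι, _, c, w, hc, hw⟩ ⟨ι', _, c', w', hc', hw'⟩
        refine ⟨ι × ι', inferInstance, fun k h => c k.1 h * c' k.2 h, fun k => w k.1 * w' k.2,
          fun k => (hc k.1).mul (hc' k.2), fun h => ?_⟩
        rw [map_mul, hw, hw', Finset.sum_mul_sum, Fintype.sum_prod_type]
        exact Finset.sum_congr rfl fun i _ => Finset.sum_congr rfl fun j _ =>
          smul_mul_smul_algebra (c i h) (c' j h) (w i) (w' j)
      add_mem' := by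
        rintro u v ⟨ι, _, c, w, hc, hw⟩ ⟨ι', _, c', w', hc', hw'⟩
        refine ⟨ι ⊕ ι', inferInstance, Sum.elim c c', Sum.elim w w',
          fun k => ?_, fun h => ?_⟩
        · rcases k with k | k
          · exact hc k
          · exact hc' k
        · rw [map_add, hw, hw', Fintype.sum_sum_type]
          rfl
      algebraMap_mem' := fun a => ⟨Unit, inferInstance, fun _ _ => a, fun _ => 1,
        fun _ => continuous_const, fun h => by
        rw [AlgHom.commutes, Algebra.algebraMap_eq_smul_one]
        simp⟩ }
  have hS : S = ⊤ := tensorUg_subalgebra_eq_top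
    (fun j v => by
      obtain ⟨d, c, w, hc, hw⟩ := (isFinSmooth_adRep (E := E) (G := G)).isFinContinuous v
      refine ⟨Fin d, inferInstance, fun k h => c k (h j), fun k => inL j (w k),
        fun k => (hc k).comp (continuous_apply j), fun h => ?_⟩
      rw [gaugeAd_inL, ← adRep_apply, hw, map_sum]
      exact Finset.sum_congr rfl fun k _ => map_smul _ _ _)
    (fun j v => by
      obtain ⟨d, c, w, hc, hw⟩ := (isFinSmooth_adRep (E := E) (G := G)).isFinContinuous v
      refine ⟨Fin d, inferInstance, fun k h => c k (h (j + 1)), fun k => inR j (w k),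
        fun k => (hc k).comp (continuous_apply (j + 1)), fun h => ?_⟩
      rw [gaugeAd_inR, ← adRep_apply, hw, map_sum]
      exact Finset.sum_congr rfl fun k _ => map_smul _ _ _)
  refine isFinContinuous_of_fintype fun u => ?_
  have hu : u ∈ S := hS ▸ Algebra.mem_top
  exact hu

/-- An element of `(U𝔤 ⊗ U𝔤)^{⊗N}` fixed by the gauge action has a gauge invariant class in the
balanced tensor product. -/
theorem mem_gaugeInvariants {u : ⨂[ℂ] _ : Fin N, UgUg E G} (hu : ∀ h, gaugeAd E h u = u) :
    u ∈ gaugeInvariants E G N := Algebra.mem_iInf.2 fun h => by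
  rw [AlgHom.mem_equalizer, AlgHom.comp_apply, hu]

/-- Elements whose class is gauge invariant may fail to be gauge invariant themselves, but they act
on `𝓡(G^N)` like their gauge transforms. -/
theorem momentMap_gaugeAd [FiniteDimensional ℝ E] [ConnectedSpace G]
    {u : ⨂[ℂ] _ : Fin N, UgUg E G} (hu : u ∈ gaugeInvariants E G N)
    (h : Fin N → G) : momentMap E G N (gaugeAd E h u) = momentMap E G N u :=
  LinearMap.ext fun f => toSmoothLin_injective (by
    rw [toSmoothLin_momentMap, toSmoothLin_momentMap, smoothAction_gaugeAd hu])

end GaugeAverage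

/-! ### Coefficients of elements of a tensor product -/

section Contraction

variable {X Y W : Type*} [AddCommGroup X] [Module ℂ X] [AddCommGroup Y] [Module ℂ Y]
    [AddCommGroup W] [Module ℂ W]

variable (X) in
/-- The contraction `x ⊗ w ↦ l(w) x` with a functional `l`. -/
def contract (l : Module.Dual ℂ W) : X ⊗[ℂ] W →ₗ[ℂ] X :=
  TensorProduct.lift ((LinearMap.lsmul ℂ X).flip.compl₂ l)

theorem contract_tmul (l : Module.Dual ℂ W) (x : X) (w : W) :
    contract X l (x ⊗ₜ[ℂ] w) = l w • x := by
  simp [contract]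

theorem contract_add (l l' : Module.Dual ℂ W) :
    contract X (l + l') = contract X l + contract X l' :=
  TensorProduct.ext' fun x w => by
    rw [LinearMap.add_apply, contract_tmul, contract_tmul, contract_tmul, LinearMap.add_apply,
      add_smul]

theorem contract_smul (a : ℂ) (l : Module.Dual ℂ W) : contract X (a • l) = a • contract X l :=
  TensorProduct.ext' fun x w => by
    rw [LinearMap.smul_apply, contract_tmul, contract_tmul, LinearMap.smul_apply, smul_assoc]

theorem contract_map (l : Module.Dual ℂ W) (S : X →ₗ[ℂ] Y) (C : W →ₗ[ℂ] W) (f : X ⊗[ℂ] W) :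
    contract Y l (TensorProduct.map S C f) = S (contract X (l ∘ₗ C) f) := by
  have h : contract Y l ∘ₗ TensorProduct.map S C = S ∘ₗ contract X (l ∘ₗ C) :=
    TensorProduct.ext' fun x w => by
      rw [LinearMap.comp_apply, LinearMap.comp_apply, TensorProduct.map_tmul, contract_tmul,
        contract_tmul, map_smul, LinearMap.comp_apply]
  exact LinearMap.congr_fun h f

theorem contract_rTensor (l : Module.Dual ℂ W) (S : X →ₗ[ℂ] Y) (f : X ⊗[ℂ] W) :
    contract Y l (S.rTensor W f) = S (contract X l f) :=
  contract_map l S LinearMap.id f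

/-- The coefficients of an element of `X ⊗ W` as a linear map on functionals. -/
def coeffMap (S : Submodule ℂ X) (f : X ⊗[ℂ] W) (hf : ∀ l, contract X l f ∈ S) :
    Module.Dual ℂ W →ₗ[ℂ] S where
  toFun l := ⟨contract X l f, hf l⟩
  map_add' l l' := Subtype.ext (LinearMap.congr_fun (contract_add l l') f)
  map_smul' a l := Subtype.ext (LinearMap.congr_fun (contract_smul a l) f)

theorem exists_leftInverse_coeffMap {S : Submodule ℂ X} {f : X ⊗[ℂ] W}
    (hf : ∀ l, contract X l f ∈ S) (h : ∀ l : Module.Dual ℂ W, contract X l f = 0 → l = 0) :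
    ∃ g : S →ₗ[ℂ] Module.Dual ℂ W, ∀ l, g (coeffMap S f hf l) = l := by
  obtain ⟨g, hg⟩ := (coeffMap S f hf).exists_leftInverse_of_injective
    (LinearMap.ker_eq_bot'.2 fun l hl => h l (congrArg Subtype.val hl))
  exact ⟨g, LinearMap.congr_fun hg⟩

variable [FiniteDimensional ℂ W]

/-- An element of `X ⊗ W` is the sum of its coefficients with respect to a basis of `W`. -/
theorem sum_contract_tmul (f : X ⊗[ℂ] W) :
    ∑ k, contract X ((Module.finBasis ℂ W).coord k) f ⊗ₜ[ℂ] Module.finBasis ℂ W k = f := by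
  let b := Module.finBasis ℂ W
  have h : ∑ k, (TensorProduct.mk ℂ X W).flip (b k) ∘ₗ contract X (b.coord k) = LinearMap.id :=
    TensorProduct.ext' fun x w => by
      rw [LinearMap.id_apply, LinearMap.sum_apply]
      conv_rhs => rw [← b.sum_repr w, TensorProduct.tmul_sum]
      refine Finset.sum_congr rfl fun k _ => ?_
      rw [LinearMap.comp_apply, contract_tmul, LinearMap.flip_apply, TensorProduct.mk_apply,
        TensorProduct.tmul_smul, TensorProduct.smul_tmul', Module.Basis.coord_apply]
  have := LinearMap.congr_fun h f
  rw [LinearMap.id_apply, LinearMap.sum_apply] at this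
  exact this

theorem ext_contract {f f' : X ⊗[ℂ] W} (h : ∀ l, contract X l f = contract X l f') : f = f' := by
  rw [← sum_contract_tmul f, ← sum_contract_tmul f']
  simp only [h]

theorem mem_range_rTensor_iff {S : Submodule ℂ X} {f : X ⊗[ℂ] W} :
    f ∈ LinearMap.range (S.subtype.rTensor W) ↔ ∀ l, contract X l f ∈ S := by
  constructor
  · rintro ⟨f, rfl⟩ l
    rw [contract_rTensor]
    exact Subtype.prop _
  · intro h
    rw [← sum_contract_tmul f]
    refine sum_mem fun k _ => ⟨(⟨contract X ((Module.finBasis ℂ W).coord k) f, h _⟩ : S) ⊗ₜ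
      Module.finBasis ℂ W k, ?_⟩
    rw [LinearMap.rTensor_tmul]
    rfl

theorem finiteDimensional_range_rTensor (S : Submodule ℂ X) [FiniteDimensional ℂ S] :
    FiniteDimensional ℂ (LinearMap.range (S.subtype.rTensor W)) :=
  inferInstance

theorem iSup_range_rTensor {ι : Type*} {S : ι → Submodule ℂ X} (hS : ⨆ i, S i = ⊤) :
    ⨆ i, LinearMap.range ((S i).subtype.rTensor W) = ⊤ := by
  rw [eq_top_iff]
  rintro f -
  rw [← sum_contract_tmul f]
  refine sum_mem fun k _ => ?_
  let T : X →ₗ[ℂ] X ⊗[ℂ] W := (TensorProduct.mk ℂ X W).flip (Module.finBasis ℂ W k)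
  have hle : ⨆ i, S i ≤ (⨆ i, LinearMap.range ((S i).subtype.rTensor W)).comap T :=
    iSup_le fun i x hx => Submodule.mem_iSup_of_mem i
      ⟨(⟨x, hx⟩ : S i) ⊗ₜ _, LinearMap.rTensor_tmul _ _ _ _⟩
  exact hle (hS ▸ Submodule.mem_top)

end Contraction

/-! ### Vector-valued representative functions -/

section VectorValued

variable {E : Type*} [NormedAddCommGroup E] [NormedSpace ℝ E] [CompleteSpace E]
    {G : Type*} [TopologicalSpace G] [ChartedSpace E G] [Group G] [LieGroup 𝓘(ℝ, E) ∞ G] {N : ℕ}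
    [NeZero N]
    {V : Fin N → Type*} [∀ i, AddCommGroup (V i)] [∀ i, Module ℂ (V i)]
    {π : ∀ i, Representation ℂ G (V i)}

variable (E G) in
/-- The coefficient function of a vector-valued function with respect to a functional `l`. -/
def contr (l : Module.Dual ℂ (⨂[ℂ] i, V i)) : RGV E G V →ₗ[ℂ] RG E G N :=
  contract (RG E G N) l

theorem contr_add (l l' : Module.Dual ℂ (⨂[ℂ] i, V i)) (f : RGV E G V) :
    contr E G (l + l') f = contr E G l f + contr E G l' f :=
  LinearMap.congr_fun (contract_add l l') f

theorem contr_smul (a : ℂ) (l : Module.Dual ℂ (⨂[ℂ] i, V i)) (f : RGV E G V) :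
    contr E G (a • l) f = a • contr E G l f :=
  LinearMap.congr_fun (contract_smul a l) f

theorem contr_actV (l : Module.Dual ℂ (⨂[ℂ] i, V i)) (T : Module.End ℂ (RG E G N))
    (f : RGV E G V) : contr E G l (actV E G V T f) = T (contr E G l f) :=
  contract_rTensor l T f

theorem contr_gaugeRepV (l : Module.Dual ℂ (⨂[ℂ] i, V i)) (h : Fin N → G) (f : RGV E G V) :
    contr E G l (gaugeRepV E π h f) = gaugeRep E h (contr E G (l ∘ₗ extTensor π h) f) :=
  contract_map l (gaugeRep E h) (extTensor π h) f

variable [∀ i, FiniteDimensional ℂ (V i)]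

theorem ext_contr {f f' : RGV E G V} (h : ∀ l, contr E G l f = contr E G l f') : f = f' :=
  ext_contract h

/-- A vector-valued function lies in the block of `ν` exactly when all its coefficient
functions do. -/
theorem mem_RGVblock_iff {ν : Fin N → IrrClass E G} {f : RGV E G V} :
    f ∈ RGVblock E V ν ↔ ∀ l, contr E G l f ∈ RGblock E ν :=
  mem_range_rTensor_iff

instance finiteDimensional_RGVblock (ν : Fin N → IrrClass E G) :
    FiniteDimensional ℂ (RGVblock E V ν) :=
  finiteDimensional_range_rTensor (RGblock E ν)

theorem actV_momentMap_mem_RGVblock {ν : Fin N → IrrClass E G} {f : RGV E G V}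
    (hf : f ∈ RGVblock E V ν) (u : ⨂[ℂ] _ : Fin N, UgUg E G) :
    actV E G V (momentMap E G N u) f ∈ RGVblock E V ν := by
  rw [mem_RGVblock_iff] at hf ⊢
  intro l
  rw [contr_actV]
  exact momentMap_mem_RGblock ν u (hf l)

theorem gaugeRepV_mem_RGVblock {ν : Fin N → IrrClass E G} {f : RGV E G V}
    (hf : f ∈ RGVblock E V ν) (h : Fin N → G) : gaugeRepV E π h f ∈ RGVblock E V ν := by
  rw [mem_RGVblock_iff] at hf ⊢
  intro l
  rw [contr_gaugeRepV]
  exact biTrans_mem_RGblock ν _ (hf _)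

theorem iSup_RGVblock [CompactSpace G] : ⨆ ν, RGVblock (G := G) E V ν = ⊤ :=
  iSup_range_rTensor (iSup_RGblock (G := G) (N := N))

variable [FiniteDimensional ℝ E] [ConnectedSpace G]

theorem gaugeRepV_actV (h : Fin N → G) (u : ⨂[ℂ] _ : Fin N, UgUg E G) (f : RGV E G V) :
    gaugeRepV E π h (actV E G V (momentMap E G N u) f) =
      actV E G V (momentMap E G N (gaugeAd E h u)) (gaugeRepV E π h f) := by
  refine ext_contr fun l => ?_
  rw [contr_gaugeRepV, contr_actV, contr_actV, contr_gaugeRepV, gaugeRep_momentMap]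

theorem actV_momentR {ν : Fin N → IrrClass E G} {f : RGV E G V} (hf : f ∈ RGVblock E V ν)
    (p : Fin N × Subalgebra.center ℂ (Ug E G)) :
    actV E G V (momentR E p.1 p.2.1) f = blockChar ν p • f := by
  refine ext_contr fun l => ?_
  rw [contr_actV, map_smul, momentR_apply_RGblock p (mem_RGVblock_iff.1 hf l)]

theorem iSupIndep_RGVblock [CompactSpace G] :
    iSupIndep fun ν : Fin N → IrrClass E G => RGVblock E V ν :=
  iSupIndep_of_apply_eq_smul (M := RGV E G V) (W := fun ν => RGVblock E V ν)
    (fun p : Fin N × Subalgebra.center ℂ (Ug E G) => actV E G V (momentR E p.1 p.2.1))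
    blockChar blockChar_injective fun _ p _ hf => actV_momentR hf p

/-- The coefficient functions of a nonzero invariant vector-valued function are linearly
independent, since the target is an irreducible representation. -/
theorem contr_injective (hirr : ∀ i, (π i).IsIrreducible) {f : RGV E G V} (hf : f ∈ Rmu E π)
    (h0 : f ≠ 0) {l : Module.Dual ℂ (⨂[ℂ] i, V i)} (hl : contr E G l f = 0) : l = 0 := by
  by_contra hl0
  -- the functionals annihilating `f` form a subspace stable under all operators
  let B : Subalgebra ℂ (Module.End ℂ (⨂[ℂ] i, V i)) :=
    { carrier := {C | ∀ l, contr E G l f = 0 → contr E G (l ∘ₗ C) f = 0}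
      mul_mem' := fun {C D} hC hD l hl => hD (l ∘ₗ C) (hC l hl)
      add_mem' := fun {C D} hC hD l hl => by
        rw [LinearMap.comp_add, contr_add, hC l hl, hD l hl, add_zero]
      algebraMap_mem' := fun a l hl => by
        have e : l ∘ₗ algebraMap ℂ (Module.End ℂ (⨂[ℂ] i, V i)) a = a • l := by
          ext; simp
        rw [e, contr_smul, hl, smul_zero] }
  have hB : B = ⊤ := subalgebra_extTensor_eq_top hirr fun h l hl => by
    have e := contr_gaugeRepV (π := π) l h f
    rw [hf h, hl] at e
    have e2 := congrArg (gaugeRep E h⁻¹) e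
    rw [map_zero, ← Module.End.mul_apply, ← map_mul, inv_mul_cancel, map_one,
      Module.End.one_apply] at e2
    exact e2.symm
  obtain ⟨w, hw⟩ : ∃ w, l w ≠ 0 := by
    by_contra! h
    exact hl0 (LinearMap.ext h)
  refine h0 (ext_contr fun k => ?_)
  rw [map_zero]
  have hC : (k.smulRight ((l w)⁻¹ • w) : Module.End ℂ (⨂[ℂ] i, V i)) ∈ B := hB ▸ Algebra.mem_top
  have e : l ∘ₗ k.smulRight ((l w)⁻¹ • w) = k := by
    ext; simp [hw]
  have := hC l hl
  rwa [e] at this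

/-- Gauge invariant elements of `(U𝔤 ⊗ U𝔤)^{⊗N}` act transitively on the nonzero elements of a
block. Some element `u₀` maps the first vector to the second because its coefficient functions are
linearly independent; the average of `u₀` over the gauge group does the same. -/
theorem exists_gaugeInvariant_apply_eq [CompactSpace G] (hirr : ∀ i, (π i).IsIrreducible)
    {ν : Fin N → IrrClass E G} {f f' : RGV E G V} (hf : f ∈ Rmu E π) (hf' : f' ∈ Rmu E π)
    (hfν : f ∈ RGVblock E V ν) (hfν' : f' ∈ RGVblock E V ν) (h0 : f ≠ 0) :
    ∃ u ∈ gaugeInvariants E G N, actV E G V (momentMap E G N u) f = f' := by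
  rw [mem_RGVblock_iff] at hfν hfν'
  obtain ⟨g, hg⟩ := exists_leftInverse_coeffMap (S := RGblock E ν) hfν fun l hl =>
    contr_injective hirr hf h0 hl
  -- an operator on `𝓡^{(ν)}(G^N)` taking the coefficients of `f` to those of `f'`
  obtain ⟨u₀, hu₀⟩ := exists_momentMap_eq ν (coeffMap (RGblock E ν) f' hfν' ∘ₗ g)
  have h1 : actV E G V (momentMap E G N u₀) f = f' := by
    refine ext_contr fun l => ?_
    have e := hu₀ (coeffMap (RGblock E ν) f hfν l)
    rw [LinearMap.comp_apply, hg] at e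
    rw [contr_actV]
    exact e
  have : IsTopologicalGroup G := topologicalGroup_of_lieGroup 𝓘(ℝ, E) ∞
  obtain ⟨u, hu, huu⟩ := (isFinContinuous_gaugeAdRep (E := E) (G := G) (N := N)).exists_invariant u₀
  refine ⟨u, mem_gaugeInvariants hu, ?_⟩
  -- all gauge transforms of `u₀` map `f` to `f'`, since both are invariant
  refine map_eq_of_sub_mem_span huu (LinearMap.applyₗ f ∘ₗ (actV E G V).toLinearMap ∘ₗ
    (momentMap E G N).toLinearMap) fun h => ?_
  have e := gaugeRepV_actV (π := π) h u₀ f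
  rw [h1, hf h, hf' h] at e
  exact e.symm

end VectorValued

/-! ### Joint eigenspaces and transitive algebras -/

section MultiplicityFree

variable {M : Type*} [AddCommGroup M] [Module ℂ M] {W : Submodule ℂ M}
    {I J : Subalgebra ℂ (Module.End ℂ M)}

theorem inducedOps_mono (h : I ≤ J) : inducedOps I W ≤ inducedOps J W := by
  rintro T ⟨b, hb, hT⟩
  exact ⟨b, h hb, hT⟩

theorem isIrreducibleSubmodule_of_transitive (hs : IsStable J W) (h0 : W ≠ ⊥)
    (ht : ∀ f ∈ W, ∀ f' ∈ W, f ≠ 0 → ∃ T ∈ J, T f = f') : IsIrreducibleSubmodule J W := by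
  refine ⟨hs, h0, fun W' hle hW' => ?_⟩
  by_cases hb : W' = ⊥
  · exact Or.inl hb
  obtain ⟨f, hf, hf0⟩ := W'.ne_bot_iff.1 hb
  refine Or.inr (le_antisymm hle fun f' hf' => ?_)
  obtain ⟨T, hT, rfl⟩ := ht f (hle hf) f' hf' hf0
  exact hW' T hT f hf

/-- An algebra acting transitively on the nonzero vectors of `W` induces all operators on `W`, by
Burnside's theorem. -/
theorem inducedOps_eq_top [FiniteDimensional ℂ W] (hs : IsStable J W)
    (ht : ∀ f ∈ W, ∀ f' ∈ W, f ≠ 0 → ∃ T ∈ J, T f = f') : inducedOps J W = ⊤ := by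
  refine subalgebra_end_eq_top fun W' hW' => ?_
  by_cases hb : W' = ⊥
  · exact Or.inl hb
  obtain ⟨f, hf, hf0⟩ := W'.ne_bot_iff.1 hb
  refine Or.inr (eq_top_iff.2 fun f' _ => ?_)
  obtain ⟨T, hT, hTf⟩ := ht f f.2 f' f'.2 fun h => hf0 (Subtype.ext h)
  have := hW' (T.restrict fun w hw => hs T hT w hw) ⟨T, hT, fun _ => rfl⟩ f hf
  have e : (T.restrict fun w hw => hs T hT w hw) f = f' := Subtype.ext hTf
  rwa [e] at this

/-- An algebra that preserves `W` and commutes with an algebra inducing all operators on `W` acts on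
`W` through a character. -/
theorem exists_character (hs : IsStable I W) (h0 : W ≠ ⊥) (hJ : inducedOps J W = ⊤)
    (hIJ : ∀ S ∈ I, ∀ T ∈ J, Commute S T) :
    ∃ χ : I →ₐ[ℂ] ℂ, ∀ T : I, ∀ f ∈ W, T.1 f = χ T • f := by
  obtain ⟨f₀, hf₀, hne⟩ := W.ne_bot_iff.1 h0
  have h : ∀ T : I, ∃ c : ℂ, ∀ f ∈ W, T.1 f = c • f := by
    intro T
    obtain ⟨c, hc⟩ := exists_eq_smul_of_commute
      (T := (T.1.restrict fun w hw => hs T.1 T.2 w hw : Module.End ℂ W)) fun S => by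
        obtain ⟨b, hb, hS⟩ : S ∈ inducedOps J W := hJ ▸ Algebra.mem_top
        refine LinearMap.ext fun w => Subtype.ext ?_
        rw [Module.End.mul_apply, Module.End.mul_apply, hS, LinearMap.coe_restrict_apply,
          LinearMap.coe_restrict_apply, hS]
        exact (LinearMap.congr_fun (hIJ T.1 T.2 b hb).eq w.1).symm
    refine ⟨c, fun f hf => ?_⟩
    exact congrArg Subtype.val (LinearMap.congr_fun hc ⟨f, hf⟩)
  choose c hc using h
  have huniq : ∀ a b : ℂ, a • f₀ = b • f₀ → a = b := fun a b h => smul_left_injective ℂ hne h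
  refine ⟨AlgHom.ofLinearMap
    { toFun := c
      map_add' := fun S T => huniq _ _ ?_
      map_smul' := fun a T => huniq _ _ ?_ } (huniq _ _ ?_) fun S T => huniq _ _ ?_, hc⟩
  · rw [← hc _ f₀ hf₀, add_smul, ← hc S f₀ hf₀, ← hc T f₀ hf₀]
    rfl
  · rw [← hc _ f₀ hf₀, RingHom.id_apply, smul_eq_mul, mul_smul, ← hc T f₀ hf₀]
    rfl
  · change c 1 • f₀ = _
    rw [← hc _ f₀ hf₀, one_smul]
    rfl
  · change c (S * T) • f₀ = (c S * c T) • f₀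
    rw [← hc _ f₀ hf₀, mul_smul, ← hc T f₀ hf₀, ← hc S _ (hs T.1 T.2 f₀ hf₀)]
    rfl

variable {κ ι : Type*} {B : κ → Submodule ℂ M} {T : ι → Module.End ℂ M} {χ : κ → ι → ℂ}

/-- If the subspaces `B k` span and the operators `T i` act on them by pairwise different systems of
scalars, then each `B k` is the full joint eigenspace. -/
theorem mem_of_forall_apply_eq_smul (hχ : Function.Injective χ)
    (h : ∀ k i, ∀ w ∈ B k, T i w = χ k i • w) (htop : ⨆ k, B k = ⊤) {k : κ} {f : M}
    (hf : ∀ i, T i f = χ k i • f) : f ∈ B k := by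
  classical
  have hind := iSupIndep_of_apply_eq_smul T χ hχ h
  rw [iSupIndep_iff_finsetSum_eq_zero_imp_eq_zero] at hind
  obtain ⟨F, hF, hsum⟩ := (Submodule.mem_iSup_iff_exists_finsupp B f).1
    (htop ▸ Submodule.mem_top)
  have hz : ∀ l ∈ F.support, l ≠ k → F l = 0 := by
    intro l hl hlk
    obtain ⟨i, hi⟩ : ∃ i, χ l i ≠ χ k i := by
      by_contra! hne
      exact hlk (hχ (funext hne))
    -- apply `T i - χ k i` to the decomposition of `f`
    have h1 : ∑ m ∈ F.support, (χ m i - χ k i) • F m = 0 := by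
      have h2 := hf i
      rw [← hsum, Finsupp.sum, map_sum, Finset.smul_sum, ← sub_eq_zero,
        ← Finset.sum_sub_distrib] at h2
      rw [← h2]
      exact Finset.sum_congr rfl fun m _ => by rw [h m i _ (hF m), sub_smul]
    exact (smul_eq_zero.1 (hind F.support _ (fun m _ => Submodule.smul_mem _ _ (hF m)) h1 l
      hl)).resolve_left (sub_ne_zero.2 hi)
  rw [← hsum]
  refine sum_mem fun l hl => ?_
  by_cases hlk : l = k
  · exact hlk ▸ hF l
  · change F l ∈ B k
    rw [hz l hl hlk]
    exact zero_mem _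

/-- The invariants of a direct sum of stable subspaces are the direct sum of their invariants. -/
theorem iSup_comap_invariants {K : Type*} [Group K] {ρ : Representation ℂ K M}
    (hind : iSupIndep B) (htop : ⨆ k, B k = ⊤) (hρ : ∀ k g, ∀ w ∈ B k, ρ g w ∈ B k) :
    ⨆ k, (B k).comap ρ.invariants.subtype = ⊤ := by
  classical
  rw [eq_top_iff]
  rintro f -
  rw [iSupIndep_iff_finsetSum_eq_zero_imp_eq_zero] at hind
  obtain ⟨F, hF, hsum⟩ := (Submodule.mem_iSup_iff_exists_finsupp B f.1).1
    (htop ▸ Submodule.mem_top)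
  have hinv : ∀ k, F k ∈ ρ.invariants := by
    intro k g
    by_cases hk : k ∈ F.support
    · have h1 : ∑ l ∈ F.support, (ρ g (F l) - F l) = 0 := by
        have h2 := f.2 g
        rw [← hsum, Finsupp.sum, map_sum, ← sub_eq_zero, ← Finset.sum_sub_distrib] at h2
        exact h2
      exact sub_eq_zero.1 (hind F.support _
        (fun l _ => sub_mem (hρ l g _ (hF l)) (hF l)) h1 k hk)
    · rw [Finsupp.notMem_support_iff.1 hk, map_zero]
  have e : f = ∑ k ∈ F.support, (⟨F k, hinv k⟩ : ρ.invariants) := by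
    refine Subtype.ext ?_
    rw [AddSubmonoidClass.coe_finsetSum]
    exact hsum.symm
  rw [e]
  exact sum_mem fun k _ => Submodule.mem_iSup_of_mem k (hF k)

end MultiplicityFree

/-! ### Quantum Hamiltonians and quantum integrals on the blocks -/

section Blocks

variable {E : Type*} [NormedAddCommGroup E] [NormedSpace ℝ E] [CompleteSpace E]
    {G : Type*} [TopologicalSpace G] [ChartedSpace E G] [Group G] [LieGroup 𝓘(ℝ, E) ∞ G] {N : ℕ}
    [NeZero N]
    {V : Fin N → Type*} [∀ i, AddCommGroup (V i)] [∀ i, Module ℂ (V i)]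
    {π : ∀ i, Representation ℂ G (V i)}

theorem mem_Jmu {T : Module.End ℂ (Rmu E π)} :
    T ∈ Jmu E π ↔ ∃ u ∈ gaugeInvariants E G N, ∀ f : Rmu E π,
      (T f : RGV E G V) = actV E G V (momentMap E G N u) f := by
  constructor
  · rintro ⟨_, ⟨_, ⟨u, hu, rfl⟩, rfl⟩, h⟩
    exact ⟨u, hu, h⟩
  · rintro ⟨u, hu, h⟩
    exact ⟨_, ⟨_, ⟨u, hu, rfl⟩, rfl⟩, h⟩

theorem mem_Imu {T : Module.End ℂ (Rmu E π)} :
    T ∈ Imu E π ↔ ∃ u ∈ centerLeft E G N, ∀ f : Rmu E π,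
      (T f : RGV E G V) = actV E G V (momentMap E G N u) f := by
  constructor
  · rintro ⟨_, ⟨_, ⟨u, hu, rfl⟩, rfl⟩, h⟩
    exact ⟨u, hu, h⟩
  · rintro ⟨u, hu, h⟩
    exact ⟨_, ⟨_, ⟨u, hu, rfl⟩, rfl⟩, h⟩

variable [FiniteDimensional ℝ E] [ConnectedSpace G]

theorem Imu_le_Jmu : Imu E π ≤ Jmu E π := fun T hT => by
  obtain ⟨u, hu, h⟩ := mem_Imu.1 hT
  exact mem_Jmu.2 ⟨u, centerLeft_le_gaugeInvariants hu, h⟩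

theorem Imu_commute_Jmu {S T : Module.End ℂ (Rmu E π)} (hS : S ∈ Imu E π) (hT : T ∈ Jmu E π) :
    Commute S T := by
  obtain ⟨u, hu, h⟩ := mem_Imu.1 hS
  obtain ⟨v, hv, h'⟩ := mem_Jmu.1 hT
  refine LinearMap.ext fun f => Subtype.ext ?_
  rw [Module.End.mul_apply, Module.End.mul_apply, h, h', h', h, ← Module.End.mul_apply,
    ← Module.End.mul_apply, ← map_mul, ← map_mul, ← map_mul, ← map_mul,
    Subalgebra.mem_center_iff.1 (centerLeft_le_center hu) v]

theorem Jmu_le_ZIA : Jmu E π ≤ ZIA E π := fun T hT => by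
  refine ⟨fun S hS => (Imu_commute_Jmu hS hT).eq, ?_⟩
  obtain ⟨u, hu, h⟩ := mem_Jmu.1 hT
  exact ⟨_, ⟨_, momentMap_mem_invDiffOpsOn hu, rfl⟩, h⟩

variable [∀ i, FiniteDimensional ℂ (V i)]

/-- Quantum integrals preserve `𝓡_μ`. -/
theorem actV_momentMap_mem_Rmu {u : ⨂[ℂ] _ : Fin N, UgUg E G} (hu : u ∈ gaugeInvariants E G N)
    {f : RGV E G V} (hf : f ∈ Rmu E π) : actV E G V (momentMap E G N u) f ∈ Rmu E π := fun h => by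
  rw [gaugeRepV_actV, momentMap_gaugeAd hu, hf h]

variable (E π) in
/-- The quantum integral on `𝓡_μ` given by a gauge invariant element of `(U𝔤 ⊗ U𝔤)^{⊗N}`. -/
def integral {u : ⨂[ℂ] _ : Fin N, UgUg E G} (hu : u ∈ gaugeInvariants E G N) :
    Module.End ℂ (Rmu E π) :=
  (actV E G V (momentMap E G N u)).restrict fun _ hf => actV_momentMap_mem_Rmu hu hf

variable (E π) in
/-- The quantum Hamiltonian on `𝓡_μ` given by a central element of `U𝔤` in one factor. The antipode
turns the action of the center in the right factors into the one in the left factors. -/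
def hamiltonian (p : Fin N × Subalgebra.center ℂ (Ug E G)) : Module.End ℂ (Rmu E π) :=
  integral E π (centerLeft_le_gaugeInvariants
    (inL_mem_centerLeft (N := N) p.1 (antipode_mem_center p.2.2)))

theorem hamiltonian_mem_Imu (p : Fin N × Subalgebra.center ℂ (Ug E G)) :
    hamiltonian E π p ∈ Imu E π :=
  mem_Imu.2 ⟨_, inL_mem_centerLeft p.1 (antipode_mem_center p.2.2), fun _ => rfl⟩

theorem hamiltonian_apply {ν : Fin N → IrrClass E G} (p : Fin N × Subalgebra.center ℂ (Ug E G))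
    {f : Rmu E π} (hf : f ∈ block E π ν) : hamiltonian E π p f = blockChar ν p • f := by
  refine Subtype.ext ?_
  change actV E G V (momentMap E G N (inL p.1 (antipode p.2.1))) f.1 = blockChar ν p • f.1
  rw [momentMap_inL, momentL_antipode p.1 p.2.2]
  exact actV_momentR hf p

theorem isStable_block (ν : Fin N → IrrClass E G) : IsStable (Jmu E π) (block E π ν) := by
  intro T hT f hf
  obtain ⟨u, hu, h⟩ := mem_Jmu.1 hT
  change (T f : RGV E G V) ∈ RGVblock E V ν
  rw [h]
  exact actV_momentMap_mem_RGVblock hf u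

variable (E π) in
/-- The inclusion of `𝓡_μ^{(ν)}` into `𝓡^{(ν)}(G^N) ⊗ V_{μ_1} ⊗ ⋯ ⊗ V_{μ_N}`. -/
def blockIncl (ν : Fin N → IrrClass E G) : block E π ν →ₗ[ℂ] RGVblock E V ν :=
  ((Rmu E π).subtype ∘ₗ (block E π ν).subtype).codRestrict _ fun f => f.2

instance finiteDimensional_block (ν : Fin N → IrrClass E G) :
    FiniteDimensional ℂ (block E π ν) :=
  FiniteDimensional.of_injective (blockIncl E π ν) fun _ _ h =>
    Subtype.ext (Subtype.ext (congrArg (fun f => f.1) h))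

variable [CompactSpace G]

theorem iSupIndep_block : iSupIndep (block E π) :=
  iSupIndep_of_apply_eq_smul (M := Rmu E π) (W := fun ν => block E π ν)
    (fun p : Fin N × Subalgebra.center ℂ (Ug E G) => hamiltonian E π p)
    blockChar blockChar_injective fun _ p _ hf => hamiltonian_apply p hf

theorem iSup_block : ⨆ ν, block E π ν = ⊤ :=
  iSup_comap_invariants (ρ := gaugeRepV E π) iSupIndep_RGVblock iSup_RGVblock
    fun _ g _ hw => gaugeRepV_mem_RGVblock hw g

/-- The blocks are the full joint eigenspaces of the Hamiltonians. -/
theorem mem_block_of_forall_hamiltonian {ν : Fin N → IrrClass E G} {f : Rmu E π}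
    (hf : ∀ p, hamiltonian E π p f = blockChar ν p • f) : f ∈ block E π ν :=
  mem_of_forall_apply_eq_smul (M := Rmu E π) (B := fun ν => block E π ν)
    (T := fun p : Fin N × Subalgebra.center ℂ (Ug E G) => hamiltonian E π p)
    blockChar_injective (fun _ p _ hf => hamiltonian_apply p hf) iSup_block hf

/-- Operators commuting with the Hamiltonians preserve their joint eigenspaces. -/
theorem isStable_ZIA_block (ν : Fin N → IrrClass E G) : IsStable (ZIA E π) (block E π ν) := by
  intro T hT f hf
  refine mem_block_of_forall_hamiltonian fun p => ?_
  have e : hamiltonian E π p (T f) = T (hamiltonian E π p f) :=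
    LinearMap.congr_fun (hT.1 _ (hamiltonian_mem_Imu p)) f
  rw [e, hamiltonian_apply p hf, map_smul]

/-- A Hamiltonian acting by `1` on one block and by `0` on the other shows that they are not
isomorphic. -/
theorem not_areIsomorphic_block {ν ν' : Fin N → IrrClass E G} (hν : ν ≠ ν')
    (h0 : block E π ν' ≠ ⊥) : ¬ AreIsomorphic (Jmu E π) (block E π ν) (block E π ν') := by
  rintro ⟨e, he⟩
  obtain ⟨p, h1, h2⟩ := exists_blockChar hν.symm
  refine h0 ((Submodule.eq_bot_iff _).2 fun f hf => ?_)
  have hv := he _ (Imu_le_Jmu (hamiltonian_mem_Imu p)) (e.symm ⟨f, hf⟩) 0 (by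
    rw [hamiltonian_apply p (e.symm ⟨f, hf⟩).2, h2, zero_smul]; rfl)
  rw [map_zero, LinearEquiv.apply_symm_apply, hamiltonian_apply p hf, h1, one_smul] at hv
  exact hv.symm

theorem exists_Jmu_apply_eq (hirr : ∀ i, (π i).IsIrreducible) {ν : Fin N → IrrClass E G}
    (f : Rmu E π) (hf : f ∈ block E π ν) (f' : Rmu E π) (hf' : f' ∈ block E π ν) (h0 : f ≠ 0) :
    ∃ T ∈ Jmu E π, T f = f' := by
  obtain ⟨u, hu, h⟩ := exists_gaugeInvariant_apply_eq hirr f.2 f'.2 hf hf'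
    fun h => h0 (Subtype.ext h)
  exact ⟨integral E π hu, mem_Jmu.2 ⟨u, hu, fun _ => rfl⟩, Subtype.ext h⟩

theorem inducedOps_Jmu_eq_top (hirr : ∀ i, (π i).IsIrreducible) (ν : Fin N → IrrClass E G) :
    inducedOps (Jmu E π) (block E π ν) = ⊤ :=
  inducedOps_eq_top (isStable_block ν) (exists_Jmu_apply_eq hirr)

theorem exists_character_block (hirr : ∀ i, (π i).IsIrreducible) {ν : Fin N → IrrClass E G}
    (h0 : block E π ν ≠ ⊥) : ∃ χ : Imu E π →ₐ[ℂ] ℂ,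
      ∀ f, f ∈ block E π ν ↔ ∀ T : Imu E π, T.1 f = χ T • f := by
  obtain ⟨χ, hχ⟩ := exists_character (fun T hT => isStable_block ν T (Imu_le_Jmu hT)) h0
    (inducedOps_Jmu_eq_top hirr ν) fun S hS T hT => Imu_commute_Jmu hS hT
  refine ⟨χ, fun f => ⟨fun hf T => hχ T f hf, fun h => mem_block_of_forall_hamiltonian fun p => ?_⟩⟩
  obtain ⟨f₀, hf₀, hne⟩ := Submodule.exists_mem_ne_zero_of_ne_bot h0
  have e : χ ⟨_, hamiltonian_mem_Imu p⟩ = blockChar ν p :=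
    smul_left_injective ℂ hne ((hχ ⟨_, hamiltonian_mem_Imu p⟩ f₀ hf₀).symm.trans
      (hamiltonian_apply p hf₀))
  rw [← e]
  exact h ⟨_, hamiltonian_mem_Imu p⟩

end Blocks

end

end SpinChain

theorem mainTheorem2 {E : Type*} [NormedAddCommGroup E] [NormedSpace ℝ E] [FiniteDimensional ℝ E]
    {G : Type*} [TopologicalSpace G] [ChartedSpace E G] [Group G] [LieGroup 𝓘(ℝ, E) ∞ G]
    [T2Space G] [CompactSpace G] [SimplyConnectedSpace G]
    [LieAlgebra.IsSimple ℝ (GroupLieAlgebra 𝓘(ℝ, E) G)]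
    {N : ℕ} [NeZero N] {V : Fin N → Type*} [∀ i, AddCommGroup (V i)] [∀ i, Module ℂ (V i)]
    [∀ i, FiniteDimensional ℂ (V i)] (π : ∀ i, Representation ℂ G (V i))
    (hsmooth : ∀ i, IsSmoothRep 𝓘(ℝ, E) (π i)) (hirr : ∀ i, (π i).IsIrreducible) :
    -- the chain of algebras of quantum Hamiltonians, quantum integrals and observables
    (Imu E π ≤ Jmu E π ∧ Jmu E π ≤ ZIA E π ∧ ZIA E π ≤ Amu E π) ∧
    -- the space of states is the direct sum of the blocks
    (iSupIndep (block E π) ∧ ⨆ ν, block E π ν = ⊤) ∧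
    -- the nonzero blocks are joint eigenspaces of the quantum Hamiltonians
    (∀ ν, block E π ν ≠ ⊥ → ∃ χ : Imu E π →ₐ[ℂ] ℂ,
      ∀ f, f ∈ block E π ν ↔ ∀ T : Imu E π, T.1 f = χ T • f) ∧
    -- the nonzero blocks are irreducible and pairwise non-isomorphic modules
    (∀ ν, block E π ν ≠ ⊥ → IsIrreducibleSubmodule (Jmu E π) (block E π ν)) ∧
    (∀ ν ν', ν ≠ ν' → block E π ν ≠ ⊥ → block E π ν' ≠ ⊥ →
      ¬ AreIsomorphic (Jmu E π) (block E π ν) (block E π ν')) ∧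
    -- the quantum integrals and the centralizer of the Hamiltonians agree on every block
    (∀ ν, IsStable (ZIA E π) (block E π ν)) ∧
    ∀ ν, inducedOps (Jmu E π) (block E π ν) = inducedOps (ZIA E π) (block E π ν) := by
  have : CompleteSpace E := FiniteDimensional.complete ℝ E
  refine ⟨⟨Imu_le_Jmu, Jmu_le_ZIA, inf_le_right⟩, ⟨iSupIndep_block, iSup_block⟩,
    fun ν h0 => exists_character_block hirr h0,
    fun ν h0 => isIrreducibleSubmodule_of_transitive (isStable_block ν) h0
      (exists_Jmu_apply_eq hirr),
    fun ν ν' hν _ h0 => not_areIsomorphic_block hν h0, isStable_ZIA_block, fun ν => ?_⟩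
  exact (inducedOps_Jmu_eq_top hirr ν).trans (eq_top_iff.2
    ((inducedOps_Jmu_eq_top hirr ν).ge.trans (inducedOps_mono Jmu_le_ZIA))).symm
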